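/- Let $\mathbb S^2\subset\mathbb R^3$ be the round unit sphere and $\rho$ its uniform probability measure. For each $n$ let $\{Y_k\}_{-n\le k\le n}=\{Y_{n,k}\}$ be any real orthonormal basis, in $L^2(\mathbb S^2,\rho)$, of the space of spherical harmonics of degree $n$ (restrictions to $\mathbb S^2$ of homogeneous harmonic polynomials of degree $n$). Let $$f_n=\frac1{\sqrt{2n+1}}\sum_{k=-n}^n a_{k}Y_{k},$$ where, for each $n$, the $a_k=a_{n,k}$ are i.i.d. real random variables on a probability space $(\Omega,\mathbb P)$ with a law that does not depend on $n$, $\mathbb E[a_k]=0$ and $\mathbb E[a_k^2]=1$ (for example, a fixed i.i.d. sequence $(a_k)_{k\in\mathbb Z}$). Fix $R>0$. For each $x\in\mathbb S^2$ identify $T_x\mathbb S^2$ isometrically with $\mathbb R^2$, let $\exp_x:\mathbb R^2\cong T_x\mathbb S^2\to\mathbb S^2$ be the exponential map, and put $F_x(y)=f_n(\exp_x(Ry/n))$ for $y$ in the closed unit disk of $\mathbb R^2$. Nodal domains are the connected components of the zero set. Let $\mathcal N(F_x)$ be the number of nodal domains of $F_x$ that are fully contained in the open unit disk (equivalently, that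 do not meet its boundary). Let $F_\mu$ be the Gaussian monochromatic random plane wave, that is, the centred stationary Gaussian field on $\mathbb R^2$ with continuous sample paths and covariance $$\mathbb E[F_\mu(x)F_\mu(y)]=\int_{\mathbb S^1}e^{i\langle s,x-y\rangle}\,d\mu(s),$$ where $\mu$ is the uniform probability measure on the unit circle $\mathbb S^1$; and let $\mathcal N(F_\mu,R)$ be the number of nodal domains of $F_\mu$ that are fully contained in the open disk $B(R)$ of radius $R$ centred at the origin. Both counts are a priori elements of $\{0,1,2,\dots\}\cup\{\infty\}\subset[0,\infty]$. Then $\mathcal N(F_\mu,R)$ is almost surely finite and, for every fixed $R>0$, the random variables $(\omega,x)\mapsto\mathcal N(F_x)$ on $\Omega\times\mathbb S^2$, equipped with the product probability measure $\mathbb P\otimes\rho$, converge in distribution to $\mathcal N(F_\mu,R)$ as $n\to\infty$. -/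

import Mathlib

open MeasureTheory ProbabilityTheory Filter
open scoped ENNReal Topology

namespace NodalUniversality

noncomputable section

/-- The Euclidean plane `ℝ²`. -/
abbrev Plane : Type := EuclideanSpace ℝ (Fin 2)

/-- The Euclidean space `ℝ³`. -/
abbrev Space : Type := EuclideanSpace ℝ (Fin 3)

/-- The unit sphere `S² ⊆ ℝ³`. -/
abbrev S2 : Type := Metric.sphere (0 : Space) 1

/-! ### Uniform probability measures on spheres -/

/-- The uniform (rotation invariant, surface area) probability measure on the unit sphere of a
Euclidean space. -/
def uniformSphere (E : Type*) [NormedAddCommGroup E] [InnerProductSpace ℝ E]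
    [FiniteDimensional ℝ E] [MeasurableSpace E] [BorelSpace E] :
    Measure (Metric.sphere (0 : E) 1) :=
  ((volume : Measure E).toSphere Set.univ)⁻¹ • (volume : Measure E).toSphere

instance uniformSphere.instIsProbabilityMeasure (E : Type*) [NormedAddCommGroup E]
    [InnerProductSpace ℝ E] [FiniteDimensional ℝ E] [MeasurableSpace E] [BorelSpace E]
    [Nontrivial E] : IsProbabilityMeasure (uniformSphere E) := by
  refine ⟨?_⟩
  have h : (volume : Measure E).toSphere ≠ 0 := Measure.toSphere_ne_zero _
  rw [uniformSphere, Measure.smul_apply, smul_eq_mul]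
  exact ENNReal.inv_mul_cancel (fun h0 => h (Measure.measure_univ_eq_zero.1 h0))
    (measure_ne_top _ _)

/-- The uniform probability measure `ρ` on `S²`. -/
abbrev rho : Measure S2 := uniformSphere Space

/-- The uniform probability measure on the unit circle `S¹ ⊆ ℝ²`, as a measure on `ℝ²`. -/
def unitCircleMeasure : Measure Plane := (uniformSphere Plane).map Subtype.val

/-! ### Spherical harmonics -/

/-- The Laplacian `∂₀² + ∂₁² + ∂₂²` on polynomials in three variables. -/
def polyLaplacian (p : MvPolynomial (Fin 3) ℝ) : MvPolynomial (Fin 3) ℝ :=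
  ∑ i, MvPolynomial.pderiv i (MvPolynomial.pderiv i p)

/-- The spherical harmonics of degree `n`: the restrictions to `S²` of the homogeneous harmonic
polynomials of degree `n`. -/
def sphericalHarmonics (n : ℕ) : Set (S2 → ℝ) :=
  {f | ∃ p : MvPolynomial (Fin 3) ℝ, p.IsHomogeneous n ∧ polyLaplacian p = 0 ∧
    ∀ x : S2, f x = MvPolynomial.eval (fun i => (x : Space) i) p}

/-- The index set `{-n, …, n}`. -/
abbrev Idx (n : ℕ) : Type := Set.Icc (-(n : ℤ)) (n : ℤ)

/-- `(Y_k)_{-n ≤ k ≤ n}` is a (real) orthonormal basis of the spherical harmonics of degree `n`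
with respect to the inner product of `L²(S², ρ)`. -/
structure IsHarmonicONB (n : ℕ) (Y : Idx n → S2 → ℝ) : Prop where
  orthonormal : ∀ k l, ∫ x, Y k x * Y l x ∂rho = if k = l then 1 else 0
  span_eq : (Submodule.span ℝ (Set.range Y) : Set (S2 → ℝ)) = sphericalHarmonics n

/-- The random spherical harmonic `f_n = (2n+1)^{-1/2} ∑_{k=-n}^{n} a_k Y_k`. -/
def randomHarmonic {Ω : Type*} (n : ℕ) (a : Idx n → Ω → ℝ) (Y : Idx n → S2 → ℝ)
    (ω : Ω) (x : S2) : ℝ :=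
  (√(2 * (n : ℝ) + 1))⁻¹ * ∑ k, a k ω * Y k x

/-! ### The exponential map of the sphere and the local rescaling -/

/-- The tangent plane `T_x S²`, i.e. the orthogonal complement of `x` in `ℝ³` with the induced
inner product. -/
abbrev TangentPlane (x : S2) : Type := (ℝ ∙ (x : Space))ᗮ

theorem norm_sphereExp (x : S2) (v : TangentPlane x) :
    ‖Real.cos ‖v‖ • (x : Space) + Real.sinc ‖v‖ • (v : Space)‖ = 1 := by
  have hx : ‖(x : Space)‖ = 1 := norm_eq_of_mem_sphere x
  have hxv : inner ℝ (x : Space) (v : Space) = 0 :=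
    Submodule.mem_orthogonal_singleton_iff_inner_right.1 v.2
  have hs : Real.sinc ‖v‖ * ‖(v : Space)‖ = Real.sin ‖v‖ := by
    rw [Submodule.norm_coe]
    by_cases h : ‖v‖ = 0
    · simp [h]
    · rw [Real.sinc_of_ne_zero h]
      field_simp
  have h2 : ‖Real.cos ‖v‖ • (x : Space) + Real.sinc ‖v‖ • (v : Space)‖ ^ 2 = 1 := by
    rw [norm_add_sq_real, inner_smul_left, inner_smul_right, hxv, norm_smul, norm_smul, hx,
      mul_pow, mul_pow, Real.norm_eq_abs, Real.norm_eq_abs, sq_abs, sq_abs, ← mul_pow (Real.sinc _),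
      hs]
    simp
  nlinarith [norm_nonneg (Real.cos ‖v‖ • (x : Space) + Real.sinc ‖v‖ • (v : Space))]

/-- The Riemannian exponential map `exp_x : T_x S² → S²` of the round unit sphere: `exp_x v` is the
endpoint of the great circle arc of length `‖v‖` issued from `x` in the direction of `v`, that is
`exp_x v = cos ‖v‖ x + (sin ‖v‖ / ‖v‖) v`. -/
def sphereExp (x : S2) (v : TangentPlane x) : S2 :=
  ⟨Real.cos ‖v‖ • (x : Space) + Real.sinc ‖v‖ • (v : Space), by
    rw [mem_sphere_zero_iff_norm]; exact norm_sphereExp x v⟩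

/-- The rescaled function `F_x(y) = f(exp_x(R y / n))`, where `e` is the isometric identification
`ℝ² ≅ T_x S²` in use. It is only considered for `y` in the closed unit disk. -/
def localField (n : ℕ) (R : ℝ) (f : S2 → ℝ) (x : S2) (e : Plane ≃ₗᵢ[ℝ] TangentPlane x)
    (y : Plane) : ℝ :=
  f (sphereExp x (e ((R / (n : ℝ)) • y)))

/-! ### Nodal domains -/

/-- The nodal domains of a function `g` considered on the set `D`: the connected components of the
zero set `{y ∈ D | g y = 0}`. -/
def nodalDomains (D : Set Plane) (g : Plane → ℝ) : Set (Set Plane) :=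
  (fun y => connectedComponentIn {z ∈ D | g z = 0} y) '' {z ∈ D | g z = 0}

/-- The number (possibly `∞`) of nodal domains of `g` on `D` that are fully contained in the open
ball `B(r)` centred at the origin. -/
def nodalCount (D : Set Plane) (g : Plane → ℝ) (r : ℝ) : ℕ∞ :=
  {Γ ∈ nodalDomains D g | Γ ⊆ Metric.ball 0 r}.encard

/-- `𝒩(F_x)`: the number of nodal domains of `F_x`, as a function on the closed unit disk, that do
not meet the boundary of the disk. -/
def localCount (n : ℕ) (R : ℝ) (f : S2 → ℝ) (x : S2) (e : Plane ≃ₗᵢ[ℝ] TangentPlane x) : ℕ∞ :=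
  nodalCount (Metric.closedBall 0 1) (localField n R f x e) 1

/-- `𝒩(g, R)`: the number of nodal domains of a function `g` on `ℝ²` that are fully contained in
`B(R)`. -/
def planarCount (g : Plane → ℝ) (R : ℝ) : ℕ∞ := nodalCount Set.univ g R

/-! ### The Gaussian monochromatic random plane wave -/

/-- `F` is the monochromatic random plane wave: the centred Gaussian field on `ℝ²` with continuous
sample paths whose spectral measure is the uniform probability measure `μ` on the unit circle,
`E[F(x) F(y)] = ∫ exp(i ⟨s, x - y⟩) dμ(s)`. Stationarity is automatic. -/
structure IsRandomPlaneWave {Ω : Type*} [MeasurableSpace Ω] (F : Plane → Ω → ℝ)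
    (P : Measure Ω) : Prop where
  gaussian : IsGaussianProcess F P
  centered : ∀ x, ∫ ω, F x ω ∂P = 0
  covariance : ∀ x y, ((∫ ω, F x ω * F y ω ∂P : ℝ) : ℂ) = charFun unitCircleMeasure (x - y)
  continuous : ∀ ω, Continuous fun x => F x ω

end

end NodalUniversality

/-!
The convergence follows from three facts about the rescaled fields `F_x(y) = f_n(exp_x(R y / n))`,
regarded as random functions on the disk of radius `2` under `P ⊗ ρ`: their finite-dimensional
distributions converge to those of `y ↦ F_μ(R y)`, they are tight in a compact class of `C^{1,1}`
functions, and on this class the number of nodal domains is continuous at almost every sample of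
the limit.

*Stability.* `smoothClass M` is a ball of `C^{1,1}`, described by first order expansions with
quadratic error so that it is compact for pointwise convergence. If `f` in the class has no
critical zero in the closed unit disk and its zero set is nowhere tangent to the unit circle, then
its zero set is locally a graph, uniformly over the functions of the class near `f`; by compactness
`f` has finitely many nodal domains and nearby functions have the same number of those that avoid
the circle (`nodalCount_stable`). A Gaussian field in the class has this regularity almost surely by
Bulinskaya's argument on a fine grid (`measure_not_regular_eq_zero`). The portmanteau inequality,
extended from marginals to closed subsets of the class, then gives the convergence of the counts
(`nodalCount_limit`). Counts are measurable because components of a compact set are separated by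
relatively clopen sets, which can be taken from a countable family
(`le_encard_innerComponents_iff`).

*Finite-dimensional distributions.* For a fixed base point `x`, a linear combination of values of
`F_x` is a sum `∑ b_k a_k` of independent variables, so its law is nearly Gaussian as soon as all the
weights `b_k` are small and `∑ b_k²` converges. The sum `∑ b_k²` is expressed by the kernel
`∑ Y_k(x) Y_k(y)`, which is invariant under isometries, hence zonal, and therefore equal to `2n+1`
times a solution of the Legendre equation in the angle. An energy estimate compares this solution
near the pole with `J₀(n θ)` (`IsLegendre.sq_sub_bessel_le`), which is the covariance of the plane
wave; this is `eventually_kernel_close`. Smallness of the weights can fail at particular base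
points for particular bases, but only on a set of vanishing measure (`tendsto_rho_large`): by
Sonine's estimate the kernel is small away from the diagonal and the antidiagonal, so by duality a
basis function can be of order `√n` only on boundedly many double caps of radius of order `1/n`.
Averaging over `x` gives `tendsto_integral_exp_localField`.

*Tightness.* `f_n` is the restriction of a random homogeneous polynomial, a combination of harmonic
polynomials `q_k` with `∑ q_k² = ‖x‖^(2n)`. Since `Δ ∑ q_k² = 2 ∑ |∇ q_k|²`, iteration bounds the
second moments of the derivatives of order `m` by powers `n ^ (2m)`, up to `C ^ m`
(`sum_derivSqSum_le`). Taylor's formula at the base point then bounds `F_x` in the class, in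
mean and uniformly in `n` (`exists_eventually_cutoff_localField`).
-/

namespace NodalUniversality

noncomputable section

/-! ### Counting components with separating open sets -/

/-- The components of `K` contained in the open ball of radius `r`. -/
def innerComponents (K : Set Plane) (r : ℝ) : Set (Set Plane) :=
  {Γ ∈ (fun y => connectedComponentIn K y) '' K | Γ ⊆ Metric.ball 0 r}

/-- Finite unions of open balls taken from a countable basis, indexed by finite sets. -/
def basisOpen (s : Finset (ℕ × ℕ)) : Set Plane :=
  ⋃ p ∈ s, Metric.ball (TopologicalSpace.denseSeq Plane p.1) (1 / ((p.2 : ℝ) + 1))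

/-- The union of the closed balls corresponding to `basisOpen s`. -/
def basisClosed (s : Finset (ℕ × ℕ)) : Set Plane :=
  ⋃ p ∈ s, Metric.closedBall (TopologicalSpace.denseSeq Plane p.1) (1 / ((p.2 : ℝ) + 1))

theorem isOpen_basisOpen (s : Finset (ℕ × ℕ)) : IsOpen (basisOpen s) :=
  isOpen_biUnion fun _ _ => Metric.isOpen_ball

theorem isCompact_basisClosed (s : Finset (ℕ × ℕ)) : IsCompact (basisClosed s) :=
  s.isCompact_biUnion fun _ _ => isCompact_closedBall _ _

theorem basisOpen_subset_basisClosed (s : Finset (ℕ × ℕ)) : basisOpen s ⊆ basisClosed s :=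
  Set.iUnion₂_mono fun _ _ => Metric.ball_subset_closedBall

/-- A compact set and a disjoint closed set are separated by one of countably many open sets. -/
theorem exists_basis_separation {C T : Set Plane} (hC : IsCompact C) (hT : IsClosed T)
    (h : Disjoint C T) : ∃ s, C ⊆ basisOpen s ∧ Disjoint (basisClosed s) T := by
  classical
  have key : ∀ x ∈ C, ∃ p : ℕ × ℕ,
      x ∈ Metric.ball (TopologicalSpace.denseSeq Plane p.1) (1 / ((p.2 : ℝ) + 1)) ∧
      Disjoint (Metric.closedBall (TopologicalSpace.denseSeq Plane p.1) (1 / ((p.2 : ℝ) + 1))) T := by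
    intro x hx
    have hxT : Tᶜ ∈ 𝓝 x := hT.isOpen_compl.mem_nhds fun hxT => Set.disjoint_left.1 h hx hxT
    obtain ⟨ε, hε, hsub⟩ := Metric.mem_nhds_iff.1 hxT
    obtain ⟨j, hj⟩ := exists_nat_one_div_lt (show 0 < ε / 2 by positivity)
    have hj0 : 0 < 1 / ((j : ℝ) + 1) := Nat.one_div_pos_of_nat
    obtain ⟨i, hi⟩ := (TopologicalSpace.denseRange_denseSeq Plane).exists_dist_lt x hj0
    refine ⟨(i, j), hi, Set.disjoint_left.2 fun y hy hyT => ?_⟩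
    refine hsub (?_ : y ∈ Metric.ball x ε) hyT
    rw [Metric.mem_ball]
    rw [Metric.mem_closedBall] at hy
    have := dist_triangle y (TopologicalSpace.denseSeq Plane i) x
    rw [dist_comm (TopologicalSpace.denseSeq Plane i) x] at this
    simp only at hy
    linarith
  choose! p hp1 hp2 using key
  obtain ⟨t, hCt⟩ := hC.elim_nhds_subcover'
    (fun x hx => Metric.ball (TopologicalSpace.denseSeq Plane (p x).1) (1 / (((p x).2 : ℝ) + 1)))
    (fun x hx => Metric.isOpen_ball.mem_nhds (hp1 x hx))
  refine ⟨t.image fun x : C => p (x : Plane), ?_, ?_⟩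
  · intro y hy
    obtain ⟨x, hx, hyx⟩ := Set.mem_iUnion₂.1 (hCt hy)
    exact Set.mem_iUnion₂.2 ⟨p x, Finset.mem_image_of_mem _ hx, hyx⟩
  · rw [basisClosed, Set.disjoint_iUnion₂_left]
    intro q hq
    obtain ⟨x, hx, rfl⟩ := Finset.mem_image.1 hq
    exact hp2 x x.2

/-- In a compact Hausdorff space components are intersections of clopen sets, so a component that
misses a closed set can be separated from it by a relatively clopen set. -/
theorem exists_clopen_separation {X : Type*} [TopologicalSpace X] [T2Space X] {K S : Set X}
    (hK : IsCompact K) (hS : IsClosed S) {x : X} (hx : x ∈ K)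
    (h : Disjoint (connectedComponentIn K x) S) :
    ∃ C ⊆ K, x ∈ C ∧ IsCompact C ∧ IsCompact (K \ C) ∧ Disjoint C S := by
  classical
  have : CompactSpace K := isCompact_iff_compactSpace.1 hK
  have hcc : connectedComponentIn K x = ((↑) : K → X) '' connectedComponent (⟨x, hx⟩ : K) :=
    connectedComponentIn_eq_image hx
  have hS' : IsCompact (((↑) : K → X) ⁻¹' S) := (hS.preimage continuous_subtype_val).isCompact
  have hemp : ¬ (((↑) : K → X) ⁻¹' S ∩
      ⋂ s : { s : Set K // IsClopen s ∧ (⟨x, hx⟩ : K) ∈ s }, (s : Set K)).Nonempty := by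
    rw [← connectedComponent_eq_iInter_isClopen]
    rintro ⟨y, hyS, hyC⟩
    exact Set.disjoint_left.1 h (hcc ▸ Set.mem_image_of_mem _ hyC) hyS
  have := mt (hS'.inter_iInter_nonempty
    (fun s : { s : Set K // IsClopen s ∧ (⟨x, hx⟩ : K) ∈ s } => (s : Set K))
    (fun s => s.2.1.1)) hemp
  push Not at this
  obtain ⟨u, hu⟩ := this
  have hclop : IsClopen (⋂ i ∈ u, (i : Set K)) :=
    u.finite_toSet.isClopen_biInter fun i _ => i.2.1
  refine ⟨((↑) : K → X) '' ⋂ i ∈ u, (i : Set K), Subtype.coe_image_subset _ _,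
    ⟨⟨x, hx⟩, Set.mem_iInter₂.2 fun i _ => i.2.2, rfl⟩,
    hclop.1.isCompact.image continuous_subtype_val, ?_, ?_⟩
  · have : K \ ((↑) : K → X) '' (⋂ i ∈ u, (i : Set K)) =
        ((↑) : K → X) '' (⋂ i ∈ u, (i : Set K))ᶜ := by
      ext y
      constructor
      · rintro ⟨hy, hn⟩
        exact ⟨⟨y, hy⟩, fun h' => hn ⟨_, h', rfl⟩, rfl⟩
      · rintro ⟨z, hz, rfl⟩
        refine ⟨z.2, ?_⟩
        rintro ⟨w, hw, hwz⟩
        exact hz (Subtype.ext hwz ▸ hw)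
    rw [this]
    exact hclop.compl.1.isCompact.image continuous_subtype_val
  · rw [Set.disjoint_left]
    rintro _ ⟨y, hy, rfl⟩ hyS
    exact Set.notMem_empty y (hu ▸ ⟨hyS, hy⟩)

/-- A compact set has at least `k` components inside the ball iff it contains `k` nonempty pieces,
each cut out inside the ball by an open set whose boundary layer misses the compact set. The open
sets range over a countable family, so that the condition is measurable in a random `K`. -/
theorem le_encard_innerComponents_iff {K : Set Plane} (hK : IsCompact K) (r : ℝ) (k : ℕ) :
    (k : ℕ∞) ≤ (innerComponents K r).encard ↔ ∃ s : Fin k → Finset (ℕ × ℕ),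
      (∀ i, basisClosed (s i) ⊆ Metric.ball 0 r ∧
        Disjoint K (basisClosed (s i) \ basisOpen (s i)) ∧ (K ∩ basisClosed (s i)).Nonempty) ∧
      ∀ i j, i ≠ j → Disjoint K (basisClosed (s i) ∩ basisClosed (s j)) := by
  classical
  constructor
  · intro hk
    obtain ⟨t, ht, htk⟩ := Set.exists_subset_encard_eq hk
    have hfin : t.Finite := Set.finite_of_encard_eq_coe htk
    have hcard : hfin.toFinset.card = k := by
      rw [hfin.encard_eq_coe_toFinset_card] at htk
      exact_mod_cast htk
    let e := (hfin.toFinset.equivFinOfCardEq hcard).symm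
    have he : ∀ i, (e i : Set Plane) ∈ innerComponents K r := fun i =>
      ht (hfin.mem_toFinset.1 (e i).2)
    choose x hxK hx using fun i => (he i).1
    have hinj : ∀ i j, i ≠ j → x j ∉ connectedComponentIn K (x i) := by
      intro i j hij hmem
      apply hij
      apply e.injective
      apply Subtype.ext
      rw [← hx i, ← hx j]
      exact connectedComponentIn_eq hmem
    have hsep : ∀ i, ∃ C ⊆ K, x i ∈ C ∧ IsCompact C ∧ IsCompact (K \ C) ∧
        Disjoint C ((Metric.ball 0 r)ᶜ ∪ x '' {j | j ≠ i}) := by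
      intro i
      refine exists_clopen_separation hK
        (Metric.isOpen_ball.isClosed_compl.union (Set.toFinite _).isClosed) (hxK i) ?_
      rw [Set.disjoint_union_right]
      constructor
      · rw [Set.disjoint_compl_right_iff_subset]
        have h : connectedComponentIn K (x i) = e i := hx i
        rw [h]
        exact (he i).2
      · rw [Set.disjoint_right]
        rintro _ ⟨j, hj, rfl⟩ hmem
        exact hinj i j (Ne.symm hj) hmem
    choose C hCK hxC hCc hKC hCd using hsep
    -- Each clopen piece excludes the base points of the other components, but two of them may
    -- overlap; remove from each the other ones.
    let D : Fin k → Set Plane := fun i => C i ∩ ⋂ j ∈ {j | j ≠ i}, (K \ C j)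
    have hD1 : ∀ i, IsCompact (D i) := fun i =>
      (hCc i).inter_right (isClosed_biInter fun j _ => (hKC j).isClosed)
    have hD2 : ∀ i, IsClosed (K \ D i) := by
      intro i
      have : K \ D i = (K \ C i) ∪ ⋃ j ∈ {j | j ≠ i}, C j := by
        ext y
        simp only [D, Set.mem_sdiff, Set.mem_inter_iff, Set.mem_iInter, Set.mem_union,
          Set.mem_iUnion, Set.mem_ofPred_eq]
        constructor
        · rintro ⟨hy, hn⟩
          by_cases hc : y ∈ C i
          · right
            by_contra hcon
            push Not at hcon
            exact hn ⟨hc, fun j hj => ⟨hy, hcon j hj⟩⟩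
          · exact Or.inl ⟨hy, hc⟩
        · rintro (⟨hy, hn⟩ | ⟨j, hj, hyj⟩)
          · exact ⟨hy, fun h' => hn h'.1⟩
          · exact ⟨hCK j hyj, fun h' => (h'.2 j hj).2 hyj⟩
      rw [this]
      exact (hKC i).isClosed.union (Set.Finite.isClosed_biUnion (Set.toFinite _)
        fun j _ => (hCc j).isClosed)
    have hxD : ∀ i, x i ∈ D i := by
      intro i
      refine ⟨hxC i, Set.mem_iInter₂.2 fun j hj => ⟨hxK i, fun hm => ?_⟩⟩
      exact Set.disjoint_left.1 (hCd j) hm (Or.inr ⟨i, Ne.symm hj, rfl⟩)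
    have hs : ∀ i, ∃ s, D i ⊆ basisOpen s ∧
        Disjoint (basisClosed s) ((K \ D i) ∪ (Metric.ball 0 r)ᶜ) := by
      intro i
      refine exists_basis_separation (hD1 i) ((hD2 i).union Metric.isOpen_ball.isClosed_compl) ?_
      rw [Set.disjoint_union_right]
      exact ⟨Set.disjoint_left.2 fun y hy hy' => hy'.2 hy,
        ((hCd i).mono_left Set.inter_subset_left).mono_right Set.subset_union_left⟩
    choose s hs1 hs2 using hs
    have hs3 : ∀ i y, y ∈ K → y ∈ basisClosed (s i) → y ∈ D i := by
      intro i y hy hys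
      by_contra hn
      exact Set.disjoint_left.1 (hs2 i) hys (Or.inl ⟨hy, hn⟩)
    refine ⟨s, fun i => ⟨?_, ?_, ?_⟩, ?_⟩
    · exact Set.disjoint_compl_right_iff_subset.1 ((hs2 i).mono_right Set.subset_union_right)
    · exact Set.disjoint_left.2 fun y hy hy' => hy'.2 (hs1 i (hs3 i y hy hy'.1))
    · exact ⟨x i, hxK i, basisOpen_subset_basisClosed _ (hs1 i (hxD i))⟩
    · intro i j hij
      refine Set.disjoint_left.2 fun y hy hy' => ?_
      have h1 := hs3 i y hy hy'.1
      have h2 := hs3 j y hy hy'.2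
      exact (Set.mem_iInter₂.1 h1.2 j (Ne.symm hij)).2 h2.1
  · rintro ⟨s, hs, hd⟩
    choose x hx using fun i => (hs i).2.2
    have hsub : ∀ i, connectedComponentIn K (x i) ⊆ basisOpen (s i) := by
      intro i
      have hcc : connectedComponentIn K (x i) ⊆ basisOpen (s i) ∪ (basisClosed (s i))ᶜ := by
        intro y hy
        by_cases hyc : y ∈ basisClosed (s i)
        · left
          by_contra hn
          exact Set.disjoint_left.1 (hs i).2.1 (connectedComponentIn_subset _ _ hy) ⟨hyc, hn⟩
        · exact Or.inr hyc
      refine isPreconnected_connectedComponentIn.subset_left_of_subset_union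
        (isOpen_basisOpen _) (isCompact_basisClosed _).isClosed.isOpen_compl ?_ hcc ?_
      · exact Set.disjoint_compl_right_iff_subset.2 (basisOpen_subset_basisClosed _)
      · refine ⟨x i, mem_connectedComponentIn (hx i).1, ?_⟩
        by_contra hn
        exact Set.disjoint_left.1 (hs i).2.1 (hx i).1 ⟨(hx i).2, hn⟩
    have hinj : Function.Injective fun i => connectedComponentIn K (x i) := by
      intro i j hij
      by_contra hne
      have hmem : x j ∈ connectedComponentIn K (x i) := by
        simp only at hij
        rw [hij]
        exact mem_connectedComponentIn (hx j).1
      exact Set.disjoint_left.1 (hd i j hne) (hx j).1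
        ⟨basisOpen_subset_basisClosed _ (hsub i hmem), (hx j).2⟩
    calc (k : ℕ∞) = (Set.range fun i => connectedComponentIn K (x i)).encard := by
          rw [← Set.image_univ, hinj.encard_image, Set.encard_univ]
          simp
      _ ≤ _ := by
          refine Set.encard_le_encard ?_
          rintro _ ⟨i, rfl⟩
          exact ⟨⟨x i, (hx i).1, rfl⟩, ((hsub i).trans (basisOpen_subset_basisClosed _)).trans
            (hs i).1⟩

theorem isCompact_zeroSet {g : Plane → ℝ} {r : ℝ} (hg : ContinuousOn g (Metric.closedBall 0 r)) :
    IsCompact {z ∈ Metric.closedBall (0 : Plane) r | g z = 0} := by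
  have : {z ∈ Metric.closedBall (0 : Plane) r | g z = 0} =
      Metric.closedBall 0 r ∩ g ⁻¹' {0} := rfl
  rw [this]
  exact (isCompact_closedBall _ _).of_isClosed_subset
    (hg.preimage_isClosed_of_isClosed Metric.isClosed_closedBall isClosed_singleton)
    Set.inter_subset_left

theorem nodalCount_eq_encard (D : Set Plane) (g : Plane → ℝ) (r : ℝ) :
    nodalCount D g r = (innerComponents {z ∈ D | g z = 0} r).encard := rfl

theorem nodalCount_congr {D : Set Plane} {g g' : Plane → ℝ} {r : ℝ}
    (h : ∀ z ∈ D, g z = g' z) : nodalCount D g r = nodalCount D g' r := by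
  have : {z ∈ D | g z = 0} = {z ∈ D | g' z = 0} := by
    ext z
    exact and_congr_right fun hz => by rw [h z hz]
  rw [nodalCount_eq_encard, nodalCount_eq_encard, this]

/-- A component contained in the open ball does not see what happens outside the closed ball. -/
theorem planarCount_eq_nodalCount {g : Plane → ℝ} (hg : Continuous g) (R : ℝ) :
    planarCount g R = nodalCount (Metric.closedBall 0 R) g R := by
  rw [planarCount, nodalCount_eq_encard, nodalCount_eq_encard]
  congr 1
  set Z : Set Plane := {z ∈ Set.univ | g z = 0}
  set K : Set Plane := {z ∈ Metric.closedBall (0 : Plane) R | g z = 0}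
  have hKZ : K ⊆ Z := fun z hz => ⟨trivial, hz.2⟩
  have hK : IsCompact K := isCompact_zeroSet hg.continuousOn
  have h1 : ∀ y ∈ Z, connectedComponentIn Z y ⊆ Metric.ball 0 R →
      y ∈ K ∧ connectedComponentIn K y = connectedComponentIn Z y := by
    intro y hy hsub
    have hyb := hsub (mem_connectedComponentIn hy)
    have hyK : y ∈ K := ⟨Metric.ball_subset_closedBall hyb, hy.2⟩
    refine ⟨hyK, (connectedComponentIn_mono y hKZ).antisymm ?_⟩
    exact isPreconnected_connectedComponentIn.subset_connectedComponentIn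
      (mem_connectedComponentIn hy) fun z hz =>
        ⟨Metric.ball_subset_closedBall (hsub hz), (connectedComponentIn_subset _ _ hz).2⟩
  have h2 : ∀ y ∈ K, connectedComponentIn K y ⊆ Metric.ball 0 R →
      connectedComponentIn Z y ⊆ Metric.ball 0 R := by
    intro y hy hsub
    obtain ⟨C, hCK, hyC, hC, hKC, hCS⟩ := exists_clopen_separation hK
      (Metric.isOpen_ball (x := (0 : Plane)) (ε := R)).isClosed_compl hy
      (Set.disjoint_compl_right_iff_subset.2 hsub)
    have hCb : C ⊆ Metric.ball 0 R := Set.disjoint_compl_right_iff_subset.1 hCS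
    have hu : IsOpen ((K \ C)ᶜ ∩ Metric.ball (0 : Plane) R) :=
      hKC.isClosed.isOpen_compl.inter Metric.isOpen_ball
    have hy0 : y ∈ connectedComponentIn Z y := mem_connectedComponentIn (hKZ hy)
    have hcov : connectedComponentIn Z y ⊆ ((K \ C)ᶜ ∩ Metric.ball (0 : Plane) R) ∪ Cᶜ := by
      intro z _
      by_cases hzC : z ∈ C
      · exact Or.inl ⟨fun h => h.2 hzC, hCb hzC⟩
      · exact Or.inr hzC
    have hdisj : connectedComponentIn Z y ∩ (((K \ C)ᶜ ∩ Metric.ball (0 : Plane) R) ∩ Cᶜ) = ∅ := by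
      rw [Set.eq_empty_iff_forall_notMem]
      rintro z ⟨hz, ⟨hz1, hz2⟩, hz3⟩
      exact hz1 ⟨⟨Metric.ball_subset_closedBall hz2, (connectedComponentIn_subset _ _ hz).2⟩, hz3⟩
    rcases isPreconnected_iff_subset_of_disjoint.1 isPreconnected_connectedComponentIn _ _ hu
      hC.isClosed.isOpen_compl hcov hdisj with h | h
    · exact h.trans Set.inter_subset_right
    · exact absurd hyC (h hy0)
  ext Γ
  constructor
  · rintro ⟨⟨y, hy, rfl⟩, hsub⟩
    obtain ⟨hyK, heq⟩ := h1 y hy hsub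
    exact ⟨⟨y, hyK, heq⟩, hsub⟩
  · rintro ⟨⟨y, hy, rfl⟩, hsub⟩
    have := h2 y hy hsub
    obtain ⟨hyK, heq⟩ := h1 y (hKZ hy) this
    exact ⟨⟨y, hKZ hy, heq.symm⟩, hsub⟩

/-- Homeomorphisms of the plane carry inner components to inner components. -/
theorem encard_innerComponents_image (h : Plane ≃ₜ Plane) {r r' : ℝ}
    (hr : h '' Metric.ball 0 r = Metric.ball 0 r') (K : Set Plane) :
    (innerComponents (h '' K) r').encard = (innerComponents K r).encard := by
  have : innerComponents (h '' K) r' = (fun S => h '' S) '' innerComponents K r := by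
    ext Γ
    constructor
    · rintro ⟨⟨_, ⟨y, hy, rfl⟩, rfl⟩, hsub⟩
      refine ⟨connectedComponentIn K y, ⟨⟨y, hy, rfl⟩, ?_⟩, h.image_connectedComponentIn hy⟩
      rw [← Set.image_subset_image_iff h.injective, hr, h.image_connectedComponentIn hy]
      exact hsub
    · rintro ⟨_, ⟨⟨y, hy, rfl⟩, hsub⟩, rfl⟩
      refine ⟨⟨h y, ⟨y, hy, rfl⟩, (h.image_connectedComponentIn hy).symm⟩, ?_⟩
      rw [← hr]
      exact Set.image_mono hsub
  rw [this, Function.Injective.encard_image (Set.image_injective.2 h.injective)]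

theorem nodalCount_comp_isometry (L : Plane ≃ₗᵢ[ℝ] Plane) (g : Plane → ℝ) (r : ℝ) :
    nodalCount (Metric.closedBall 0 r) (fun y => g (L y)) r =
      nodalCount (Metric.closedBall 0 r) g r := by
  rw [nodalCount_eq_encard, nodalCount_eq_encard,
    ← encard_innerComponents_image L.toHomeomorph (r := r) (r' := r)]
  · congr 2
    ext z
    constructor
    · rintro ⟨y, ⟨hy, hg⟩, rfl⟩
      exact ⟨by simpa using hy, hg⟩
    · rintro ⟨hz, hg⟩
      exact ⟨L.symm z, ⟨by simpa using hz, by simpa using hg⟩, by simp⟩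
  · simp

theorem nodalCount_comp_smul {R : ℝ} (hR : 0 < R) (g : Plane → ℝ) :
    nodalCount (Metric.closedBall 0 1) (fun y => g (R • y)) 1 =
      nodalCount (Metric.closedBall 0 R) g R := by
  rw [nodalCount_eq_encard, nodalCount_eq_encard,
    ← encard_innerComponents_image (Homeomorph.smulOfNeZero R hR.ne') (r := 1) (r' := R)]
  · congr 2
    ext z
    constructor
    · rintro ⟨y, ⟨hy, hg⟩, rfl⟩
      refine ⟨?_, hg⟩
      simp only [Metric.mem_closedBall, dist_zero_right] at hy ⊢
      simp [norm_smul, abs_of_pos hR]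
      nlinarith
    · rintro ⟨hz, hg⟩
      refine ⟨R⁻¹ • z, ⟨?_, ?_⟩, ?_⟩
      · simp only [Metric.mem_closedBall, dist_zero_right] at hz ⊢
        rw [norm_smul, Real.norm_eq_abs, abs_of_pos (inv_pos.2 hR), inv_mul_le_iff₀ hR]
        simpa using hz
      · simpa [smul_smul, hR.ne'] using hg
      · simp [smul_smul, hR.ne']
  · have := smul_ball hR.ne' (0 : Plane) 1
    rw [← Set.image_smul] at this
    simpa [abs_of_pos hR] using this

/-! ### Measurability of the nodal count -/

/-- For a random continuous function, having no zero on a compact set is a countable condition. -/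
theorem nullMeasurableSet_disjoint_zeroSet {Ω : Type*} [MeasurableSpace Ω] {μ : Measure Ω}
    {X : Ω → Plane → ℝ} {A : Set Plane} (hA : IsCompact A) (hc : ∀ ω, ContinuousOn (X ω) A)
    (hm : ∀ y ∈ A, AEMeasurable (fun ω => X ω y) μ) :
    NullMeasurableSet {ω | ∀ y ∈ A, X ω y ≠ 0} μ := by
  obtain ⟨t, htA, htc, htd⟩ := (TopologicalSpace.IsSeparable.of_separableSpace A).exists_countable_dense_subset
  have : {ω | ∀ y ∈ A, X ω y ≠ 0} = ⋃ m : ℕ, ⋂ y ∈ t, {ω | 1 / ((m : ℝ) + 1) ≤ |X ω y|} := by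
    ext ω
    simp only [Set.mem_ofPred_eq, Set.mem_iUnion, Set.mem_iInter]
    constructor
    · intro h
      rcases A.eq_empty_or_nonempty with rfl | hne
      · exact ⟨0, fun y hy => absurd (htA hy) (Set.notMem_empty y)⟩
      obtain ⟨y₀, hy₀, hmin⟩ := hA.exists_isMinOn hne (hc ω).abs
      obtain ⟨m, hm⟩ := exists_nat_one_div_lt (abs_pos.2 (h y₀ hy₀))
      exact ⟨m, fun y hy => hm.le.trans (hmin (htA hy))⟩
    · rintro ⟨m, hm⟩ y hy h0
      obtain ⟨u, hu, hlim⟩ := mem_closure_iff_seq_limit.1 (htd hy)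
      have h1 : Tendsto (fun j => |X ω (u j)|) atTop (𝓝 |X ω y|) :=
        ((hc ω).abs y hy).tendsto.comp (tendsto_nhdsWithin_iff.2
          ⟨hlim, Eventually.of_forall fun j => htA (hu j)⟩)
      have h2 := ge_of_tendsto' h1 fun j => hm (u j) (hu j)
      rw [h0, abs_zero] at h2
      exact absurd h2 (not_le.2 Nat.one_div_pos_of_nat)
  rw [this]
  refine NullMeasurableSet.iUnion fun m => NullMeasurableSet.biInter htc fun y hy => ?_
  exact nullMeasurableSet_le aemeasurable_const (hm y (htA hy)).abs

theorem aemeasurable_toENNReal_of_nullMeasurableSet {Ω : Type*} [MeasurableSpace Ω]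
    {μ : Measure Ω} {N : Ω → ℕ∞} (h : ∀ k : ℕ, NullMeasurableSet {ω | (k : ℕ∞) ≤ N ω} μ) :
    AEMeasurable (fun ω => (N ω : ℝ≥0∞)) μ := by
  have : (fun ω => (N ω : ℝ≥0∞)) =
      fun ω => ⨆ k : ℕ, {ω | (k : ℕ∞) ≤ N ω}.indicator (fun _ => (k : ℝ≥0∞)) ω := by
    ext ω
    refine le_antisymm ?_ (iSup_le fun k => ?_)
    · rcases eq_or_ne (N ω) ⊤ with h' | h'
      · have : ∀ k : ℕ, {ω | (k : ℕ∞) ≤ N ω}.indicator (fun _ => (k : ℝ≥0∞)) ω = k := fun k => by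
          rw [Set.indicator_of_mem]
          change (k : ℕ∞) ≤ N ω
          rw [h']
          exact le_top
        simp_rw [this]
        rw [ENNReal.iSup_natCast]
        exact le_top
      · obtain ⟨n, hn⟩ := ENat.ne_top_iff_exists.1 h'
        refine le_iSup_of_le n ?_
        rw [Set.indicator_of_mem (show ω ∈ {ω | (n : ℕ∞) ≤ N ω} from hn.le), ← hn]
        simp
    · by_cases hk : (k : ℕ∞) ≤ N ω
      · rw [Set.indicator_of_mem (show ω ∈ {ω | (k : ℕ∞) ≤ N ω} from hk)]
        simpa using ENat.toENNReal_le.2 hk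
      · rw [Set.indicator_of_notMem (show ω ∉ {ω | (k : ℕ∞) ≤ N ω} from hk)]
        exact zero_le
  rw [this]
  refine AEMeasurable.iSup fun k => ?_
  exact (aemeasurable_const).indicator₀ (h k)

theorem aemeasurable_nodalCount {Ω : Type*} [MeasurableSpace Ω] {μ : Measure Ω}
    {X : Ω → Plane → ℝ} {r : ℝ} (hc : ∀ ω, ContinuousOn (X ω) (Metric.closedBall 0 r))
    (hm : ∀ y ∈ Metric.closedBall (0 : Plane) r, AEMeasurable (fun ω => X ω y) μ) :
    AEMeasurable (fun ω => ((nodalCount (Metric.closedBall 0 r) (X ω) r : ℕ∞) : ℝ≥0∞)) μ := by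
  refine aemeasurable_toENNReal_of_nullMeasurableSet fun k => ?_
  have hev : ∀ A : Set Plane, IsCompact A → A ⊆ Metric.ball 0 r →
      NullMeasurableSet {ω | Disjoint {z ∈ Metric.closedBall (0 : Plane) r | X ω z = 0} A} μ := by
    intro A hA hAr
    have hAr' := hAr.trans Metric.ball_subset_closedBall
    have : {ω | Disjoint {z ∈ Metric.closedBall (0 : Plane) r | X ω z = 0} A} =
        {ω | ∀ y ∈ A, X ω y ≠ 0} := by
      ext ω
      simp only [Set.mem_ofPred_eq, Set.disjoint_right, not_and]
      exact ⟨fun h y hy => h hy (hAr' hy), fun h y hy _ => h y hy⟩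
    rw [this]
    exact nullMeasurableSet_disjoint_zeroSet hA (fun ω => (hc ω).mono hAr')
      fun y hy => hm y (hAr' hy)
  have : {ω | (k : ℕ∞) ≤ nodalCount (Metric.closedBall 0 r) (X ω) r} =
      ⋃ s : Fin k → Finset (ℕ × ℕ), ⋃ _ : ∀ i, basisClosed (s i) ⊆ Metric.ball 0 r,
        (⋂ i, ({ω | Disjoint {z ∈ Metric.closedBall (0 : Plane) r | X ω z = 0}
            (basisClosed (s i) \ basisOpen (s i))} ∩
          {ω | Disjoint {z ∈ Metric.closedBall (0 : Plane) r | X ω z = 0}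
            (basisClosed (s i))}ᶜ)) ∩
        ⋂ i, ⋂ j, ⋂ _ : i ≠ j, {ω | Disjoint {z ∈ Metric.closedBall (0 : Plane) r | X ω z = 0}
            (basisClosed (s i) ∩ basisClosed (s j))} := by
    ext ω
    rw [Set.mem_ofPred_eq, nodalCount_eq_encard,
      le_encard_innerComponents_iff (isCompact_zeroSet (hc ω))]
    simp only [Set.mem_iUnion, Set.mem_inter_iff, Set.mem_iInter, Set.mem_ofPred_eq,
      Set.mem_compl_iff, Set.not_disjoint_iff_nonempty_inter, exists_prop]
    refine exists_congr fun s => ?_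
    exact ⟨fun h => ⟨fun i => (h.1 i).1, fun i => (h.1 i).2, h.2⟩,
      fun h => ⟨fun i => ⟨h.1 i, h.2.1 i⟩, h.2.2⟩⟩
  rw [this]
  refine NullMeasurableSet.iUnion fun s => NullMeasurableSet.iUnion fun hs => ?_
  refine (NullMeasurableSet.iInter fun i => ?_).inter
    (NullMeasurableSet.iInter fun i => NullMeasurableSet.iInter fun j =>
      NullMeasurableSet.iInter fun _ => ?_)
  · exact (hev _ ((isCompact_basisClosed _).diff (isOpen_basisOpen _))
      (Set.sdiff_subset.trans (hs i))).inter
      (hev _ (isCompact_basisClosed _) (hs i)).compl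
  · exact hev _ ((isCompact_basisClosed _).inter (isCompact_basisClosed _))
      (Set.inter_subset_left.trans (hs i))

/-! ### A compact class of differentiable functions -/

/-- `G` is a gradient of `f` at `q` on the disk of radius `2`, with a quadratic error bound. -/
def HasQuadApprox (M : ℝ) (f : Plane → ℝ) (q G : Plane) : Prop :=
  ∀ p ∈ Metric.closedBall (0 : Plane) 2, |f p - f q - inner ℝ G (p - q)| ≤ M * ‖p - q‖ ^ 2

/-- Functions bounded by `M` on the disk of radius `2`, extended by zero outside of it, which have
at each point of that disk a gradient bounded by `M` with quadratic error bounded by `M`. This is a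
pointwise formulation of a ball of `C^{1,1}`, chosen because it is closed in the topology of
pointwise convergence. -/
def smoothClass (M : ℝ) : Set (Plane → ℝ) :=
  {f | (∀ p ∈ Metric.closedBall (0 : Plane) 2, |f p| ≤ M) ∧
    (∀ p ∉ Metric.closedBall (0 : Plane) 2, f p = 0) ∧
    ∀ q ∈ Metric.closedBall (0 : Plane) 2, ∃ G, ‖G‖ ≤ M ∧ HasQuadApprox M f q G}

/-- `f` vanishes transversally in the closed unit disk and along the unit circle: no gradient at a
zero is zero, and no gradient at a zero on the circle is normal to the circle. -/
def IsRegularOn (M : ℝ) (f : Plane → ℝ) : Prop :=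
  (∀ z ∈ Metric.closedBall (0 : Plane) 1, f z = 0 → ∀ G, HasQuadApprox M f z G → G ≠ 0) ∧
  ∀ z ∈ Metric.sphere (0 : Plane) 1, f z = 0 → ∀ G, HasQuadApprox M f z G → ∀ c : ℝ, G ≠ c • z

theorem closedBall_one_subset_two :
    Metric.closedBall (0 : Plane) 1 ⊆ Metric.closedBall (0 : Plane) 2 :=
  Metric.closedBall_subset_closedBall one_le_two

/-- Arzelà–Ascoli in the topology of pointwise convergence: by Tychonoff's theorem only closedness is
at issue. -/
theorem isCompact_smoothClass (M : ℝ) : IsCompact (smoothClass M) := by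
  have hsub : smoothClass M ⊆ Set.pi Set.univ fun _ => Set.Icc (-|M|) |M| := by
    intro f hf p _
    rw [Set.mem_Icc, ← abs_le]
    by_cases hp : p ∈ Metric.closedBall (0 : Plane) 2
    · exact (hf.1 p hp).trans (le_abs_self M)
    · rw [hf.2.1 p hp]
      simp
  refine (isCompact_univ_pi fun _ => isCompact_Icc).of_isClosed_subset ?_ hsub
  -- The existence of a gradient is a closed condition: it is the projection of a closed condition
  -- along the compact ball in which the gradient varies.
  have : smoothClass M =
      (⋂ p ∈ Metric.closedBall (0 : Plane) 2, {f : Plane → ℝ | |f p| ≤ M}) ∩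
      ((⋂ p ∈ (Metric.closedBall (0 : Plane) 2)ᶜ, {f : Plane → ℝ | f p = 0}) ∩
      ⋂ q ∈ Metric.closedBall (0 : Plane) 2, Prod.fst '' ((Set.univ ×ˢ Metric.closedBall 0 M) ∩
        ⋂ p ∈ Metric.closedBall (0 : Plane) 2, {x : (Plane → ℝ) × Plane |
          |x.1 p - x.1 q - inner ℝ x.2 (p - q)| ≤ M * ‖p - q‖ ^ 2})) := by
    ext f
    simp only [smoothClass, HasQuadApprox, Set.mem_ofPred_eq, Set.mem_inter_iff, Set.mem_iInter,
      Set.mem_image, Prod.exists, Set.mem_prod, Set.mem_univ, true_and, mem_closedBall_zero_iff,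
      exists_and_right, exists_eq_right, Set.mem_compl_iff]
  rw [this]
  refine (isClosed_biInter fun p _ => isClosed_le (continuous_apply p).abs continuous_const).inter
    ((isClosed_biInter fun p _ => isClosed_eq (continuous_apply p) continuous_const).inter
    (isClosed_biInter fun q _ => ?_))
  have hproj : IsClosedMap (Prod.fst : (Plane → ℝ) × Metric.closedBall (0 : Plane) M → Plane → ℝ) := by
    have : CompactSpace (Metric.closedBall (0 : Plane) M) :=
      isCompact_iff_compactSpace.1 (isCompact_closedBall _ _)
    exact isClosedMap_fst_of_compactSpace
  have himg : Prod.fst '' (((Set.univ : Set (Plane → ℝ)) ×ˢ Metric.closedBall (0 : Plane) M) ∩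
        ⋂ p ∈ Metric.closedBall (0 : Plane) 2, {x : (Plane → ℝ) × Plane |
          |x.1 p - x.1 q - inner ℝ x.2 (p - q)| ≤ M * ‖p - q‖ ^ 2}) =
      Prod.fst '' (⋂ p ∈ Metric.closedBall (0 : Plane) 2,
        {x : (Plane → ℝ) × Metric.closedBall (0 : Plane) M |
          |x.1 p - x.1 q - inner ℝ (x.2 : Plane) (p - q)| ≤ M * ‖p - q‖ ^ 2}) := by
    ext f
    simp only [Set.mem_image, Set.mem_inter_iff, Set.mem_prod, Set.mem_univ, true_and,
      Set.mem_iInter, Set.mem_ofPred_eq, Prod.exists, Subtype.exists, exists_and_right,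
      exists_eq_right, exists_prop]
  rw [himg]
  refine hproj _ (isClosed_biInter fun p _ => isClosed_le ?_ continuous_const)
  have h1 : Continuous fun x : (Plane → ℝ) × Metric.closedBall (0 : Plane) M => x.1 p :=
    (continuous_apply p).comp continuous_fst
  have h2 : Continuous fun x : (Plane → ℝ) × Metric.closedBall (0 : Plane) M => x.1 q :=
    (continuous_apply q).comp continuous_fst
  have h3 : Continuous fun x : (Plane → ℝ) × Metric.closedBall (0 : Plane) M => (x.2 : Plane) :=
    continuous_subtype_val.comp continuous_snd
  exact ((h1.sub h2).sub (h3.inner continuous_const)).abs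

theorem smoothClass_nonneg {M : ℝ} {f : Plane → ℝ} (hf : f ∈ smoothClass M) : 0 ≤ M :=
  (abs_nonneg _).trans (hf.1 0 (by simp))

theorem smoothClass_lipschitz {M : ℝ} {f : Plane → ℝ} (hf : f ∈ smoothClass M) {p q : Plane}
    (hp : p ∈ Metric.closedBall (0 : Plane) 2) (hq : q ∈ Metric.closedBall (0 : Plane) 2) :
    |f p - f q| ≤ 5 * M * ‖p - q‖ := by
  obtain ⟨G, hG, h⟩ := hf.2.2 q hq
  have hM := smoothClass_nonneg hf
  have h1 := h p hp
  have h2 := abs_real_inner_le_norm G (p - q)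
  have h3 : ‖p - q‖ ≤ 4 := by
    have := norm_sub_le p q
    rw [mem_closedBall_zero_iff] at hp hq
    linarith
  have h4 := abs_le.1 h1
  have h5 := abs_le.1 h2
  have h6 : ‖G‖ * ‖p - q‖ ≤ M * ‖p - q‖ := by gcongr
  have h7 : M * ‖p - q‖ ^ 2 ≤ M * (4 * ‖p - q‖) := by
    gcongr
    nlinarith [norm_nonneg (p - q)]
  rw [abs_le]
  constructor <;> linarith

theorem smoothClass_continuousOn {M : ℝ} {f : Plane → ℝ} (hf : f ∈ smoothClass M) :
    ContinuousOn f (Metric.closedBall 0 2) := by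
  have hM := smoothClass_nonneg hf
  refine LipschitzOnWith.continuousOn (K := Real.toNNReal (5 * M)) ?_
  refine LipschitzOnWith.of_dist_le_mul fun p hp q hq => ?_
  rw [Real.dist_eq, dist_eq_norm, Real.coe_toNNReal _ (by positivity)]
  exact smoothClass_lipschitz hf hp hq

theorem smoothClass_mono {M M' : ℝ} (h : M ≤ M') : smoothClass M ⊆ smoothClass M' := by
  intro f hf
  refine ⟨fun p hp => (hf.1 p hp).trans h, hf.2.1, fun q hq => ?_⟩
  obtain ⟨G, hG, hq⟩ := hf.2.2 q hq
  exact ⟨G, hG.trans h, fun p hp => (hq p hp).trans (by gcongr)⟩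

/-- On the class, which is equi-Lipschitz, pointwise convergence is uniform. -/
theorem eventually_uniformly_close (M : ℝ) (f : Plane → ℝ) (hf : f ∈ smoothClass M) {ε : ℝ}
    (hε : 0 < ε) : ∀ᶠ g in 𝓝[smoothClass M] f,
      ∀ p ∈ Metric.closedBall (0 : Plane) 2, |g p - f p| ≤ ε := by
  have hM := smoothClass_nonneg hf
  set δ := ε / (15 * (M + 1)) with hδ
  have hδ0 : 0 < δ := by positivity
  obtain ⟨t, htB, htf, hcov⟩ := finite_cover_balls_of_compact (isCompact_closedBall (0 : Plane) 2) hδ0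
  have h1 : ∀ᶠ g in 𝓝[smoothClass M] f, ∀ p ∈ t, |g p - f p| < ε / 3 := by
    rw [eventually_all_finite htf]
    intro p _
    have hcont : Tendsto (fun g : Plane → ℝ => g p) (𝓝[smoothClass M] f) (𝓝 (f p)) :=
      ((continuous_apply p).tendsto f).mono_left nhdsWithin_le_nhds
    have := (Metric.tendsto_nhds.1 hcont) (ε / 3) (by positivity)
    simpa [Real.dist_eq] using this
  filter_upwards [h1, self_mem_nhdsWithin] with g hg hgM p hp
  obtain ⟨q, hq, hpq⟩ := Set.mem_iUnion₂.1 (hcov hp)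
  have hpq' : ‖p - q‖ ≤ δ := by
    rw [← dist_eq_norm]
    exact (Metric.mem_ball.1 hpq).le
  have a1 := smoothClass_lipschitz hgM hp (htB hq)
  have a2 := smoothClass_lipschitz hf hp (htB hq)
  have a3 := hg q hq
  have a4 : 5 * M * ‖p - q‖ ≤ ε / 3 := by
    calc 5 * M * ‖p - q‖ ≤ 5 * (M + 1) * δ := by gcongr; linarith
      _ = ε / 3 := by rw [hδ]; field_simp; norm_num
  rw [abs_le] at a1 a2 ⊢
  rw [abs_lt] at a3
  constructor <;> linarith

/-- Near a point where the derivative of `f` in direction `ν` is positive, every function of the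
class that is close to `f` increases along all directions in a narrow cone around `ν`. -/
theorem cone_monotone {M : ℝ} (hM1 : 1 ≤ M) {f : Plane → ℝ} (hf : f ∈ smoothClass M)
    {z G ν : Plane} (hz : z ∈ Metric.closedBall (0 : Plane) 1) (hG : HasQuadApprox M f z G)
    (hν : ‖ν‖ = 1) (hc : 0 < inner ℝ G ν) :
    ∃ ρ > 0, ∃ η > 0, ∀ᶠ g in 𝓝[smoothClass M] f, ∀ p ∈ Metric.ball z ρ, ∀ q ∈ Metric.ball z ρ,
      ∀ σ > 0, ‖p - q - σ • ν‖ ≤ η * σ → g q < g p := by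
  obtain ⟨c, hc0, hcM, hcG⟩ : ∃ c > 0, c ≤ M ∧ c ≤ inner ℝ G ν :=
    ⟨min M (inner ℝ G ν), lt_min (by linarith) hc, min_le_left _ _, min_le_right _ _⟩
  have hM0 : 0 < M := by linarith
  set η := c / (8 * M) with hη
  have hη0 : 0 < η := by positivity
  have hη1 : η ≤ 1 / 8 := by
    rw [hη, div_le_iff₀ (by positivity)]
    linarith
  have hηM : M * η = c / 8 := by rw [hη]; field_simp
  set ρ := c * η / (80 * M) with hρ
  have hρ0 : 0 < ρ := by positivity
  have hρM : M * ρ = c * η / 80 := by rw [hρ]; field_simp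
  have hρ1 : ρ ≤ 1 / 8 := by
    rw [hρ, div_le_iff₀ (by positivity)]
    have : c * η ≤ M * (1 / 8) := by gcongr
    linarith
  refine ⟨ρ, hρ0, η, hη0, ?_⟩
  -- The gradient of `g` at `q` is tested by the increment of `g` over the step `η • ν`, which is
  -- compared with the increment of `f` at `z` by uniform closeness.
  filter_upwards [eventually_uniformly_close M f hf (show 0 < c * η / 16 by positivity),
    self_mem_nhdsWithin] with g hg hgM p hp q hq σ hσ hpq
  rw [mem_closedBall_zero_iff] at hz
  rw [mem_ball_iff_norm] at hp hq
  have hb : ∀ w : Plane, ‖w - z‖ ≤ 1 / 4 → w ∈ Metric.closedBall (0 : Plane) 2 := by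
    intro w hw
    rw [mem_closedBall_zero_iff]
    have := norm_add_le (w - z) z
    rw [sub_add_cancel] at this
    linarith
  have hην : ‖η • ν‖ = η := by rw [norm_smul, hν, mul_one, Real.norm_of_nonneg hη0.le]
  have hz2 : z ∈ Metric.closedBall (0 : Plane) 2 := hb z (by simp)
  have hq2 : q ∈ Metric.closedBall (0 : Plane) 2 := hb q (by linarith)
  have hp2 : p ∈ Metric.closedBall (0 : Plane) 2 := hb p (by linarith)
  have hzh2 : z + η • ν ∈ Metric.closedBall (0 : Plane) 2 := hb _ (by
    rw [add_sub_cancel_left, hην]; linarith)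
  have hqh2 : q + η • ν ∈ Metric.closedBall (0 : Plane) 2 := hb _ (by
    have := norm_add_le (q - z) (η • ν)
    rw [show q + η • ν - z = q - z + η • ν by abel]
    linarith)
  obtain ⟨G', hG'M, hG'⟩ := hgM.2.2 q hq2
  have e1 := abs_le.1 (hG (z + η • ν) hzh2)
  have e2 := abs_le.1 (hG' (q + η • ν) hqh2)
  rw [add_sub_cancel_left, hην, inner_smul_right] at e1 e2
  have e3 := abs_le.1 (smoothClass_lipschitz hf hq2 hz2)
  have e4 := abs_le.1 (smoothClass_lipschitz hf hqh2 hzh2)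
  rw [show q + η • ν - (z + η • ν) = q - z by abel] at e4
  have e5 := abs_le.1 (hg _ hq2)
  have e6 := abs_le.1 (hg _ hqh2)
  have e7 : 5 * M * ‖q - z‖ ≤ c * η / 16 := by
    calc 5 * M * ‖q - z‖ ≤ 5 * M * ρ := by gcongr
      _ = c * η / 16 := by linarith
  have e8 : η * c ≤ η * inner ℝ G ν := by gcongr
  have e9 : M * η ^ 2 = c * η / 8 := by
    rw [pow_two, ← mul_assoc, hηM]; ring
  have key : c / 2 ≤ inner ℝ G' ν := by
    have : η * (c / 2) ≤ η * inner ℝ G' ν := by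
      linarith only [e1, e2, e3, e4, e5, e6, e7, e8, e9]
    exact le_of_mul_le_mul_left this hη0
  have f1 := abs_le.1 (hG' p hp2)
  have f2 : inner ℝ G' (p - q) = σ * inner ℝ G' ν + inner ℝ G' (p - q - σ • ν) := by
    rw [inner_sub_right _ _ (σ • ν), inner_smul_right]; ring
  have f3 := abs_le.1 (abs_real_inner_le_norm G' (p - q - σ • ν))
  have f4 : ‖G'‖ * ‖p - q - σ • ν‖ ≤ M * (η * σ) := by gcongr
  have f5 : ‖p - q‖ ≤ 2 * σ := by
    have := norm_add_le (p - q - σ • ν) (σ • ν)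
    rw [sub_add_cancel, norm_smul, hν, mul_one, Real.norm_of_nonneg hσ.le] at this
    have h' : η * σ ≤ 1 / 8 * σ := by gcongr
    linarith only [this, h', hpq, hσ]
  have f6 : ‖p - q‖ ≤ 2 * ρ := by
    have := norm_sub_le (p - z) (q - z)
    rw [sub_sub_sub_cancel_right] at this
    linarith
  have f7 : M * ‖p - q‖ ^ 2 ≤ M * ((2 * σ) * (2 * ρ)) := by
    rw [pow_two]
    gcongr
  have f8 : M * ((2 * σ) * (2 * ρ)) = 4 * σ * (c * η / 80) := by rw [← hρM]; ring
  have f9 : M * (η * σ) = σ * (c / 8) := by rw [← hηM]; ring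
  have f10 : σ * (c / 2) ≤ σ * inner ℝ G' ν := by gcongr
  have f11 : 4 * σ * (c * η / 80) ≤ σ * (c / 8) := by
    have h1 : σ * (c * η) ≤ σ * (c * (1 / 8)) := by gcongr
    have h2 := mul_pos hσ hc0
    linarith only [h1, h2]
  have f12 := mul_pos hσ hc0
  linarith only [f1, f2, f3, f4, f7, f8, f9, f10, f11, f12]

/-! ### Zero sets near a transversal zero -/

/-- A function on a rectangle that is increasing in the first variable and changes sign on each
horizontal segment has a connected zero set (a graph over the second coordinate). -/
theorem isPreconnected_box_zeroSet {H : ℝ × ℝ → ℝ} {s₀ a b : ℝ} (hs : 0 < s₀)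
    (hc : ContinuousOn H (Set.Icc (-s₀) s₀ ×ˢ Set.Icc a b))
    (hmono : ∀ t ∈ Set.Icc a b, ∀ s ∈ Set.Icc (-s₀) s₀, ∀ s' ∈ Set.Icc (-s₀) s₀, s < s' →
      H (s, t) < H (s', t))
    (hneg : ∀ t ∈ Set.Icc a b, H (-s₀, t) < 0) (hpos : ∀ t ∈ Set.Icc a b, 0 < H (s₀, t)) :
    IsPreconnected {x ∈ Set.Icc (-s₀) s₀ ×ˢ Set.Icc a b | H x = 0} := by
  set Z := {x ∈ Set.Icc (-s₀) s₀ ×ˢ Set.Icc a b | H x = 0} with hZ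
  have hcZ : IsCompact Z :=
    (isCompact_Icc.prod isCompact_Icc).of_isClosed_subset
      (hc.preimage_isClosed_of_isClosed (isClosed_Icc.prod isClosed_Icc) isClosed_singleton)
      fun x hx => hx.1
  have : CompactSpace Z := isCompact_iff_compactSpace.1 hcZ
  let π : Z → ℝ := fun x => x.1.2
  -- the projection to the second coordinate is a closed embedding onto the whole interval
  have hπ : Continuous π := continuous_snd.comp continuous_subtype_val
  have hinj : Function.Injective π := by
    rintro ⟨⟨s, t⟩, ⟨hs1, ht1⟩, h1⟩ ⟨⟨s', t'⟩, ⟨hs2, ht2⟩, h2⟩ (heq : t = t')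
    subst heq
    simp only [Subtype.mk.injEq, Prod.mk.injEq, and_true]
    rcases lt_trichotomy s s' with h | h | h
    · have := hmono t ht1 s hs1 s' hs2 h
      linarith
    · exact h
    · have := hmono t ht1 s' hs2 s hs1 h
      linarith
  have hrange : Set.Icc a b ⊆ Set.range π := by
    intro t ht
    have hct : ContinuousOn (fun s => H (s, t)) (Set.Icc (-s₀) s₀) :=
      hc.comp (by fun_prop) fun s hs => ⟨hs, ht⟩
    obtain ⟨s, hs1, hs2⟩ := intermediate_value_Icc (by linarith) hct
      ⟨(hneg t ht).le, (hpos t ht).le⟩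
    exact ⟨⟨(s, t), ⟨hs1, ht⟩, hs2⟩, rfl⟩
  have hpre := isPreconnected_Icc.preimage_of_isClosedMap hinj hπ.isClosedMap hrange
  have huniv : π ⁻¹' Set.Icc a b = Set.univ := Set.eq_univ_of_forall fun x => x.2.1.2
  rw [huniv] at hpre
  have := hpre.image ((↑) : Z → ℝ × ℝ) continuous_subtype_val.continuousOn
  rwa [Set.image_univ, Subtype.range_coe] at this

/-- The rotation of the plane by a right angle. -/
def rot90 (v : Plane) : Plane := !₂[-v 1, v 0]

theorem inner_plane (v w : Plane) : inner ℝ v w = v 0 * w 0 + v 1 * w 1 := by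
  simp [PiLp.inner_apply, Fin.sum_univ_two, mul_comm]

theorem norm_sq_plane (v : Plane) : ‖v‖ ^ 2 = v 0 ^ 2 + v 1 ^ 2 := by
  simp [EuclideanSpace.norm_sq_eq, Fin.sum_univ_two]

theorem inner_rot90_self (v : Plane) : inner ℝ (rot90 v) v = 0 := by
  simp [inner_plane, rot90]
  ring

theorem norm_rot90 (v : Plane) : ‖rot90 v‖ = ‖v‖ := by
  have : ‖rot90 v‖ ^ 2 = ‖v‖ ^ 2 := by
    simp [norm_sq_plane, rot90]
    ring
  exact (sq_eq_sq₀ (norm_nonneg _) (norm_nonneg _)).1 this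

/-- The expansion of a vector in the orthonormal basis `ν, rot90 ν`. -/
theorem plane_decomp {ν : Plane} (hν : ‖ν‖ = 1) (v : Plane) :
    v = inner ℝ ν v • ν + inner ℝ (rot90 ν) v • rot90 ν := by
  have h : ν 0 ^ 2 + ν 1 ^ 2 = 1 := by rw [← norm_sq_plane, hν]; norm_num
  ext i
  fin_cases i
  · simp [inner_plane, rot90]
    linear_combination -(v 0) * h
  · simp [inner_plane, rot90]
    linear_combination -(v 1) * h

/-- A coordinate system of the closed unit disk near `z` whose first coordinate lines are nearly
parallel to `ν`; on the unit circle it runs along the circle. The second coordinate ranges over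
`[a t, t]` for small `t`, with `a = -1` at interior points and `a = 0` at boundary points. -/
structure IsDiskChart (z ν : Plane) (a : ℝ) (Φ : ℝ × ℝ → Plane) : Prop where
  continuous : Continuous Φ
  origin : Φ (0, 0) = z
  nonpos : a ≤ 0
  ge : -1 ≤ a
  cone : ∀ η > 0, ∃ r > 0, ∀ s ∈ Set.Icc (-r) r, ∀ s' ∈ Set.Icc (-r) r, s < s' →
    ∀ t, ‖Φ (s', t) - Φ (s, t) - (s' - s) • ν‖ ≤ η * (s' - s)
  mem_disk : ∃ r > 0, ∀ s ∈ Set.Icc (-r) r, ∀ t ∈ Set.Icc (a * r) r,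
    Φ (s, t) ∈ Metric.closedBall (0 : Plane) 1
  mem_circle : ‖z‖ = 1 → ∃ r > 0, ∀ s ∈ Set.Icc (-r) r, ‖Φ (s, 0)‖ = 1
  nbhd : ∀ r > 0, ∀ t₀ > 0, ∃ W : Set Plane, IsOpen W ∧ z ∈ W ∧
    ∀ p ∈ W, p ∈ Metric.closedBall (0 : Plane) 1 →
      ∃ s ∈ Set.Icc (-r) r, ∃ t ∈ Set.Icc (a * t₀) t₀, Φ (s, t) = p

theorem exists_interior_chart {z ν : Plane} (hz : ‖z‖ < 1) (hν : ‖ν‖ = 1) :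
    IsDiskChart z ν (-1) fun x => z + x.1 • ν + x.2 • rot90 ν where
  continuous := by fun_prop
  origin := by simp
  nonpos := by norm_num
  ge := le_rfl
  cone η hη := ⟨1, one_pos, fun s _ s' _ hss t => by
    have : z + s' • ν + t • rot90 ν - (z + s • ν + t • rot90 ν) - (s' - s) • ν = 0 := by
      module
    simp only [this, norm_zero]
    have := sub_pos.2 hss
    positivity⟩
  mem_disk := by
    refine ⟨(1 - ‖z‖) / 2, by linarith, fun s hs t ht => ?_⟩
    rw [mem_closedBall_zero_iff]
    have h1 : |s| ≤ (1 - ‖z‖) / 2 := abs_le.2 hs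
    have h2 : |t| ≤ (1 - ‖z‖) / 2 := abs_le.2 ⟨by linarith [ht.1], ht.2⟩
    calc ‖z + s • ν + t • rot90 ν‖ ≤ ‖z‖ + ‖s • ν‖ + ‖t • rot90 ν‖ := norm_add₃_le
      _ = ‖z‖ + |s| + |t| := by
        rw [norm_smul, norm_smul, norm_rot90, hν, mul_one, mul_one, Real.norm_eq_abs,
          Real.norm_eq_abs]
      _ ≤ 1 := by linarith
  mem_circle h := absurd h hz.ne
  nbhd r hr t₀ ht₀ := by
    refine ⟨{p | |inner ℝ ν (p - z)| < r ∧ |inner ℝ (rot90 ν) (p - z)| < t₀}, ?_, ?_, ?_⟩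
    · have h1 : IsOpen {p : Plane | |inner ℝ ν (p - z)| < r} :=
        isOpen_lt (by fun_prop) continuous_const
      have h2 : IsOpen {p : Plane | |inner ℝ (rot90 ν) (p - z)| < t₀} :=
        isOpen_lt (by fun_prop) continuous_const
      exact h1.inter h2
    · simp [hr, ht₀]
    · rintro p ⟨h1, h2⟩ _
      refine ⟨inner ℝ ν (p - z), abs_le.1 h1.le, inner ℝ (rot90 ν) (p - z), ?_, ?_⟩
      · have := abs_le.1 h2.le
        exact ⟨by linarith [this.1], this.2⟩
      · simp only
        rw [add_assoc, ← plane_decomp hν]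
        abel

/-- The first coordinate runs along the circle in the direction `τ`, the second one is the depth below
the circle. -/
theorem exists_boundary_chart {z τ : Plane} (hz : ‖z‖ = 1) (hτ : τ = rot90 z ∨ τ = -rot90 z) :
    IsDiskChart z τ 0 fun x => x.1 • τ + (√(1 - x.1 ^ 2) - x.2) • z := by
  have hτ1 : ‖τ‖ = 1 := by
    rcases hτ with rfl | rfl
    · rw [norm_rot90, hz]
    · rw [norm_neg, norm_rot90, hz]
  have hτz : inner ℝ τ z = 0 := by
    rcases hτ with rfl | rfl
    · exact inner_rot90_self z
    · rw [inner_neg_left, inner_rot90_self, neg_zero]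
  have hdec : ∀ p : Plane, p = inner ℝ τ p • τ + inner ℝ z p • z := by
    intro p
    conv_lhs => rw [plane_decomp hz p]
    rcases hτ with rfl | rfl
    · rw [add_comm]
    · rw [inner_neg_left, smul_neg, neg_smul, neg_neg, add_comm]
  have hnorm : ∀ x y : ℝ, ‖x • τ + y • z‖ ^ 2 = x ^ 2 + y ^ 2 := by
    intro x y
    rw [norm_add_sq_real, norm_smul, norm_smul, inner_smul_left, inner_smul_right, hτz, hz, hτ1]
    simp
  have hsqrt : ∀ s : ℝ, |s| ≤ 1 / 2 → 1 / 2 ≤ √(1 - s ^ 2) ∧ √(1 - s ^ 2) ^ 2 = 1 - s ^ 2 := by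
    intro s hs
    have h1 : s ^ 2 ≤ 1 / 4 := by
      rw [← sq_abs]
      nlinarith [abs_nonneg s]
    refine ⟨Real.le_sqrt_of_sq_le (by linarith), Real.sq_sqrt (by linarith)⟩
  refine ⟨by fun_prop, by simp, le_rfl, by norm_num, ?_, ?_, ?_, ?_⟩
  · intro η hη
    refine ⟨min (1 / 2) (η / 2), by positivity, fun s hs s' hs' hss t => ?_⟩
    have a1 : |s| ≤ 1 / 2 := (abs_le.2 hs).trans (min_le_left _ _)
    have a2 : |s| ≤ η / 2 := (abs_le.2 hs).trans (min_le_right _ _)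
    have a3 : |s'| ≤ 1 / 2 := (abs_le.2 hs').trans (min_le_left _ _)
    have a4 : |s'| ≤ η / 2 := (abs_le.2 hs').trans (min_le_right _ _)
    have : s' • τ + (√(1 - s' ^ 2) - t) • z - (s • τ + (√(1 - s ^ 2) - t) • z) - (s' - s) • τ =
        (√(1 - s' ^ 2) - √(1 - s ^ 2)) • z := by module
    simp only [this, norm_smul, hz, mul_one, Real.norm_eq_abs]
    obtain ⟨b1, b2⟩ := hsqrt s a1
    obtain ⟨b3, b4⟩ := hsqrt s' a3
    have hprod : (√(1 - s' ^ 2) - √(1 - s ^ 2)) * (√(1 - s' ^ 2) + √(1 - s ^ 2)) =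
        -((s' - s) * (s' + s)) := by linear_combination b4 - b2
    have habs := congrArg abs hprod
    rw [abs_mul, abs_neg, abs_mul, abs_of_pos (sub_pos.2 hss),
      abs_of_pos (show 0 < √(1 - s' ^ 2) + √(1 - s ^ 2) by linarith)] at habs
    have hsum : |s' + s| ≤ η := (abs_add_le _ _).trans (by linarith)
    calc |√(1 - s' ^ 2) - √(1 - s ^ 2)| ≤
        |√(1 - s' ^ 2) - √(1 - s ^ 2)| * (√(1 - s' ^ 2) + √(1 - s ^ 2)) :=
          le_mul_of_one_le_right (abs_nonneg _) (by linarith)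
      _ = (s' - s) * |s' + s| := habs
      _ ≤ (s' - s) * η := by
          have := (sub_pos.2 hss).le
          gcongr
      _ = η * (s' - s) := mul_comm _ _
  · refine ⟨1 / 2, by norm_num, fun s hs t ht => ?_⟩
    obtain ⟨b1, b2⟩ := hsqrt s (abs_le.2 hs)
    rw [zero_mul] at ht
    rw [mem_closedBall_zero_iff]
    have h := hnorm s (√(1 - s ^ 2) - t)
    have h2 : ‖s • τ + (√(1 - s ^ 2) - t) • z‖ ^ 2 ≤ 1 := by
      rw [h]
      nlinarith [ht.1, ht.2]
    exact (sq_le_one_iff₀ (norm_nonneg _)).1 h2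
  · intro _
    refine ⟨1 / 2, by norm_num, fun s hs => ?_⟩
    obtain ⟨b1, b2⟩ := hsqrt s (abs_le.2 hs)
    have h := hnorm s (√(1 - s ^ 2))
    rw [b2] at h
    simp only [sub_zero]
    have h2 : ‖s • τ + √(1 - s ^ 2) • z‖ ^ 2 = 1 := by rw [h]; ring
    nlinarith [norm_nonneg (s • τ + √(1 - s ^ 2) • z)]
  · intro r hr t₀ ht₀
    refine ⟨{p | |inner ℝ τ p| < r ∧ |√(1 - inner ℝ τ p ^ 2) - inner ℝ z p| < t₀}, ?_, ?_, ?_⟩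
    · have h1 : IsOpen {p : Plane | |inner ℝ τ p| < r} :=
        isOpen_lt (by fun_prop) continuous_const
      have h2 : IsOpen {p : Plane | |√(1 - inner ℝ τ p ^ 2) - inner ℝ z p| < t₀} :=
        isOpen_lt (by fun_prop) continuous_const
      exact h1.inter h2
    · simp [hτz, hr, ht₀, hz]
    · rintro p ⟨h1, h2⟩ hp
      rw [mem_closedBall_zero_iff] at hp
      refine ⟨inner ℝ τ p, abs_le.1 h1.le, √(1 - inner ℝ τ p ^ 2) - inner ℝ z p, ⟨?_, ?_⟩, ?_⟩
      · rw [zero_mul, sub_nonneg]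
        refine Real.le_sqrt_of_sq_le ?_
        have := hnorm (inner ℝ τ p) (inner ℝ z p)
        rw [← hdec p] at this
        nlinarith [norm_nonneg p]
      · exact (le_abs_self _).trans h2.le
      · simp only [sub_sub_cancel]
        exact (hdec p).symm

/-- Every zero of a regular function of the class admits a chart along whose first coordinate lines
the function increases. -/
theorem exists_chart {M : ℝ} {f : Plane → ℝ} (hf : f ∈ smoothClass M) (hreg : IsRegularOn M f)
    {z : Plane} (hz : z ∈ Metric.closedBall (0 : Plane) 1) (hfz : f z = 0) :
    ∃ G ν a Φ, HasQuadApprox M f z G ∧ ‖ν‖ = 1 ∧ 0 < inner ℝ G ν ∧ IsDiskChart z ν a Φ := by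
  obtain ⟨G, -, hG⟩ := hf.2.2 z (closedBall_one_subset_two hz)
  rw [mem_closedBall_zero_iff] at hz
  rcases hz.lt_or_eq with hz | hz
  · have hG0 : G ≠ 0 := hreg.1 z (by simpa using hz.le) hfz G hG
    have hn : 0 < ‖G‖ := norm_pos_iff.2 hG0
    refine ⟨G, ‖G‖⁻¹ • G, -1, _, hG, ?_, ?_, exists_interior_chart hz ?_⟩
    · rw [norm_smul, norm_inv, norm_norm, inv_mul_cancel₀ hn.ne']
    · rw [inner_smul_right, real_inner_self_eq_norm_sq]
      positivity
    · rw [norm_smul, norm_inv, norm_norm, inv_mul_cancel₀ hn.ne']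
  · have hne : inner ℝ (rot90 z) G ≠ 0 := by
      intro h0
      refine hreg.2 z (by simpa using hz) hfz G hG (inner ℝ z G) ?_
      conv_lhs => rw [plane_decomp hz G]
      rw [h0, zero_smul, add_zero]
    rcases lt_or_gt_of_ne hne with h | h
    · refine ⟨G, -rot90 z, 0, _, hG, ?_, ?_, exists_boundary_chart hz (Or.inr rfl)⟩
      · rw [norm_neg, norm_rot90, hz]
      · rw [real_inner_comm, inner_neg_left]
        linarith
    · refine ⟨G, rot90 z, 0, _, hG, ?_, ?_, exists_boundary_chart hz (Or.inl rfl)⟩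
      · rw [norm_rot90, hz]
      · rwa [real_inner_comm]

/-- The zero set of a function in the closed unit disk. -/
def diskZeros (f : Plane → ℝ) : Set Plane := {z ∈ Metric.closedBall (0 : Plane) 1 | f z = 0}

/-- Near a transversal zero of `f`, the zeros of all functions of the class close to `f` lie in one
connected piece of the zero set, and such zeros exist; at a boundary zero they exist on the
boundary. -/
theorem local_structure {M : ℝ} (hM : 1 ≤ M) {f : Plane → ℝ} (hf : f ∈ smoothClass M)
    (hreg : IsRegularOn M f) {z : Plane} (hz : z ∈ diskZeros f) :
    (∃ W : Set Plane, IsOpen W ∧ z ∈ W ∧ ∀ᶠ g in 𝓝[smoothClass M] f,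
      ∃ S, IsPreconnected S ∧ S ⊆ diskZeros g ∧ W ∩ diskZeros g ⊆ S) ∧
    ∀ W ∈ 𝓝 z, ∀ᶠ g in 𝓝[smoothClass M] f,
      ∃ p ∈ W, p ∈ diskZeros g ∧ (‖z‖ = 1 → ‖p‖ = 1) := by
  obtain ⟨G, ν, a, Φ, hG, hν, hc, hΦ⟩ := exists_chart hf hreg hz.1 hz.2
  obtain ⟨ρ, hρ, η, hη, hmon⟩ := cone_monotone hM hf hz.1 hG hν hc
  obtain ⟨r₁, hr₁, hcone⟩ := hΦ.cone η hη
  obtain ⟨r₂, hr₂, hdisk⟩ := hΦ.mem_disk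
  obtain ⟨r₃, hr₃, hcirc⟩ : ∃ r > 0, ‖z‖ = 1 → ∀ s ∈ Set.Icc (-r) r, ‖Φ (s, 0)‖ = 1 := by
    by_cases h : ‖z‖ = 1
    · obtain ⟨r, hr, h'⟩ := hΦ.mem_circle h
      exact ⟨r, hr, fun _ => h'⟩
    · exact ⟨1, one_pos, fun h' => absurd h' h⟩
  -- shrink so that the image of the rectangle stays in a prescribed neighbourhood
  have hsmall : ∀ V ∈ 𝓝 z, ∃ r > 0, ∀ s ∈ Set.Icc (-r) r, ∀ t ∈ Set.Icc (-r) r, Φ (s, t) ∈ V := by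
    intro V hV
    have : Φ ⁻¹' V ∈ 𝓝 ((0 : ℝ), (0 : ℝ)) := hΦ.continuous.continuousAt.preimage_mem_nhds
      (hΦ.origin.symm ▸ hV)
    obtain ⟨r, hr, hsub⟩ := Metric.mem_nhds_iff.1 this
    refine ⟨r / 2, by positivity, fun s hs t ht => hsub ?_⟩
    rw [Metric.mem_ball, Prod.dist_eq, max_lt_iff, dist_zero_right, dist_zero_right,
      Real.norm_eq_abs, Real.norm_eq_abs, abs_lt, abs_lt]
    exact ⟨⟨by linarith [hs.1], by linarith [hs.2]⟩, ⟨by linarith [ht.1], by linarith [ht.2]⟩⟩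
  have hf2 := smoothClass_continuousOn hf
  have hmono : ∀ g : Plane → ℝ, (∀ p ∈ Metric.ball z ρ, ∀ q ∈ Metric.ball z ρ,
      ∀ σ > 0, ‖p - q - σ • ν‖ ≤ η * σ → g q < g p) → ∀ r ≤ r₁,
      (∀ s ∈ Set.Icc (-r) r, ∀ t ∈ Set.Icc (-r) r, Φ (s, t) ∈ Metric.ball z ρ) →
      ∀ t ∈ Set.Icc (-r) r, ∀ s ∈ Set.Icc (-r) r, ∀ s' ∈ Set.Icc (-r) r, s < s' →
      g (Φ (s, t)) < g (Φ (s', t)) := by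
    intro g hg r hr hb t ht s hs s' hs' hss
    refine hg _ (hb s' hs' t ht) _ (hb s hs t ht) (s' - s) (sub_pos.2 hss) ?_
    exact hcone s ⟨by linarith [hs.1], by linarith [hs.2]⟩ s'
      ⟨by linarith [hs'.1], by linarith [hs'.2]⟩ hss t
  have hself := hmon.self_of_nhdsWithin hf
  -- a radius that works for `f` inside a given neighbourhood
  have hrad : ∀ V ∈ 𝓝 z, ∃ r > 0, r ≤ r₁ ∧ r ≤ r₂ ∧ r ≤ r₃ ∧
      (∀ s ∈ Set.Icc (-r) r, ∀ t ∈ Set.Icc (-r) r, Φ (s, t) ∈ V ∩ Metric.ball z ρ) ∧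
      f (Φ (-r, 0)) < 0 ∧ 0 < f (Φ (r, 0)) := by
    intro V hV
    obtain ⟨r₀, hr₀, hb⟩ := hsmall _ (inter_mem hV (Metric.ball_mem_nhds z hρ))
    set r := min r₀ (min r₁ (min r₂ r₃)) with hr
    have h0 : 0 < r := lt_min hr₀ (lt_min hr₁ (lt_min hr₂ hr₃))
    have l0 : r ≤ r₀ := min_le_left _ _
    have l1 : r ≤ r₁ := (min_le_right _ _).trans (min_le_left _ _)
    have l2 : r ≤ r₂ := (min_le_right _ _).trans ((min_le_right _ _).trans (min_le_left _ _))
    have l3 : r ≤ r₃ := (min_le_right _ _).trans ((min_le_right _ _).trans (min_le_right _ _))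
    have hb' : ∀ s ∈ Set.Icc (-r) r, ∀ t ∈ Set.Icc (-r) r, Φ (s, t) ∈ V ∩ Metric.ball z ρ :=
      fun s hs t ht => hb s ⟨by linarith [hs.1], by linarith [hs.2]⟩ t
        ⟨by linarith [ht.1], by linarith [ht.2]⟩
    have hmf := hmono f hself r l1 fun s hs t ht => (hb' s hs t ht).2
    have z0 : (0 : ℝ) ∈ Set.Icc (-r) r := ⟨by linarith, h0.le⟩
    have zl : (-r : ℝ) ∈ Set.Icc (-r) r := ⟨le_rfl, by linarith⟩
    have zr : (r : ℝ) ∈ Set.Icc (-r) r := ⟨by linarith, le_rfl⟩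
    have hz0 : f (Φ (0, 0)) = 0 := by rw [hΦ.origin]; exact hz.2
    refine ⟨r, h0, l1, l2, l3, hb', ?_, ?_⟩
    · have := hmf 0 z0 (-r) zl 0 z0 (by linarith)
      linarith
    · have := hmf 0 z0 0 z0 r zr h0
      linarith
  constructor
  · obtain ⟨r, hr, l1, l2, l3, hb, hneg, hpos⟩ := hrad Set.univ univ_mem
    -- the signs on the two short sides persist for small `t`
    have hdisk' : ∀ s ∈ Set.Icc (-r) r, ∀ t ∈ Set.Icc (a * r) r,
        Φ (s, t) ∈ Metric.closedBall (0 : Plane) 1 := by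
      intro s hs t ht
      refine hdisk s ⟨by linarith [hs.1], by linarith [hs.2]⟩ t ⟨?_, by linarith [ht.2]⟩
      exact (mul_le_mul_of_nonpos_left l2 hΦ.nonpos).trans ht.1
    have hside : ∀ s ∈ Set.Icc (-r) r, ContinuousOn (fun t => f (Φ (s, t))) (Set.Icc (a * r) r) := by
      intro s hs
      refine hf2.comp (hΦ.continuous.comp (by fun_prop)).continuousOn fun t ht => ?_
      exact closedBall_one_subset_two (hdisk' s hs t ht)
    have h00 : (0 : ℝ) ∈ Set.Icc (a * r) r :=
      ⟨mul_nonpos_of_nonpos_of_nonneg hΦ.nonpos hr.le, hr.le⟩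
    have zl : (-r : ℝ) ∈ Set.Icc (-r) r := ⟨le_rfl, by linarith⟩
    have zr : (r : ℝ) ∈ Set.Icc (-r) r := ⟨by linarith, le_rfl⟩
    set m := min (-f (Φ (-r, 0))) (f (Φ (r, 0))) / 4 with hm
    have hm0 : 0 < m := by
      have : 0 < min (-f (Φ (-r, 0))) (f (Φ (r, 0))) := lt_min (by linarith) hpos
      positivity
    have hm1 : f (Φ (-r, 0)) ≤ -4 * m := by
      have := min_le_left (-f (Φ (-r, 0))) (f (Φ (r, 0)))
      linarith
    have hm2 : 4 * m ≤ f (Φ (r, 0)) := by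
      have := min_le_right (-f (Φ (-r, 0))) (f (Φ (r, 0)))
      linarith
    obtain ⟨d₁, hd₁, hd₁'⟩ := Metric.continuousOn_iff.1 (hside (-r) zl) 0 h00 m hm0
    obtain ⟨d₂, hd₂, hd₂'⟩ := Metric.continuousOn_iff.1 (hside r zr) 0 h00 m hm0
    set t₀ := min r (min (d₁ / 2) (d₂ / 2)) with ht₀
    have ht0 : 0 < t₀ := by positivity
    have htr : t₀ ≤ r := min_le_left _ _
    have htd1 : t₀ ≤ d₁ / 2 := (min_le_right _ _).trans (min_le_left _ _)
    have htd2 : t₀ ≤ d₂ / 2 := (min_le_right _ _).trans (min_le_right _ _)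
    have hrange : ∀ t ∈ Set.Icc (a * t₀) t₀, t ∈ Set.Icc (a * r) r ∧ t ∈ Set.Icc (-r) r ∧
        |t| ≤ t₀ := by
      intro t ht
      have e1 : a * r ≤ a * t₀ := mul_le_mul_of_nonpos_left htr hΦ.nonpos
      have e2 : -t₀ ≤ a * t₀ := by nlinarith [hΦ.ge]
      exact ⟨⟨e1.trans ht.1, ht.2.trans htr⟩, ⟨by linarith [ht.1], ht.2.trans htr⟩,
        abs_le.2 ⟨by linarith [ht.1], ht.2⟩⟩
    obtain ⟨W, hWo, hzW, hW⟩ := hΦ.nbhd r hr t₀ ht0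
    refine ⟨W, hWo, hzW, ?_⟩
    filter_upwards [hmon, eventually_uniformly_close M f hf hm0, self_mem_nhdsWithin] with
      g hg hgf hgM
    have hgm := hmono g hg r l1 fun s hs t ht => (hb s hs t ht).2
    have hcont : ContinuousOn (fun x => g (Φ x)) (Set.Icc (-r) r ×ˢ Set.Icc (a * t₀) t₀) := by
      refine (smoothClass_continuousOn hgM).comp hΦ.continuous.continuousOn ?_
      rintro ⟨s, t⟩ ⟨hs, ht⟩
      exact closedBall_one_subset_two (hdisk' s hs t (hrange t ht).1)
    have hpre := isPreconnected_box_zeroSet (H := fun x => g (Φ x)) hr hcont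
      (fun t ht s hs s' hs' hss => hgm t (hrange t ht).2.1 s hs s' hs' hss)
      (fun t ht => by
        have h1 := abs_le.1 (hgf _ (closedBall_one_subset_two (hdisk' (-r) zl t (hrange t ht).1)))
        have h2 := hd₁' t (hrange t ht).1 (by
          rw [dist_zero_right, Real.norm_eq_abs]
          linarith [(hrange t ht).2.2])
        rw [Real.dist_eq, abs_lt] at h2
        linarith [h1.2, h2.2])
      (fun t ht => by
        have h1 := abs_le.1 (hgf _ (closedBall_one_subset_two (hdisk' r zr t (hrange t ht).1)))
        have h2 := hd₂' t (hrange t ht).1 (by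
          rw [dist_zero_right, Real.norm_eq_abs]
          linarith [(hrange t ht).2.2])
        rw [Real.dist_eq, abs_lt] at h2
        linarith [h1.1, h2.1])
    refine ⟨_, hpre.image Φ hΦ.continuous.continuousOn, ?_, ?_⟩
    · rintro _ ⟨⟨s, t⟩, ⟨⟨hs, ht⟩, h0⟩, rfl⟩
      exact ⟨hdisk' s hs t (hrange t ht).1, h0⟩
    · rintro p ⟨hpW, hpd, hp0⟩
      obtain ⟨s, hs, t, ht, rfl⟩ := hW p hpW hpd
      exact ⟨(s, t), ⟨⟨hs, ht⟩, hp0⟩, rfl⟩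
  · intro V hV
    obtain ⟨r, hr, l1, l2, l3, hb, hneg, hpos⟩ := hrad V hV
    have z0 : (0 : ℝ) ∈ Set.Icc (-r) r := ⟨by linarith, hr.le⟩
    have hd0 : ∀ s ∈ Set.Icc (-r) r, Φ (s, 0) ∈ Metric.closedBall (0 : Plane) 1 := by
      intro s hs
      refine hdisk s ⟨by linarith [hs.1], by linarith [hs.2]⟩ 0 ⟨?_, hr₂.le⟩
      exact mul_nonpos_of_nonpos_of_nonneg hΦ.nonpos hr₂.le
    have zl : (-r : ℝ) ∈ Set.Icc (-r) r := ⟨le_rfl, by linarith⟩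
    have zr : (r : ℝ) ∈ Set.Icc (-r) r := ⟨by linarith, le_rfl⟩
    have hm0 : 0 < min (-f (Φ (-r, 0))) (f (Φ (r, 0))) := lt_min (by linarith) hpos
    filter_upwards [eventually_uniformly_close M f hf hm0, self_mem_nhdsWithin] with g hgf hgM
    have hcont : ContinuousOn (fun s => g (Φ (s, 0))) (Set.Icc (-r) r) :=
      (smoothClass_continuousOn hgM).comp (hΦ.continuous.comp (by fun_prop)).continuousOn
        fun s hs => closedBall_one_subset_two (hd0 s hs)
    have h1 := abs_le.1 (hgf _ (closedBall_one_subset_two (hd0 _ zl)))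
    have h2 := abs_le.1 (hgf _ (closedBall_one_subset_two (hd0 _ zr)))
    have h3 := min_le_left (-f (Φ (-r, 0))) (f (Φ (r, 0)))
    have h4 := min_le_right (-f (Φ (-r, 0))) (f (Φ (r, 0)))
    obtain ⟨s, hs, hs0⟩ := intermediate_value_Icc (by linarith) hcont
      (show (0 : ℝ) ∈ _ from ⟨by linarith [h1.2], by linarith [h2.1]⟩)
    refine ⟨Φ (s, 0), (hb s hs 0 z0).1, ⟨hd0 s hs, hs0⟩, fun h => hcirc h s ?_⟩
    exact ⟨by linarith [hs.1], by linarith [hs.2]⟩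

/-! ### Stability of the nodal count -/

theorem isCompact_diskZeros {M : ℝ} {f : Plane → ℝ} (hf : f ∈ smoothClass M) :
    IsCompact (diskZeros f) :=
  isCompact_zeroSet ((smoothClass_continuousOn hf).mono closedBall_one_subset_two)

theorem connectedComponentIn_eq_of_mem_preconnected {X : Type*} [TopologicalSpace X]
    {S F : Set X} (hS : IsPreconnected S) (hSF : S ⊆ F) {a b : X} (ha : a ∈ S) (hb : b ∈ S) :
    connectedComponentIn F a = connectedComponentIn F b :=
  connectedComponentIn_eq (hS.subset_connectedComponentIn ha hSF hb)

/-- If a connected set `Γ` is covered by open sets such that any two of them meeting inside `Γ` are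
joined by a point of `Z`, and each of them contains points of one component of `Z` only, then
all these points of `Z` lie in the same component. -/
theorem component_eq_of_chain {X ι : Type*} [TopologicalSpace X] {Γ Z : Set X} {t : Set ι}
    {W : ι → Set X} (hΓ : IsPreconnected Γ) (hWo : ∀ i ∈ t, IsOpen (W i))
    (hcov : Γ ⊆ ⋃ i ∈ t, W i)
    (hloc : ∀ i ∈ t, ∃ S, IsPreconnected S ∧ S ⊆ Z ∧ W i ∩ Z ⊆ S)
    (hmeet : ∀ i ∈ t, ∀ j ∈ t, (W i ∩ W j ∩ Γ).Nonempty → (W i ∩ W j ∩ Z).Nonempty)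
    {i j : ι} (hi : i ∈ t) (hj : j ∈ t) (hiΓ : (W i ∩ Γ).Nonempty) (hjΓ : (W j ∩ Γ).Nonempty)
    {a b : X} (ha : a ∈ W i ∩ Z) (hb : b ∈ W j ∩ Z) :
    connectedComponentIn Z a = connectedComponentIn Z b := by
  have hW : ∀ k ∈ t, ∀ x ∈ W k ∩ Z, ∀ y ∈ W k ∩ Z,
      connectedComponentIn Z x = connectedComponentIn Z y := by
    intro k hk x hx y hy
    obtain ⟨S, hS, hSZ, hWS⟩ := hloc k hk
    exact connectedComponentIn_eq_of_mem_preconnected hS hSZ (hWS hx) (hWS hy)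
  set A : Set ι := {k ∈ t | ∀ x ∈ W k ∩ Z, connectedComponentIn Z x = connectedComponentIn Z a}
  by_contra hne
  have hU : IsOpen (⋃ k ∈ A, W k) := isOpen_biUnion fun k hk => hWo k hk.1
  have hV : IsOpen (⋃ k ∈ t \ A, W k) := isOpen_biUnion fun k hk => hWo k hk.1
  have hiA : i ∈ A := ⟨hi, fun x hx => hW i hi x hx a ha⟩
  have hjA : j ∈ t \ A := ⟨hj, fun h => hne (h.2 b hb).symm⟩
  obtain ⟨x, hx⟩ := hiΓ
  obtain ⟨y, hy⟩ := hjΓ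
  obtain ⟨p, hpΓ, hpU, hpV⟩ := hΓ _ _ hU hV (fun x hx => by
      obtain ⟨k, hk, hxk⟩ := Set.mem_iUnion₂.1 (hcov hx)
      by_cases hkA : k ∈ A
      · exact Or.inl (Set.mem_iUnion₂.2 ⟨k, hkA, hxk⟩)
      · exact Or.inr (Set.mem_iUnion₂.2 ⟨k, ⟨hk, hkA⟩, hxk⟩))
    ⟨x, hx.2, Set.mem_iUnion₂.2 ⟨i, hiA, hx.1⟩⟩ ⟨y, hy.2, Set.mem_iUnion₂.2 ⟨j, hjA, hy.1⟩⟩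
  obtain ⟨k, hkA, hpk⟩ := Set.mem_iUnion₂.1 hpU
  obtain ⟨l, hlA, hpl⟩ := Set.mem_iUnion₂.1 hpV
  obtain ⟨q, ⟨hqk, hql⟩, hqZ⟩ := hmeet k hkA.1 l hlA.1 ⟨p, ⟨hpk, hpl⟩, hpΓ⟩
  refine hlA.2 ⟨hlA.1, fun x hx => ?_⟩
  rw [hW l hlA.1 x hx q ⟨hql, hqZ⟩]
  exact hkA.2 q ⟨hqk, hqZ⟩

/-- A regular function of the class has finitely many nodal domains in the disk, and their number
is locally constant in the class. -/
theorem nodalCount_stable {M : ℝ} (hM : 1 ≤ M) {f : Plane → ℝ} (hf : f ∈ smoothClass M)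
    (hreg : IsRegularOn M f) :
    nodalCount (Metric.closedBall 0 1) f 1 ≠ ⊤ ∧ ∀ᶠ g in 𝓝[smoothClass M] f,
      nodalCount (Metric.closedBall 0 1) g 1 = nodalCount (Metric.closedBall 0 1) f 1 := by
  classical
  have hK := isCompact_diskZeros hf
  have hloc := fun z (hz : z ∈ diskZeros f) => local_structure hM hf hreg hz
  choose! W hWo hzW hWev using fun z hz => (hloc z hz).1
  obtain ⟨t, htK, htf, hcov⟩ := hK.elim_finite_subcover_image (b := diskZeros f) (c := W)
    (fun z hz => hWo z hz) fun z hz => Set.mem_iUnion₂.2 ⟨z, hz, hzW z hz⟩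
  -- any component of a zero set covered by the `W i` meets one of them
  have hpick : ∀ g : Plane → ℝ, diskZeros g ⊆ ⋃ i ∈ t, W i → ∀ Γ ∈ innerComponents (diskZeros g) 1,
      ∃ i ∈ t, ∃ x ∈ W i ∩ diskZeros g, Γ = connectedComponentIn (diskZeros g) x := by
    rintro g hg Γ ⟨⟨x, hx, rfl⟩, -⟩
    obtain ⟨i, hi, hxi⟩ := Set.mem_iUnion₂.1 (hg hx)
    exact ⟨i, hi, x, ⟨hxi, hx⟩, rfl⟩
  have hEloc : ∀ᶠ g in 𝓝[smoothClass M] f, ∀ i ∈ t,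
      ∃ S, IsPreconnected S ∧ S ⊆ diskZeros g ∧ W i ∩ diskZeros g ⊆ S :=
    (eventually_all_finite htf).2 fun i hi => hWev i (htK hi)
  have hfin : nodalCount (Metric.closedBall 0 1) f 1 ≠ ⊤ := by
    have hlocf := hEloc.self_of_nhdsWithin hf
    choose! i hit x hx hΓ using hpick f hcov
    have hinj : Set.InjOn i (innerComponents (diskZeros f) 1) := by
      intro Γ₁ h₁ Γ₂ h₂ heq
      obtain ⟨S, hS, hSZ, hWS⟩ := hlocf _ (hit Γ₁ h₁)
      rw [hΓ Γ₁ h₁, hΓ Γ₂ h₂]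
      exact connectedComponentIn_eq_of_mem_preconnected hS hSZ (hWS (hx Γ₁ h₁))
        (hWS (heq ▸ hx Γ₂ h₂))
    have hle : (innerComponents (diskZeros f) 1).encard ≤ t.encard :=
      Set.encard_le_encard_of_injOn (fun Γ h => hit Γ h) hinj
    exact (hle.trans_lt (Set.encard_lt_top_iff.2 htf)).ne
  refine ⟨hfin, ?_⟩
  -- zeros of nearby functions stay in the cover
  have hEcov : ∀ᶠ g in 𝓝[smoothClass M] f, diskZeros g ⊆ ⋃ i ∈ t, W i := by
    have hUo : IsOpen (⋃ i ∈ t, W i) := isOpen_biUnion fun i hi => hWo i (htK hi)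
    have hA : IsCompact (Metric.closedBall (0 : Plane) 1 \ ⋃ i ∈ t, W i) :=
      (isCompact_closedBall _ _).diff hUo
    rcases (Metric.closedBall (0 : Plane) 1 \ ⋃ i ∈ t, W i).eq_empty_or_nonempty with h0 | hne
    · refine Eventually.of_forall fun g p hp => ?_
      exact Set.sdiff_eq_empty.1 h0 hp.1
    · obtain ⟨y, hy, hmin⟩ := hA.exists_isMinOn hne
        (((smoothClass_continuousOn hf).mono closedBall_one_subset_two).mono Set.sdiff_subset).abs
      have hpos : 0 < |f y| := abs_pos.2 fun h0 => hy.2 (hcov ⟨hy.1, h0⟩)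
      filter_upwards [eventually_uniformly_close M f hf (half_pos hpos)] with g hg p hp
      by_contra hpn
      have h1 := hg p (closedBall_one_subset_two hp.1)
      have h2 : |f y| ≤ |f p| := hmin ⟨hp.1, hpn⟩
      rw [hp.2, zero_sub, abs_neg] at h1
      linarith
  -- zeros persist where two sets of the cover meet on the zero set, and on the unit circle
  have hEmeet : ∀ᶠ g in 𝓝[smoothClass M] f, ∀ i ∈ t, ∀ j ∈ t,
      (W i ∩ W j ∩ diskZeros f).Nonempty → (W i ∩ W j ∩ diskZeros g).Nonempty := by
    refine (eventually_all_finite htf).2 fun i hi => (eventually_all_finite htf).2 fun j hj => ?_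
    by_cases h : (W i ∩ W j ∩ diskZeros f).Nonempty
    · obtain ⟨p, hp, hpZ⟩ := h
      filter_upwards [(hloc p hpZ).2 _
        (((hWo i (htK hi)).inter (hWo j (htK hj))).mem_nhds hp)] with g hg _
      obtain ⟨q, hq, hqZ, -⟩ := hg
      exact ⟨q, hq, hqZ⟩
    · exact Eventually.of_forall fun g h' => absurd h' h
  have hEcirc : ∀ᶠ g in 𝓝[smoothClass M] f, ∀ i ∈ t,
      (∃ p ∈ W i ∩ diskZeros f, ‖p‖ = 1) → ∃ p ∈ W i ∩ diskZeros g, ‖p‖ = 1 := by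
    refine (eventually_all_finite htf).2 fun i hi => ?_
    by_cases h : ∃ p ∈ W i ∩ diskZeros f, ‖p‖ = 1
    · obtain ⟨p, ⟨hpW, hpZ⟩, hp1⟩ := h
      filter_upwards [(hloc p hpZ).2 _ ((hWo i (htK hi)).mem_nhds hpW)] with g hg _
      obtain ⟨q, hq, hqZ, hq1⟩ := hg
      exact ⟨q, ⟨hq, hqZ⟩, hq1 hp1⟩
    · exact Eventually.of_forall fun g h' => absurd h' h
  -- lower bound: separating open sets still contain sign changes
  have hElow : ∀ᶠ g in 𝓝[smoothClass M] f,
      nodalCount (Metric.closedBall 0 1) f 1 ≤ nodalCount (Metric.closedBall 0 1) g 1 := by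
    obtain ⟨k, hk⟩ := ENat.ne_top_iff_exists.1 hfin
    obtain ⟨s, hs, hsd⟩ := (le_encard_innerComponents_iff hK 1 k).1 (by
      rw [hk]; exact le_rfl)
    have hEz : ∀ᶠ g in 𝓝[smoothClass M] f, ∀ i, (diskZeros g ∩ basisClosed (s i)).Nonempty := by
      refine eventually_all.2 fun i => ?_
      obtain ⟨p, hpZ, hp⟩ := (hs i).2.2
      have hpo : p ∈ basisOpen (s i) := by
        by_contra hn
        exact Set.disjoint_left.1 (hs i).2.1 hpZ ⟨hp, hn⟩
      filter_upwards [(hloc p hpZ).2 _ ((isOpen_basisOpen (s i)).mem_nhds hpo)] with g hg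
      obtain ⟨q, hq, hqZ, -⟩ := hg
      exact ⟨q, hqZ, basisOpen_subset_basisClosed _ hq⟩
    have hEd : ∀ A : Set Plane, IsCompact A → Disjoint (diskZeros f) A →
        ∀ᶠ g in 𝓝[smoothClass M] f, Disjoint (diskZeros g) A := by
      intro A hA hd
      rcases (A ∩ Metric.closedBall 0 1).eq_empty_or_nonempty with h0 | hne
      · refine Eventually.of_forall fun g => Set.disjoint_left.2 fun p hp hpA => ?_
        exact Set.notMem_empty p (h0 ▸ ⟨hpA, hp.1⟩)
      · obtain ⟨y, hy, hmin⟩ := (hA.inter_right Metric.isClosed_closedBall).exists_isMinOn hne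
          (((smoothClass_continuousOn hf).mono closedBall_one_subset_two).mono
            Set.inter_subset_right).abs
        have hpos : 0 < |f y| := abs_pos.2 fun h0 => Set.disjoint_left.1 hd ⟨hy.2, h0⟩ hy.1
        filter_upwards [eventually_uniformly_close M f hf (half_pos hpos)] with g hg
        refine Set.disjoint_left.2 fun p hp hpA => ?_
        have h1 := hg p (closedBall_one_subset_two hp.1)
        have h2 : |f y| ≤ |f p| := hmin ⟨hpA, hp.1⟩
        rw [hp.2, zero_sub, abs_neg] at h1
        linarith
    have hE1 : ∀ᶠ g in 𝓝[smoothClass M] f, ∀ i,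
        Disjoint (diskZeros g) (basisClosed (s i) \ basisOpen (s i)) :=
      eventually_all.2 fun i => hEd _ ((isCompact_basisClosed _).diff (isOpen_basisOpen _))
        (hs i).2.1
    have hE2 : ∀ᶠ g in 𝓝[smoothClass M] f, ∀ i j, i ≠ j →
        Disjoint (diskZeros g) (basisClosed (s i) ∩ basisClosed (s j)) := by
      refine eventually_all.2 fun i => eventually_all.2 fun j => ?_
      by_cases hij : i = j
      · exact Eventually.of_forall fun g h => absurd hij h
      · filter_upwards [hEd _ ((isCompact_basisClosed (s i)).inter (isCompact_basisClosed (s j)))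
          (hsd i j hij)] with g hg _ using hg
    filter_upwards [hEz, hE1, hE2, self_mem_nhdsWithin] with g h1 h2 h3 hgM
    rw [← hk]
    exact (le_encard_innerComponents_iff (isCompact_diskZeros hgM) 1 k).2
      ⟨s, fun i => ⟨(hs i).1, h2 i, h1 i⟩, h3⟩
  filter_upwards [hEloc, hEcov, hEmeet, hEcirc, hElow, self_mem_nhdsWithin] with
    g hgloc hgcov hgmeet hgcirc hglow hgM
  refine le_antisymm ?_ hglow
  -- upper bound: send a nodal domain of `g` to the nodal domain of `f` through the same chart
  choose! i hit x hx hΓ using hpick g hgcov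
  have hiK : ∀ Γ ∈ innerComponents (diskZeros g) 1, i Γ ∈ diskZeros f := fun Γ h => htK (hit Γ h)
  have hmeets : ∀ Γ ∈ innerComponents (diskZeros g) 1,
      (W (i Γ) ∩ connectedComponentIn (diskZeros f) (i Γ)).Nonempty := fun Γ h =>
    ⟨i Γ, hzW _ (hiK Γ h), mem_connectedComponentIn (hiK Γ h)⟩
  have hchain : ∀ Γ₁ ∈ innerComponents (diskZeros g) 1, ∀ j ∈ t,
      (W j ∩ connectedComponentIn (diskZeros f) (i Γ₁)).Nonempty → ∀ b ∈ W j ∩ diskZeros g,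
      Γ₁ = connectedComponentIn (diskZeros g) b := by
    intro Γ₁ h₁ j hj hjΓ b hb
    rw [hΓ Γ₁ h₁]
    refine component_eq_of_chain (Γ := connectedComponentIn (diskZeros f) (i Γ₁)) (t := t) (W := W)
      isPreconnected_connectedComponentIn (fun k hk => hWo k (htK hk))
      ((connectedComponentIn_subset _ _).trans hcov) hgloc ?_ (hit Γ₁ h₁) hj (hmeets Γ₁ h₁) hjΓ
      (hx Γ₁ h₁) hb
    intro k hk l hl hne
    exact hgmeet k hk l hl (hne.mono (Set.inter_subset_inter_right _
      (connectedComponentIn_subset _ _)))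
  refine Set.encard_le_encard_of_injOn
    (f := fun Γ => connectedComponentIn (diskZeros f) (i Γ)) ?_ ?_
  · intro Γ h
    refine ⟨⟨i Γ, hiK Γ h, rfl⟩, fun p hp => ?_⟩
    have hpZ := connectedComponentIn_subset _ _ hp
    have hp1 := hpZ.1
    rw [mem_closedBall_zero_iff] at hp1
    rw [mem_ball_zero_iff]
    refine lt_of_le_of_ne hp1 fun hp1 => ?_
    obtain ⟨j, hj, hpj⟩ := Set.mem_iUnion₂.1 (hcov hpZ)
    obtain ⟨b, hb, hb1⟩ := hgcirc j hj ⟨p, ⟨hpj, hpZ⟩, hp1⟩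
    have hΓb := hchain Γ h j hj ⟨p, hpj, hp⟩ b hb
    have hbΓ : b ∈ Γ := by
      rw [hΓb]
      exact mem_connectedComponentIn hb.2
    have := h.2 hbΓ
    rw [mem_ball_zero_iff] at this
    linarith
  · intro Γ₁ h₁ Γ₂ h₂ heq
    have := hchain Γ₁ h₁ (i Γ₂) (hit Γ₂ h₂) (by
      simp only at heq
      rw [heq]
      exact hmeets Γ₂ h₂) (x Γ₂) (hx Γ₂ h₂)
    rw [this, ← hΓ Γ₂ h₂]

/-! ### From finite-dimensional convergence to convergence of the nodal count -/

/-- The restriction of a function to the disk of radius `2`, extended by zero. -/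
def cutoff (f : Plane → ℝ) : Plane → ℝ := (Metric.closedBall (0 : Plane) 2).indicator f

theorem cutoff_apply {f : Plane → ℝ} {p : Plane} (hp : p ∈ Metric.closedBall (0 : Plane) 2) :
    cutoff f p = f p := Set.indicator_of_mem hp f

theorem nodalCount_cutoff (f : Plane → ℝ) :
    nodalCount (Metric.closedBall 0 1) (cutoff f) 1 = nodalCount (Metric.closedBall 0 1) f 1 :=
  nodalCount_congr fun _ hz => cutoff_apply (closedBall_one_subset_two hz)

instance nonempty_closedBall_two : Nonempty (Metric.closedBall (0 : Plane) 2) := ⟨⟨0, by simp⟩⟩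

/-- Finite sets increasing to a dense subset of the disk of radius `2`. -/
def gridFinset (m : ℕ) : Finset Plane := by
  classical
  exact (Finset.range (m + 1)).image
    fun i => (TopologicalSpace.denseSeq (Metric.closedBall (0 : Plane) 2) i : Plane)

theorem gridFinset_subset (m : ℕ) : (gridFinset m : Set Plane) ⊆ Metric.closedBall 0 2 := by
  intro p hp
  obtain ⟨i, -, rfl⟩ := Finset.mem_image.1 (Finset.mem_coe.1 hp)
  exact Subtype.prop _

theorem gridFinset_mono (m : ℕ) : gridFinset m ⊆ gridFinset (m + 1) :=
  Finset.image_subset_image (Finset.range_subset_range.2 (by omega))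

theorem eq_of_eq_on_grid {f g : Plane → ℝ} (hf : ContinuousOn f (Metric.closedBall 0 2))
    (hg : ContinuousOn g (Metric.closedBall 0 2)) (h : ∀ m, ∀ p ∈ gridFinset m, f p = g p) :
    ∀ p ∈ Metric.closedBall (0 : Plane) 2, f p = g p := by
  have h1 := (continuousOn_iff_continuous_domRestrict.1 hf)
  have h2 := (continuousOn_iff_continuous_domRestrict.1 hg)
  have := (TopologicalSpace.denseRange_denseSeq (Metric.closedBall (0 : Plane) 2)).equalizer h1 h2
    (by
      ext i
      exact h i _ (Finset.mem_image.2 ⟨i, by simp, rfl⟩))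
  intro p hp
  exact congrFun this ⟨p, hp⟩

variable {Ω Ω' : Type*} [MeasurableSpace Ω] [MeasurableSpace Ω']

/-- Membership of a continuous function in a closed part of the class is decided by its values on
the finite grids. -/
theorem cutoff_mem_iff {M : ℝ} {C : Set (Plane → ℝ)} (hC : IsClosed C) (hCM : C ⊆ smoothClass M)
    {f : Plane → ℝ} (hf : ContinuousOn f (Metric.closedBall 0 2)) :
    cutoff f ∈ C ↔ ∀ m, (fun p : gridFinset m => f p) ∈
      (fun g : Plane → ℝ => fun p : gridFinset m => g p) '' C := by
  constructor
  · intro h m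
    exact ⟨_, h, funext fun p => cutoff_apply (gridFinset_subset m p.2)⟩
  · intro h
    have hCc : IsCompact C := (isCompact_smoothClass M).of_isClosed_subset hC hCM
    let T : ℕ → Set (Plane → ℝ) := fun m => C ∩ {g | ∀ p ∈ gridFinset m, g p = f p}
    have hTcl : ∀ m, IsClosed (T m) := by
      intro m
      refine hC.inter ?_
      have : {g : Plane → ℝ | ∀ p ∈ gridFinset m, g p = f p} =
          ⋂ p ∈ gridFinset m, {g : Plane → ℝ | g p = f p} := by ext g; simp
      rw [this]
      exact isClosed_biInter fun p _ => isClosed_eq (continuous_apply p) continuous_const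
    obtain ⟨g, hg⟩ := IsCompact.nonempty_iInter_of_sequence_nonempty_isCompact_isClosed T
      (fun m g hg => ⟨hg.1, fun p hp => hg.2 p (gridFinset_mono m hp)⟩)
      (fun m => by
        obtain ⟨g, hg, hgf⟩ := h m
        exact ⟨g, hg, fun p hp => congrFun hgf ⟨p, hp⟩⟩)
      (hCc.of_isClosed_subset (hTcl 0) Set.inter_subset_left) hTcl
    rw [Set.mem_iInter] at hg
    have hgM := hCM (hg 0).1
    have heq := eq_of_eq_on_grid hf (smoothClass_continuousOn hgM)
      fun m p hp => ((hg m).2 p hp).symm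
    have : cutoff f = g := by
      ext p
      by_cases hp : p ∈ Metric.closedBall (0 : Plane) 2
      · rw [cutoff_apply hp, heq p hp]
      · rw [hgM.2.1 p hp]
        exact Set.indicator_of_notMem hp f
    rw [this]
    exact (hg 0).1

theorem isClosed_gridImage {M : ℝ} {C : Set (Plane → ℝ)} (hC : IsClosed C)
    (hCM : C ⊆ smoothClass M) (m : ℕ) :
    IsClosed ((fun g : Plane → ℝ => fun p : gridFinset m => g p) '' C) :=
  (((isCompact_smoothClass M).of_isClosed_subset hC hCM).image
    (continuous_pi fun _ => continuous_apply _)).isClosed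

theorem nullMeasurableSet_grid {P' : Measure Ω'} {Y : Ω' → Plane → ℝ}
    (hYm : ∀ p ∈ Metric.closedBall (0 : Plane) 2, AEMeasurable (fun ω => Y ω p) P') {M : ℝ}
    {C : Set (Plane → ℝ)} (hC : IsClosed C) (hCM : C ⊆ smoothClass M) (m : ℕ) :
    NullMeasurableSet {ω | (fun p : gridFinset m => Y ω p) ∈
      (fun g : Plane → ℝ => fun p : gridFinset m => g p) '' C} P' := by
  have : AEMeasurable (fun ω => fun p : gridFinset m => Y ω p) P' :=
    aemeasurable_pi_iff.2 fun p => hYm p (gridFinset_subset m p.2)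
  exact this.nullMeasurable (isClosed_gridImage hC hCM m).measurableSet

theorem nullMeasurableSet_cutoff_mem {P' : Measure Ω'} {Y : Ω' → Plane → ℝ}
    (hYc : ∀ ω, ContinuousOn (Y ω) (Metric.closedBall 0 2))
    (hYm : ∀ p ∈ Metric.closedBall (0 : Plane) 2, AEMeasurable (fun ω => Y ω p) P') {M : ℝ}
    {C : Set (Plane → ℝ)} (hC : IsClosed C) (hCM : C ⊆ smoothClass M) :
    NullMeasurableSet {ω | cutoff (Y ω) ∈ C} P' := by
  have : {ω | cutoff (Y ω) ∈ C} = ⋂ m, {ω | (fun p : gridFinset m => Y ω p) ∈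
      (fun g : Plane → ℝ => fun p : gridFinset m => g p) '' C} := by
    ext ω
    rw [Set.mem_iInter]
    exact cutoff_mem_iff hC hCM (hYc ω)
  rw [this]
  exact NullMeasurableSet.iInter fun m => nullMeasurableSet_grid hYm hC hCM m

/-- Convergence of the finite-dimensional marginals, in the form of the portmanteau inequality for
closed sets. -/
def FddLimsup (Q : Measure Ω) (P' : Measure Ω') (X : ℕ → Ω → Plane → ℝ) (Y : Ω' → Plane → ℝ) :
    Prop :=
  ∀ s : Finset Plane, (s : Set Plane) ⊆ Metric.closedBall 0 2 → ∀ C : Set (s → ℝ), IsClosed C →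
    ∀ δ : ℝ≥0∞, δ ≠ 0 → ∀ᶠ n in atTop,
      Q {ω | (fun p : s => X n ω p) ∈ C} ≤ P' {ω | (fun p : s => Y ω p) ∈ C} + δ

/-- The portmanteau inequality extends from finite-dimensional marginals to closed parts of the
compact class. -/
theorem FddLimsup.measure_cutoff_mem_le {Q : Measure Ω} {P' : Measure Ω'} [IsProbabilityMeasure P']
    {X : ℕ → Ω → Plane → ℝ} {Y : Ω' → Plane → ℝ} (h : FddLimsup Q P' X Y)
    (hYc : ∀ ω, ContinuousOn (Y ω) (Metric.closedBall 0 2))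
    (hYm : ∀ p ∈ Metric.closedBall (0 : Plane) 2, AEMeasurable (fun ω => Y ω p) P') {M : ℝ}
    {C : Set (Plane → ℝ)} (hC : IsClosed C) (hCM : C ⊆ smoothClass M) {δ : ℝ≥0∞} (hδ : δ ≠ 0) :
    ∀ᶠ n in atTop, Q {ω | cutoff (X n ω) ∈ C} ≤ P' {ω | cutoff (Y ω) ∈ C} + δ := by
  let A : ℕ → Set Ω' := fun m => {ω | (fun p : gridFinset m => Y ω p) ∈
      (fun g : Plane → ℝ => fun p : gridFinset m => g p) '' C}
  have hAanti : Antitone A := by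
    refine antitone_nat_of_succ_le fun m ω hω => ?_
    obtain ⟨g, hg, hgY⟩ := hω
    exact ⟨g, hg, funext fun p => congrFun hgY ⟨p, gridFinset_mono m p.2⟩⟩
  have hA : {ω | cutoff (Y ω) ∈ C} = ⋂ m, A m := by
    ext ω
    rw [Set.mem_iInter]
    exact cutoff_mem_iff hC hCM (hYc ω)
  have hlim : Tendsto (fun m => P' (A m)) atTop (𝓝 (P' {ω | cutoff (Y ω) ∈ C})) := by
    rw [hA]
    exact tendsto_measure_iInter_atTop (fun m => nullMeasurableSet_grid hYm hC hCM m) hAanti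
      ⟨0, measure_ne_top _ _⟩
  have hδ2 : δ / 2 ≠ 0 := by simp [hδ]
  obtain ⟨m, hm⟩ := (hlim.eventually_lt_const (u := P' {ω | cutoff (Y ω) ∈ C} + δ / 2)
    (ENNReal.lt_add_right (measure_ne_top _ _) hδ2)).exists
  filter_upwards [h (gridFinset m) (gridFinset_subset m) _ (isClosed_gridImage hC hCM m) (δ / 2) hδ2]
    with n hn
  calc Q {ω | cutoff (X n ω) ∈ C} ≤ Q {ω | (fun p : gridFinset m => X n ω p) ∈
          (fun g : Plane → ℝ => fun p : gridFinset m => g p) '' C} := by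
        refine measure_mono fun ω hω => ⟨_, hω, funext fun p => ?_⟩
        exact cutoff_apply (gridFinset_subset m p.2)
    _ ≤ P' (A m) + δ / 2 := hn
    _ ≤ P' {ω | cutoff (Y ω) ∈ C} + δ / 2 + δ / 2 := by gcongr
    _ = P' {ω | cutoff (Y ω) ∈ C} + δ := by rw [add_assoc, ENNReal.add_halves]

/-- If the marginals converge, the sequence is tight in the class, and the limit is almost surely
regular, then the nodal count of the limit is almost surely finite and the laws of the counts
converge. -/
theorem nodalCount_limit {Q : Measure Ω} [IsProbabilityMeasure Q] {P' : Measure Ω'}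
    [IsProbabilityMeasure P'] {X : ℕ → Ω → Plane → ℝ} {Y : Ω' → Plane → ℝ}
    (h : FddLimsup Q P' X Y) (hYc : ∀ ω, ContinuousOn (Y ω) (Metric.closedBall 0 2))
    (hYm : ∀ p ∈ Metric.closedBall (0 : Plane) 2, AEMeasurable (fun ω => Y ω p) P')
    (htight : ∀ δ : ℝ≥0∞, δ ≠ 0 → ∃ M, ∀ᶠ n in atTop, Q {ω | cutoff (X n ω) ∉ smoothClass M} ≤ δ)
    (hreg : ∀ M, P' {ω | cutoff (Y ω) ∈ smoothClass M ∧ ¬ IsRegularOn M (cutoff (Y ω))} = 0) :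
    (∀ᵐ ω ∂P', nodalCount (Metric.closedBall 0 1) (Y ω) 1 ≠ ⊤) ∧
    ∀ k : ℕ∞, ∀ δ : ℝ≥0∞, δ ≠ 0 → ∀ᶠ n in atTop,
      Q {ω | nodalCount (Metric.closedBall 0 1) (X n ω) 1 ≠ k} ≤
        P' {ω | nodalCount (Metric.closedBall 0 1) (Y ω) 1 ≠ k} + δ := by
  have htight' : ∀ δ : ℝ≥0∞, δ ≠ 0 → ∃ M, 1 ≤ M ∧
      ∀ᶠ n in atTop, Q {ω | cutoff (X n ω) ∉ smoothClass M} ≤ δ := by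
    intro δ hδ
    obtain ⟨M, hM⟩ := htight δ hδ
    refine ⟨max M 1, le_max_right _ _, hM.mono fun n hn => (measure_mono fun ω hω => ?_).trans hn⟩
    exact fun hmem => hω (smoothClass_mono (le_max_left _ _) hmem)
  constructor
  -- Tightness passes to the limit, which therefore lies in the class with high probability, and
  -- regular functions of the class have finitely many nodal domains.
  · have hcover : ∀ δ : ℝ≥0∞, δ ≠ 0 →
        P' {ω | nodalCount (Metric.closedBall 0 1) (Y ω) 1 = ⊤} ≤ δ := by
      intro δ hδ
      have hδ2 : δ / 2 ≠ 0 := by simp [hδ]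
      obtain ⟨M, hM1, hM⟩ := htight' (δ / 2) hδ2
      have hcl : IsClosed (smoothClass M) := (isCompact_smoothClass M).isClosed
      obtain ⟨n, hn1, hn2⟩ := (hM.and (h.measure_cutoff_mem_le hYc hYm hcl subset_rfl hδ2)).exists
      have hnull := nullMeasurableSet_cutoff_mem hYc hYm hcl subset_rfl
      have h1 : P' {ω | cutoff (Y ω) ∉ smoothClass M} ≤ δ := by
        have e1 : (1 : ℝ≥0∞) ≤ Q {ω | cutoff (X n ω) ∈ smoothClass M} +
            Q {ω | cutoff (X n ω) ∉ smoothClass M} := by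
          rw [← measure_univ (μ := Q)]
          refine (measure_mono fun ω _ => ?_).trans (measure_union_le _ _)
          exact em _
        have e2 : P' {ω | cutoff (Y ω) ∈ smoothClass M} +
            P' {ω | cutoff (Y ω) ∉ smoothClass M} = 1 := by
          rw [← measure_univ (μ := P')]
          exact measure_add_measure_compl₀ hnull
        have e3 : P' {ω | cutoff (Y ω) ∈ smoothClass M} +
            P' {ω | cutoff (Y ω) ∉ smoothClass M} ≤
            P' {ω | cutoff (Y ω) ∈ smoothClass M} + δ := by
          rw [e2]
          refine e1.trans ((add_le_add hn2 hn1).trans ?_)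
          rw [add_assoc, ENNReal.add_halves]
        exact (ENNReal.add_le_add_iff_left (measure_ne_top _ _)).1 e3
      calc P' {ω | nodalCount (Metric.closedBall 0 1) (Y ω) 1 = ⊤}
          ≤ P' ({ω | cutoff (Y ω) ∉ smoothClass M} ∪
            {ω | cutoff (Y ω) ∈ smoothClass M ∧ ¬ IsRegularOn M (cutoff (Y ω))}) := by
            refine measure_mono fun ω hω => ?_
            by_contra hcon
            simp only [Set.mem_union, Set.mem_ofPred_eq, not_or, not_not, not_and] at hcon
            have := (nodalCount_stable hM1 hcon.1 (hcon.2 hcon.1)).1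
            rw [nodalCount_cutoff] at this
            exact this hω
        _ ≤ δ + 0 := (measure_union_le _ _).trans (add_le_add h1 (hreg M).le)
        _ = δ := add_zero _
    have h0 : P' {ω | nodalCount (Metric.closedBall 0 1) (Y ω) 1 = ⊤} = 0 := by
      by_contra hne
      have h2 := hcover (P' {ω | nodalCount (Metric.closedBall 0 1) (Y ω) 1 = ⊤} / 2)
        (by simp [hne])
      exact absurd h2 (not_le.2 (ENNReal.half_lt_self hne (measure_ne_top _ _)))
    rw [ae_iff]
    simpa using h0
  -- Apply the portmanteau inequality to the closure of the set of functions with the wrong count.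
  · intro k δ hδ
    have hδ2 : δ / 2 ≠ 0 := by simp [hδ]
    obtain ⟨M, hM1, hM⟩ := htight' (δ / 2) hδ2
    set B : Set (Plane → ℝ) := {f ∈ smoothClass M | nodalCount (Metric.closedBall 0 1) f 1 ≠ k}
    have hBM : closure B ⊆ smoothClass M :=
      closure_minimal (fun f hf => hf.1) (isCompact_smoothClass M).isClosed
    -- regular functions in the closure still have the wrong count, by stability
    have hB : ∀ f ∈ closure B, IsRegularOn M f → nodalCount (Metric.closedBall 0 1) f 1 ≠ k := by
      intro f hf hfreg hfk
      have hst := (nodalCount_stable hM1 (hBM hf) hfreg).2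
      have hfr : ∃ᶠ g in 𝓝 f, g ∈ B := mem_closure_iff_frequently.1 hf
      rw [eventually_nhdsWithin_iff] at hst
      obtain ⟨g, hgB, hg⟩ := (hfr.and_eventually hst).exists
      exact hgB.2 ((hg hgB.1).trans hfk)
    filter_upwards [hM, h.measure_cutoff_mem_le hYc hYm isClosed_closure hBM hδ2] with n hn1 hn2
    calc Q {ω | nodalCount (Metric.closedBall 0 1) (X n ω) 1 ≠ k}
        ≤ Q ({ω | cutoff (X n ω) ∈ closure B} ∪ {ω | cutoff (X n ω) ∉ smoothClass M}) := by
          refine measure_mono fun ω hω => ?_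
          by_cases hm : cutoff (X n ω) ∈ smoothClass M
          · exact Or.inl (subset_closure ⟨hm, by rw [nodalCount_cutoff]; exact hω⟩)
          · exact Or.inr hm
      _ ≤ P' {ω | cutoff (Y ω) ∈ closure B} + δ / 2 + δ / 2 :=
          (measure_union_le _ _).trans (add_le_add hn2 hn1)
      _ = P' {ω | cutoff (Y ω) ∈ closure B} + δ := by rw [add_assoc, ENNReal.add_halves]
      _ ≤ P' {ω | nodalCount (Metric.closedBall 0 1) (Y ω) 1 ≠ k} + δ := by
          gcongr ?_ + δ
          calc P' {ω | cutoff (Y ω) ∈ closure B} ≤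
              P' ({ω | nodalCount (Metric.closedBall 0 1) (Y ω) 1 ≠ k} ∪
                {ω | cutoff (Y ω) ∈ smoothClass M ∧ ¬ IsRegularOn M (cutoff (Y ω))}) := by
                refine measure_mono fun ω hω => ?_
                by_cases hr : IsRegularOn M (cutoff (Y ω))
                · left
                  have := hB _ hω hr
                  rwa [nodalCount_cutoff] at this
                · exact Or.inr ⟨hBM hω, hr⟩
            _ ≤ _ := (measure_union_le _ _).trans (by rw [hreg M, add_zero])

/-- Convergence in distribution of extended natural numbers to an almost surely finite limit. -/
theorem tendstoInDistribution_of_eventually_le {Q : Measure Ω} [IsProbabilityMeasure Q]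
    {P' : Measure Ω'} [IsProbabilityMeasure P'] {N : ℕ → Ω → ℕ∞} {N' : Ω' → ℕ∞}
    (hN : ∀ n, AEMeasurable (fun ω => (N n ω : ℝ≥0∞)) Q)
    (hN' : AEMeasurable (fun ω => (N' ω : ℝ≥0∞)) P') (hfin : ∀ᵐ ω ∂P', N' ω ≠ ⊤)
    (h : ∀ k : ℕ∞, ∀ δ : ℝ≥0∞, δ ≠ 0 → ∀ᶠ n in atTop,
      Q {ω | N n ω ≠ k} ≤ P' {ω | N' ω ≠ k} + δ) :
    TendstoInDistribution (fun n ω => (N n ω : ℝ≥0∞)) atTop (fun ω => (N' ω : ℝ≥0∞))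
      (fun _ => Q) P' := by
  have hnullN : ∀ n (k : ℕ), NullMeasurableSet {ω | N n ω = k} Q := by
    intro n k
    have : {ω | N n ω = k} = (fun ω => (N n ω : ℝ≥0∞)) ⁻¹' {(k : ℝ≥0∞)} := by
      ext ω
      simp only [Set.mem_ofPred_eq, Set.mem_preimage, Set.mem_singleton_iff]
      rw [← ENat.toENNReal_coe, ENat.toENNReal_inj]
    rw [this]
    exact (hN n).nullMeasurable (measurableSet_singleton _)
  have hnullN' : ∀ k : ℕ, NullMeasurableSet {ω | N' ω = k} P' := by
    intro k
    have : {ω | N' ω = k} = (fun ω => (N' ω : ℝ≥0∞)) ⁻¹' {(k : ℝ≥0∞)} := by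
      ext ω
      simp only [Set.mem_ofPred_eq, Set.mem_preimage, Set.mem_singleton_iff]
      rw [← ENat.toENNReal_coe, ENat.toENNReal_inj]
    rw [this]
    exact hN'.nullMeasurable (measurableSet_singleton _)
  have hatom : ∀ k : ℕ, P' {ω | N' ω = k} ≤ liminf (fun n => Q {ω | N n ω = k}) atTop := by
    intro k
    refine ENNReal.le_of_forall_pos_le_add fun δ hδ _ => ?_
    have hδ' : (δ : ℝ≥0∞) ≠ 0 := by simpa using hδ.ne'
    have hev : ∀ᶠ n in atTop, P' {ω | N' ω = k} - δ ≤ Q {ω | N n ω = k} := by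
      filter_upwards [h k δ hδ'] with n hn
      rw [tsub_le_iff_right]
      have e1 : Q {ω | N n ω = k} + Q {ω | N n ω ≠ k} = 1 := by
        rw [← measure_univ (μ := Q)]
        exact measure_add_measure_compl₀ (hnullN n k)
      have e2 : P' {ω | N' ω = k} + P' {ω | N' ω ≠ k} = 1 := by
        rw [← measure_univ (μ := P')]
        exact measure_add_measure_compl₀ (hnullN' k)
      have e3 : P' {ω | N' ω = k} + P' {ω | N' ω ≠ k} ≤
          Q {ω | N n ω = k} + δ + P' {ω | N' ω ≠ k} := by
        rw [e2, ← e1, add_assoc, add_comm (δ : ℝ≥0∞)]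
        gcongr
      exact (ENNReal.add_le_add_iff_right (measure_ne_top _ _)).1 e3
    rw [← tsub_le_iff_right]
    exact le_liminf_of_le (by isBoundedDefault) hev
  refine ⟨hN, hN', ?_⟩
  refine tendsto_of_forall_isOpen_le_liminf' fun G hG => ?_
  simp only [ProbabilityMeasure.coe_mk]
  rw [Measure.map_apply_of_aemeasurable hN' hG.measurableSet]
  simp_rw [Measure.map_apply_of_aemeasurable (hN _) hG.measurableSet]
  have hdisj : ∀ {α : Type _} (Z : α → ℕ∞), Pairwise (Function.onFun Disjoint
      fun k : ℕ => {ω | Z ω = k ∧ (k : ℝ≥0∞) ∈ G}) := by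
    intro α Z j k hjk
    refine Set.disjoint_left.2 fun ω hj hk => hjk ?_
    exact_mod_cast hj.1.symm.trans hk.1
  calc P' ((fun ω => (N' ω : ℝ≥0∞)) ⁻¹' G)
      ≤ P' (⋃ k : ℕ, {ω | N' ω = k ∧ (k : ℝ≥0∞) ∈ G}) := by
        refine measure_mono_ae ?_
        filter_upwards [hfin] with ω hω hωG
        obtain ⟨k, hk⟩ := ENat.ne_top_iff_exists.1 hω
        refine Set.mem_iUnion.2 ⟨k, hk.symm, ?_⟩
        have : (N' ω : ℝ≥0∞) ∈ G := hωG
        rwa [← hk, ENat.toENNReal_coe] at this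
    _ ≤ ∑' k : ℕ, P' {ω | N' ω = k ∧ (k : ℝ≥0∞) ∈ G} := measure_iUnion_le _
    _ ≤ ∑' k : ℕ, liminf (fun n => Q {ω | N n ω = k ∧ (k : ℝ≥0∞) ∈ G}) atTop := by
        refine ENNReal.tsum_le_tsum fun k => ?_
        by_cases hk : (k : ℝ≥0∞) ∈ G
        · simpa [hk] using hatom k
        · simp [hk]
    _ = ∫⁻ k : ℕ, liminf (fun n => Q {ω | N n ω = k ∧ (k : ℝ≥0∞) ∈ G}) atTop ∂Measure.count := by
        rw [lintegral_count]
    _ ≤ liminf (fun n => ∫⁻ k : ℕ, Q {ω | N n ω = k ∧ (k : ℝ≥0∞) ∈ G} ∂Measure.count) atTop :=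
        lintegral_liminf_le fun n => measurable_from_top
    _ ≤ liminf (fun n => Q ((fun ω => (N n ω : ℝ≥0∞)) ⁻¹' G)) atTop := by
        refine liminf_le_liminf (Eventually.of_forall fun n => ?_)
        rw [lintegral_count, ← measure_iUnion₀ ((hdisj (N n)).mono fun _ _ h => h.aedisjoint)]
        · refine measure_mono (Set.iUnion_subset fun k ω hω => ?_)
          change (N n ω : ℝ≥0∞) ∈ G
          rw [hω.1, ENat.toENNReal_coe]
          exact hω.2
        · intro k
          by_cases hk : (k : ℝ≥0∞) ∈ G
          · simpa [hk] using hnullN n k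
          · simp [hk]

/-! ### Almost sure regularity of a Gaussian field -/

section Regularity

variable {Ω' : Type*} [MeasurableSpace Ω'] {P' : Measure Ω'}

theorem measure_abs_le_of_gaussian {X : Ω' → ℝ} (hX : HasGaussianLaw X P') {v : ℝ} (hv : 0 < v)
    (hvX : v ≤ Var[X; P']) {b : ℝ} :
    P' {ω | |X ω| ≤ b} ≤ ENNReal.ofReal (2 * b / √v) := by
  have h1 : P' {ω | |X ω| ≤ b} = P'.map X (Set.Icc (-b) b) := by
    rw [Measure.map_apply_of_aemeasurable hX.aemeasurable measurableSet_Icc]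
    congr 1
    ext ω
    simp only [Set.mem_ofPred_eq, Set.mem_preimage, Set.mem_Icc, abs_le]
  have hv' : 0 < Var[X; P'] := hv.trans_le hvX
  rw [h1, hX.map_eq_gaussianReal, gaussianReal_apply _ (Real.toNNReal_pos.2 hv').ne']
  calc ∫⁻ x in Set.Icc (-b) b, gaussianPDF (P'[X]) Var[X; P'].toNNReal x
      ≤ ∫⁻ _ in Set.Icc (-b) b, ENNReal.ofReal (1 / √v) := by
        refine lintegral_mono fun x => ENNReal.ofReal_le_ofReal ?_
        rw [gaussianPDFReal_def, one_div]
        have e1 : Real.exp (-(x - P'[X]) ^ 2 / (2 * (Var[X; P'].toNNReal : ℝ))) ≤ 1 := by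
          rw [Real.exp_le_one_iff, neg_div, neg_nonpos]
          positivity
        have e2 : √v ≤ √(2 * Real.pi * (Var[X; P'].toNNReal : ℝ)) := by
          refine Real.sqrt_le_sqrt ?_
          rw [Real.coe_toNNReal _ hv'.le]
          nlinarith [Real.pi_gt_three]
        have e3 : 0 < √v := Real.sqrt_pos.2 hv
        calc _ ≤ (√(2 * Real.pi * (Var[X; P'].toNNReal : ℝ)))⁻¹ * 1 := mul_le_mul_of_nonneg_left e1 (by positivity)
          _ ≤ (√v)⁻¹ := by rw [mul_one]; exact inv_anti₀ e3 e2
    _ = ENNReal.ofReal (1 / √v) * ENNReal.ofReal (2 * b) := by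
        rw [setLIntegral_const, Real.volume_Icc]
        congr 2
        ring
    _ = ENNReal.ofReal (2 * b / √v) := by
        rw [← ENNReal.ofReal_mul (by positivity)]
        congr 1
        ring

variable {Z : Plane → Ω' → ℝ}

/-- The sum and the difference of two values of the field are independent, of variances at least `1`
and `κ t²`, which gives a small-ball estimate for the pair. -/
theorem measure_pair_le (hG : IsGaussianProcess Z P') (h0 : ∀ x, ∫ ω, Z x ω ∂P' = 0)
    (hv : ∀ x, ∫ ω, Z x ω * Z x ω ∂P' = 1) {p q : Plane} {t κ b : ℝ} (hκ : 0 < κ) (ht : 0 < t)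
    (hb : 0 ≤ b) (h1 : κ * t ^ 2 ≤ 1 - ∫ ω, Z p ω * Z q ω ∂P') (h2 : 0 ≤ ∫ ω, Z p ω * Z q ω ∂P') :
    P' {ω | |Z p ω| ≤ b ∧ |Z q ω| ≤ b} ≤ ENNReal.ofReal (16 * b ^ 2 / (√κ * t)) := by
  have := hG.isProbabilityMeasure
  have hL2 : ∀ x, MemLp (Z x) 2 P' := fun x => (hG.hasGaussianLaw_eval x).memLp_two
  have hcov : ∀ x y, cov[Z x, Z y; P'] = ∫ ω, Z x ω * Z y ω ∂P' := by
    intro x y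
    rw [covariance_eq_sub (hL2 x) (hL2 y), h0, h0]
    simp
  set c := ∫ ω, Z p ω * Z q ω ∂P' with hc
  have hcqp : ∫ ω, Z q ω * Z p ω ∂P' = c := by simp_rw [hc, mul_comm]
  have hpair := hG.hasGaussianLaw_prodMk (s := p) (t := q)
  have hSD : HasGaussianLaw (fun ω => (Z p ω + Z q ω, Z p ω - Z q ω)) P' :=
    hpair.map_fun ((ContinuousLinearMap.fst ℝ ℝ ℝ + ContinuousLinearMap.snd ℝ ℝ ℝ).prod
      (ContinuousLinearMap.fst ℝ ℝ ℝ - ContinuousLinearMap.snd ℝ ℝ ℝ))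
  have hind : IndepFun (Z p + Z q) (Z p - Z q) P' := by
    refine HasGaussianLaw.indepFun_of_covariance_eq_zero hSD ?_
    rw [covariance_add_left (hL2 p) (hL2 q) ((hL2 p).sub (hL2 q)),
      covariance_sub_right (hL2 p) (hL2 p) (hL2 q), covariance_sub_right (hL2 q) (hL2 p) (hL2 q),
      hcov, hcov, hcov, hcov, hv, hv, hcqp]
    ring
  have hVS : Var[Z p + Z q; P'] = 2 + 2 * c := by
    rw [variance_add (hL2 p) (hL2 q), ← covariance_self (hL2 p).1.aemeasurable,
      ← covariance_self (hL2 q).1.aemeasurable, hcov, hcov, hcov, hv, hv]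
    ring
  have hVD : Var[Z p - Z q; P'] = 2 - 2 * c := by
    rw [variance_sub (hL2 p) (hL2 q), ← covariance_self (hL2 p).1.aemeasurable,
      ← covariance_self (hL2 q).1.aemeasurable, hcov, hcov, hcov, hv, hv]
    ring
  have hS := measure_abs_le_of_gaussian (X := Z p + Z q) hSD.fst (v := 1) one_pos
    (by rw [hVS]; linarith) (b := 2 * b)
  have hD := measure_abs_le_of_gaussian (X := Z p - Z q) hSD.snd (v := κ * t ^ 2) (by positivity)
    (by rw [hVD]; nlinarith [mul_pos hκ (pow_pos ht 2)]) (b := 2 * b)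
  calc P' {ω | |Z p ω| ≤ b ∧ |Z q ω| ≤ b}
      ≤ P' ((Z p + Z q) ⁻¹' {x | |x| ≤ 2 * b} ∩ (Z p - Z q) ⁻¹' {x | |x| ≤ 2 * b}) := by
        refine measure_mono fun ω hω => ⟨?_, ?_⟩
        · exact (abs_add_le (Z p ω) (Z q ω)).trans (by linarith [hω.1, hω.2])
        · exact (abs_sub (Z p ω) (Z q ω)).trans (by linarith [hω.1, hω.2])
    _ = P' {ω | |(Z p + Z q) ω| ≤ 2 * b} * P' {ω | |(Z p - Z q) ω| ≤ 2 * b} :=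
        hind.measure_inter_preimage_eq_mul _ _ (measurableSet_le (by fun_prop) (by fun_prop))
          (measurableSet_le (by fun_prop) (by fun_prop))
    _ ≤ ENNReal.ofReal (2 * (2 * b) / √1) * ENNReal.ofReal (2 * (2 * b) / √(κ * t ^ 2)) := by
        gcongr
    _ = ENNReal.ofReal (16 * b ^ 2 / (√κ * t)) := by
        rw [← ENNReal.ofReal_mul (by positivity), Real.sqrt_one, Real.sqrt_mul hκ.le,
          Real.sqrt_sq ht.le]
        congr 1
        ring

theorem exists_grid_near {N : ℕ} (hN : 0 < N) (x : ℝ) (k : ℕ) (hx : |x| ≤ k) :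
    ∃ i ∈ Finset.Icc (-(k * N : ℤ)) (k * N : ℤ), |(i : ℝ) / N - x| ≤ 1 / N := by
  have hN' : (0 : ℝ) < N := by exact_mod_cast hN
  rw [abs_le] at hx
  have h1 := Int.floor_le (x * N)
  have h2 := Int.lt_floor_add_one (x * N)
  refine ⟨⌊x * N⌋, Finset.mem_Icc.2 ⟨?_, ?_⟩, ?_⟩
  · rw [Int.le_floor]
    push_cast
    nlinarith
  · have : (⌊x * N⌋ : ℝ) ≤ ((k * N : ℤ) : ℝ) := by
      push_cast
      nlinarith
    exact_mod_cast this
  · rw [abs_le]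
    constructor
    · rw [neg_le_sub_iff_le_add, ← add_div, le_div_iff₀ hN']
      linarith
    · rw [sub_le_iff_le_add, div_le_iff₀ hN', add_mul, div_mul_cancel₀ _ hN'.ne']
      linarith

/-- Points of the grid of mesh `1 / N`. -/
def gridPoint (N : ℕ) (i j : ℤ) : Plane := !₂[(i : ℝ) / N, (j : ℝ) / N]

/-- Points of the unit circle at angles that are multiples of `1 / N`. -/
def circlePoint (N : ℕ) (j : ℤ) : Plane := !₂[Real.cos ((j : ℝ) / N), Real.sin ((j : ℝ) / N)]

/-- The definition of the class bounds some gradient at each point; this bounds all of them. -/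
theorem norm_le_of_hasQuadApprox {M : ℝ} {f : Plane → ℝ} (hf : f ∈ smoothClass M) {z G : Plane}
    (hz : z ∈ Metric.closedBall (0 : Plane) 1) (h : HasQuadApprox M f z G) : ‖G‖ ≤ 3 * M := by
  rcases eq_or_ne G 0 with rfl | hG
  · simpa using smoothClass_nonneg hf
  have hn : ‖G‖ ≠ 0 := norm_ne_zero_iff.2 hG
  rw [mem_closedBall_zero_iff] at hz
  have hu : ‖‖G‖⁻¹ • G‖ = 1 := by
    rw [norm_smul, norm_inv, norm_norm, inv_mul_cancel₀ hn]
  have hp : z + ‖G‖⁻¹ • G ∈ Metric.closedBall (0 : Plane) 2 := by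
    rw [mem_closedBall_zero_iff]
    exact (norm_add_le _ _).trans (by rw [hu]; linarith)
  have hz2 : z ∈ Metric.closedBall (0 : Plane) 2 := by
    rw [mem_closedBall_zero_iff]; linarith
  have h1 := h _ hp
  have h2 : inner ℝ G (‖G‖⁻¹ • G) = ‖G‖ := by
    rw [inner_smul_right, real_inner_self_eq_norm_sq]
    field_simp
  rw [add_sub_cancel_left, hu, h2] at h1
  have h3 := abs_le.1 (hf.1 _ hp)
  have h4 := abs_le.1 (hf.1 _ hz2)
  have h5 := abs_le.1 h1
  linarith

/-- Bulinskaya's argument: a singular zero forces small values at a nearby pair of grid points. -/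
theorem exists_small_of_singular {M : ℝ} {f : Plane → ℝ} (hf : f ∈ smoothClass M) {N : ℕ}
    (hN : 3 ≤ N) {z : Plane} (hz : z ∈ Metric.closedBall (0 : Plane) 1) (hfz : f z = 0)
    (h : HasQuadApprox M f z 0) :
    ∃ i ∈ Finset.Icc (-(1 * N : ℤ)) (1 * N : ℤ), ∃ j ∈ Finset.Icc (-(1 * N : ℤ)) (1 * N : ℤ),
      gridPoint N i j ∈ Metric.closedBall (0 : Plane) 2 ∧
      gridPoint N (i + 1) j ∈ Metric.closedBall (0 : Plane) 2 ∧
      |f (gridPoint N i j)| ≤ 6 * M / N ^ 2 ∧ |f (gridPoint N (i + 1) j)| ≤ 6 * M / N ^ 2 := by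
  have hM := smoothClass_nonneg hf
  have hN0 : (0 : ℝ) < N := by
    have : 0 < N := by omega
    exact_mod_cast this
  have hN3 : (3 : ℝ) ≤ N := by exact_mod_cast hN
  rw [mem_closedBall_zero_iff] at hz
  have hz' : z 0 ^ 2 + z 1 ^ 2 ≤ 1 := by
    rw [← norm_sq_plane]
    exact pow_le_one₀ (norm_nonneg z) hz
  have hz0 : |z 0| ≤ (1 : ℕ) := by
    rw [Nat.cast_one, ← sq_le_one_iff_abs_le_one]
    nlinarith [sq_nonneg (z 1)]
  have hz1 : |z 1| ≤ (1 : ℕ) := by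
    rw [Nat.cast_one, ← sq_le_one_iff_abs_le_one]
    nlinarith [sq_nonneg (z 0)]
  obtain ⟨i, hi, hi'⟩ := exists_grid_near (by omega : 0 < N) (z 0) 1 hz0
  obtain ⟨j, hj, hj'⟩ := exists_grid_near (by omega : 0 < N) (z 1) 1 hz1
  have s0 : ((i : ℝ) / N - z 0) ^ 2 ≤ (1 / N : ℝ) ^ 2 := sq_le_sq' (abs_le.1 hi').1 (abs_le.1 hi').2
  have s1 : ((j : ℝ) / N - z 1) ^ 2 ≤ (1 / N : ℝ) ^ 2 := sq_le_sq' (abs_le.1 hj').1 (abs_le.1 hj').2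
  have hu : (0 : ℝ) < 1 / N := by positivity
  have hu3 : (1 / N : ℝ) ≤ 1 / 3 := one_div_le_one_div_of_le (by norm_num) hN3
  have d0 : ‖gridPoint N i j - z‖ ^ 2 ≤ 6 * (1 / N : ℝ) ^ 2 := by
    rw [norm_sq_plane]
    simp only [gridPoint, PiLp.sub_apply, Matrix.cons_val_zero,
      Matrix.cons_val_one, Matrix.cons_val_fin_one]
    nlinarith [sq_nonneg (1 / N : ℝ)]
  have d1 : ‖gridPoint N (i + 1) j - z‖ ^ 2 ≤ 6 * (1 / N : ℝ) ^ 2 := by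
    rw [norm_sq_plane]
    simp only [gridPoint, PiLp.sub_apply, Matrix.cons_val_zero,
      Matrix.cons_val_one, Matrix.cons_val_fin_one]
    push_cast
    rw [add_div]
    have := abs_le.1 hi'
    nlinarith [sq_nonneg (1 / N : ℝ)]
  have hmem : ∀ p : Plane, ‖p - z‖ ^ 2 ≤ 6 * (1 / N : ℝ) ^ 2 → p ∈ Metric.closedBall (0 : Plane) 2 := by
    intro p hp
    rw [mem_closedBall_zero_iff]
    have h1 : ‖p - z‖ ≤ 1 := by
      rw [← sq_le_one_iff₀ (norm_nonneg _)]
      nlinarith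
    have := norm_add_le (p - z) z
    rw [sub_add_cancel] at this
    linarith
  have hval : ∀ p : Plane, ‖p - z‖ ^ 2 ≤ 6 * (1 / N : ℝ) ^ 2 → |f p| ≤ 6 * M / N ^ 2 := by
    intro p hp
    have := h p (hmem p hp)
    rw [hfz, inner_zero_left, sub_zero, sub_zero] at this
    calc |f p| ≤ M * ‖p - z‖ ^ 2 := this
      _ ≤ M * (6 * (1 / N : ℝ) ^ 2) := by gcongr
      _ = 6 * M / N ^ 2 := by field_simp
  exact ⟨i, hi, j, hj, hmem _ d0, hmem _ d1, hval _ d0, hval _ d1⟩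

/-- A zero on the circle at which the tangential derivative vanishes forces a very small value at a
nearby point of a fine net of the circle. -/
theorem exists_small_of_tangent {M : ℝ} {f : Plane → ℝ} (hf : f ∈ smoothClass M) {N : ℕ}
    (hN : 1 ≤ N) {z G : Plane} (hz : z ∈ Metric.sphere (0 : Plane) 1) (hfz : f z = 0)
    (h : HasQuadApprox M f z G) {c : ℝ} (hG : G = c • z) :
    ∃ j ∈ Finset.Icc (-(4 * N : ℤ)) (4 * N : ℤ),
      circlePoint N j ∈ Metric.closedBall (0 : Plane) 2 ∧
      |f (circlePoint N j)| ≤ 5 * M / N ^ 2 := by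
  have hM := smoothClass_nonneg hf
  have hN0 : (0 : ℝ) < N := by exact_mod_cast hN
  have hz1 : ‖z‖ = 1 := mem_sphere_zero_iff_norm.1 hz
  have hGn := norm_le_of_hasQuadApprox hf (Metric.sphere_subset_closedBall hz) h
  have hzz : z 0 ^ 2 + z 1 ^ 2 = 1 := by rw [← norm_sq_plane, hz1]; norm_num
  obtain ⟨α, hα, hc0, hs0⟩ : ∃ α : ℝ, |α| ≤ (4 : ℕ) ∧ Real.cos α = z 0 ∧ Real.sin α = z 1 := by
    have hn : ‖(⟨z 0, z 1⟩ : ℂ)‖ = 1 := by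
      rw [Complex.norm_eq_sqrt_sq_add_sq, hzz, Real.sqrt_one]
    refine ⟨Complex.arg ⟨z 0, z 1⟩, (Complex.abs_arg_le_pi _).trans ?_, ?_, ?_⟩
    · have := Real.pi_lt_four
      push_cast
      linarith
    · have := Complex.norm_mul_cos_arg (⟨z 0, z 1⟩ : ℂ)
      rwa [hn, one_mul] at this
    · have := Complex.norm_mul_sin_arg (⟨z 0, z 1⟩ : ℂ)
      rwa [hn, one_mul] at this
  obtain ⟨j, hj, hj'⟩ := exists_grid_near (by omega : 0 < N) α 4 hα
  have hn1 : ‖circlePoint N j‖ = 1 := by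
    have : ‖circlePoint N j‖ ^ 2 = 1 := by
      rw [norm_sq_plane]
      simp [circlePoint]
    nlinarith [norm_nonneg (circlePoint N j)]
  have hmem : circlePoint N j ∈ Metric.closedBall (0 : Plane) 2 := by
    rw [mem_closedBall_zero_iff, hn1]; norm_num
  have d0 : ‖circlePoint N j - z‖ ^ 2 ≤ 2 * (1 / N : ℝ) ^ 2 := by
    have e1 : |Real.cos (j / N) - Real.cos α| ≤ 1 / N :=
      (Real.abs_cos_sub_cos_le _ _).trans hj'
    have e2 : |Real.sin (j / N) - Real.sin α| ≤ 1 / N :=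
      (Real.abs_sin_sub_sin_le _ _).trans hj'
    rw [norm_sq_plane]
    simp only [circlePoint, PiLp.sub_apply, Matrix.cons_val_zero,
      Matrix.cons_val_one, Matrix.cons_val_fin_one]
    rw [← hc0, ← hs0]
    have := sq_le_sq' (abs_le.1 e1).1 (abs_le.1 e1).2
    have := sq_le_sq' (abs_le.1 e2).1 (abs_le.1 e2).2
    linarith
  refine ⟨j, hj, hmem, ?_⟩
  set p := circlePoint N j
  have hinner : inner ℝ z (p - z) = -(‖p - z‖ ^ 2 / 2) := by
    rw [norm_sub_sq_real, hn1, hz1, inner_sub_right, real_inner_self_eq_norm_sq, hz1,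
      real_inner_comm]
    ring
  have hcM : |c| ≤ 3 * M := by
    rwa [hG, norm_smul, hz1, mul_one, Real.norm_eq_abs] at hGn
  have h1 := h p hmem
  rw [hfz, sub_zero, hG, inner_smul_left, hinner] at h1
  simp only [conj_trivial] at h1
  have h2 := abs_le.1 h1
  have h3 := abs_le.1 hcM
  have h4 : |f p| ≤ (5 / 2) * M * ‖p - z‖ ^ 2 := by
    rw [abs_le]
    constructor <;> nlinarith [sq_nonneg ‖p - z‖]
  calc |f p| ≤ (5 / 2) * M * ‖p - z‖ ^ 2 := h4
    _ ≤ (5 / 2) * M * (2 * (1 / N : ℝ) ^ 2) := by gcongr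
    _ = 5 * M / N ^ 2 := by field_simp

/-- A centred Gaussian field of unit variance whose increments in the first direction are
nondegenerate is almost surely regular, where it belongs to the class. -/
theorem measure_not_regular_eq_zero (hG : IsGaussianProcess Z P') (h0 : ∀ x, ∫ ω, Z x ω ∂P' = 0)
    (hv : ∀ x, ∫ ω, Z x ω * Z x ω ∂P' = 1) {κ : ℝ} (hκ : 0 < κ)
    (hinc : ∀ᶠ N : ℕ in atTop, ∀ i j : ℤ,
      κ * (1 / N : ℝ) ^ 2 ≤ 1 - ∫ ω, Z (gridPoint N i j) ω * Z (gridPoint N (i + 1) j) ω ∂P' ∧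
      0 ≤ ∫ ω, Z (gridPoint N i j) ω * Z (gridPoint N (i + 1) j) ω ∂P') (M : ℝ) :
    P' {ω | cutoff (fun y => Z y ω) ∈ smoothClass M ∧
      ¬ IsRegularOn M (cutoff fun y => Z y ω)} = 0 := by
  have := hG.isProbabilityMeasure
  rcases lt_or_ge M 0 with hM | hM
  · refine measure_mono_null (t := ∅) (fun ω hω => ?_) measure_empty
    exact absurd (smoothClass_nonneg hω.1) (not_le.2 hM)
  -- There are `O(N²)` pairs of grid points, each with small values of order `N⁻²` with probability
  -- `O(N⁻³)`, and `O(N)` points of the circle, each with small values with probability `O(N⁻²)`.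
  have hbound : ∀ᶠ N : ℕ in atTop, P' {ω | cutoff (fun y => Z y ω) ∈ smoothClass M ∧
      ¬ IsRegularOn M (cutoff fun y => Z y ω)} ≤
      ENNReal.ofReal ((5184 * M ^ 2 / √κ + 90 * M) / N) := by
    filter_upwards [hinc, eventually_ge_atTop 3] with N hN hN3
    have hN0 : (0 : ℝ) < N := by
      have : 0 < N := by omega
      exact_mod_cast this
    have hN1 : (1 : ℝ) ≤ N := by
      have : 1 ≤ N := by omega
      exact_mod_cast this
    set I := Finset.Icc (-(1 * N : ℤ)) (1 * N : ℤ)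
    set J := Finset.Icc (-(4 * N : ℤ)) (4 * N : ℤ)
    have hI : (I.card : ℝ) ≤ 3 * N := by
      have : I.card = 2 * N + 1 := by
        simp only [I, Int.card_Icc]
        omega
      rw [this]
      push_cast
      linarith
    have hJ : (J.card : ℝ) ≤ 9 * N := by
      have : J.card = 8 * N + 1 := by
        simp only [J, Int.card_Icc]
        omega
      rw [this]
      push_cast
      linarith
    have hsub : {ω | cutoff (fun y => Z y ω) ∈ smoothClass M ∧
        ¬ IsRegularOn M (cutoff fun y => Z y ω)} ⊆
        (⋃ i ∈ I, ⋃ j ∈ I, {ω | |Z (gridPoint N i j) ω| ≤ 6 * M / N ^ 2 ∧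
          |Z (gridPoint N (i + 1) j) ω| ≤ 6 * M / N ^ 2}) ∪
        ⋃ j ∈ J, {ω | |Z (circlePoint N j) ω| ≤ 5 * M / N ^ 2} := by
      rintro ω ⟨hmem, hnr⟩
      rw [IsRegularOn, not_and_or] at hnr
      rcases hnr with hnr | hnr
      · left
        push Not at hnr
        obtain ⟨z, hz, hfz, G, hG, rfl⟩ := hnr
        obtain ⟨i, hi, j, hj, b1, b2, h1, h2⟩ := exists_small_of_singular hmem hN3 hz hfz hG
        rw [cutoff_apply b1] at h1
        rw [cutoff_apply b2] at h2
        exact Set.mem_iUnion₂.2 ⟨i, hi, Set.mem_iUnion₂.2 ⟨j, hj, h1, h2⟩⟩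
      · right
        push Not at hnr
        obtain ⟨z, hz, hfz, G, hG, c, hc⟩ := hnr
        obtain ⟨j, hj, b1, h1⟩ := exists_small_of_tangent hmem (by omega : 1 ≤ N) hz hfz hG hc
        rw [cutoff_apply b1] at h1
        exact Set.mem_iUnion₂.2 ⟨j, hj, h1⟩
    have hvar : ∀ x, Var[Z x; P'] = 1 := by
      intro x
      have hL2 := (hG.hasGaussianLaw_eval x).memLp_two
      rw [← covariance_self hL2.1.aemeasurable, covariance_eq_sub hL2 hL2, h0]
      simpa using hv x
    refine (measure_mono hsub).trans ((measure_union_le _ _).trans ?_)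
    have hA : P' (⋃ i ∈ I, ⋃ j ∈ I, {ω | |Z (gridPoint N i j) ω| ≤ 6 * M / N ^ 2 ∧
          |Z (gridPoint N (i + 1) j) ω| ≤ 6 * M / N ^ 2}) ≤
        ENNReal.ofReal (5184 * M ^ 2 / √κ / N) := by
      calc _ ≤ ∑ i ∈ I, ∑ j ∈ I, P' {ω | |Z (gridPoint N i j) ω| ≤ 6 * M / N ^ 2 ∧
          |Z (gridPoint N (i + 1) j) ω| ≤ 6 * M / N ^ 2} :=
            (measure_biUnion_finset_le _ _).trans
              (Finset.sum_le_sum fun i _ => measure_biUnion_finset_le _ _)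
        _ ≤ ∑ i ∈ I, ∑ j ∈ I, ENNReal.ofReal (16 * (6 * M / N ^ 2) ^ 2 / (√κ * (1 / N))) :=
            Finset.sum_le_sum fun i _ => Finset.sum_le_sum fun j _ =>
              measure_pair_le hG h0 hv hκ (by positivity) (by positivity) (hN i j).1 (hN i j).2
        _ = ENNReal.ofReal (I.card * (I.card * (16 * (6 * M / N ^ 2) ^ 2 / (√κ * (1 / N))))) := by
            rw [Finset.sum_const, Finset.sum_const, nsmul_eq_mul, nsmul_eq_mul,
              ENNReal.ofReal_mul (by positivity), ENNReal.ofReal_mul (by positivity),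
              ENNReal.ofReal_natCast]
        _ ≤ ENNReal.ofReal (5184 * M ^ 2 / √κ / N) := by
            refine ENNReal.ofReal_le_ofReal ?_
            have hk : 0 < √κ := Real.sqrt_pos.2 hκ
            calc (I.card : ℝ) * (I.card * (16 * (6 * M / N ^ 2) ^ 2 / (√κ * (1 / N))))
                ≤ (3 * N) * ((3 * N) * (16 * (6 * M / N ^ 2) ^ 2 / (√κ * (1 / N)))) := by gcongr
              _ = 5184 * M ^ 2 / √κ / N := by field_simp; ring
    have hB : P' (⋃ j ∈ J, {ω | |Z (circlePoint N j) ω| ≤ 5 * M / N ^ 2}) ≤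
        ENNReal.ofReal (90 * M / N) := by
      calc _ ≤ ∑ j ∈ J, P' {ω | |Z (circlePoint N j) ω| ≤ 5 * M / N ^ 2} :=
            measure_biUnion_finset_le _ _
        _ ≤ ∑ j ∈ J, ENNReal.ofReal (2 * (5 * M / N ^ 2) / √1) :=
            Finset.sum_le_sum fun j _ => measure_abs_le_of_gaussian
              (hG.hasGaussianLaw_eval _) one_pos (hvar _).ge
        _ = ENNReal.ofReal (J.card * (2 * (5 * M / N ^ 2) / √1)) := by
            rw [Finset.sum_const, nsmul_eq_mul, ENNReal.ofReal_mul (by positivity),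
              ENNReal.ofReal_natCast]
        _ ≤ ENNReal.ofReal (90 * M / N) := by
            refine ENNReal.ofReal_le_ofReal ?_
            rw [Real.sqrt_one, div_one]
            calc (J.card : ℝ) * (2 * (5 * M / N ^ 2)) ≤ (9 * N) * (2 * (5 * M / N ^ 2)) := by gcongr
              _ = 90 * M / N := by field_simp; ring
    calc _ ≤ ENNReal.ofReal (5184 * M ^ 2 / √κ / N) + ENNReal.ofReal (90 * M / N) :=
          add_le_add hA hB
      _ = ENNReal.ofReal ((5184 * M ^ 2 / √κ + 90 * M) / N) := by
          rw [← ENNReal.ofReal_add (by positivity) (by positivity), add_div]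
  have hlim : Tendsto (fun N : ℕ => ENNReal.ofReal ((5184 * M ^ 2 / √κ + 90 * M) / N)) atTop (𝓝 0) := by
    rw [← ENNReal.ofReal_zero]
    exact ENNReal.tendsto_ofReal (tendsto_const_div_atTop_nhds_zero_nat _)
  exact le_antisymm (ge_of_tendsto hlim hbound) bot_le

end Regularity

/-! ### Invariance of the uniform measure on a sphere -/

section Sphere

theorem sphereMap_norm_aux {E : Type*} [NormedAddCommGroup E] [InnerProductSpace ℝ E]
    (A : E ≃ₗᵢ[ℝ] E) (x : Metric.sphere (0 : E) 1) : A x ∈ Metric.sphere (0 : E) 1 := by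
  rw [mem_sphere_zero_iff_norm, A.norm_map, norm_eq_of_mem_sphere x]

/-- The action of a linear isometry on the unit sphere. -/
def sphereMap {E : Type*} [NormedAddCommGroup E] [InnerProductSpace ℝ E]
    (A : E ≃ₗᵢ[ℝ] E) (x : Metric.sphere (0 : E) 1) : Metric.sphere (0 : E) 1 :=
  ⟨A x, sphereMap_norm_aux A x⟩

theorem continuous_sphereMap {E : Type*} [NormedAddCommGroup E] [InnerProductSpace ℝ E]
    (A : E ≃ₗᵢ[ℝ] E) : Continuous (sphereMap A) :=
  (A.continuous.comp continuous_subtype_val).subtype_mk _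

variable {E : Type*} [NormedAddCommGroup E] [InnerProductSpace ℝ E] [FiniteDimensional ℝ E]
  [MeasurableSpace E] [BorelSpace E]

theorem measurePreserving_sphereMap (A : E ≃ₗᵢ[ℝ] E) :
    MeasurePreserving (sphereMap A) (uniformSphere E) (uniformSphere E) := by
  refine ⟨(continuous_sphereMap A).measurable, ?_⟩
  ext s hs
  rw [Measure.map_apply (continuous_sphereMap A).measurable hs]
  simp only [uniformSphere, Measure.smul_apply, smul_eq_mul]
  congr 1
  rw [Measure.toSphere_apply' _ hs,
    Measure.toSphere_apply' _ ((continuous_sphereMap A).measurable hs)]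
  congr 1
  have hA : MeasurePreserving A.toHomeomorph.toMeasurableEquiv (volume : Measure E) volume :=
    A.measurePreserving
  refine Eq.trans ?_ (hA.measure_preimage_equiv _)
  congr 1
  ext z
  simp only [Set.mem_smul, Set.mem_image, Set.mem_preimage]
  change _ ↔ ∃ r ∈ Set.Ioo (0 : ℝ) 1, ∃ y, (∃ x ∈ s, (x : E) = y) ∧ r • y = A z
  constructor
  · rintro ⟨r, hr, _, ⟨x, hx, rfl⟩, rfl⟩
    exact ⟨r, hr, _, ⟨sphereMap A x, hx, rfl⟩, by simp [sphereMap]⟩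
  · rintro ⟨r, hr, _, ⟨x, hx, rfl⟩, h⟩
    refine ⟨r, hr, _, ⟨sphereMap A.symm x, ?_, rfl⟩, ?_⟩
    · have : sphereMap A (sphereMap A.symm x) = x := by
        ext; simp [sphereMap]
      rwa [this]
    · apply A.injective
      simpa [sphereMap] using h

theorem integral_sphereMap (A : E ≃ₗᵢ[ℝ] E) {f : Metric.sphere (0 : E) 1 → ℝ}
    (hf : Continuous f) :
    ∫ x, f (sphereMap A x) ∂uniformSphere E = ∫ x, f x ∂uniformSphere E := by
  conv_rhs => rw [← (measurePreserving_sphereMap A).map_eq]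
  rw [integral_map (continuous_sphereMap A).aemeasurable
    hf.stronglyMeasurable.aestronglyMeasurable]

end Sphere

/-! ### Polynomials on the Euclidean space -/

/-- The value of a polynomial at a point of the Euclidean space. -/
def polyEval (p : MvPolynomial (Fin 3) ℝ) (x : Space) : ℝ := MvPolynomial.eval (fun i => x i) p

section Polynomial

open MvPolynomial

theorem polyEval_add (p q : MvPolynomial (Fin 3) ℝ) (x : Space) :
    polyEval (p + q) x = polyEval p x + polyEval q x := map_add _ _ _

theorem polyEval_mul (p q : MvPolynomial (Fin 3) ℝ) (x : Space) :
    polyEval (p * q) x = polyEval p x * polyEval q x := map_mul _ _ _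

theorem polyEval_C (c : ℝ) (x : Space) : polyEval (C c) x = c := eval_C _

theorem polyEval_X (i : Fin 3) (x : Space) : polyEval (X i) x = x i := eval_X _

theorem polyEval_sum {ι : Type*} (s : Finset ι) (p : ι → MvPolynomial (Fin 3) ℝ) (x : Space) :
    polyEval (∑ i ∈ s, p i) x = ∑ i ∈ s, polyEval (p i) x := map_sum _ _ _

theorem polyEval_natCast_mul (n : ℕ) (p : MvPolynomial (Fin 3) ℝ) (x : Space) :
    polyEval (n • p) x = n * polyEval p x := by
  rw [polyEval, map_nsmul, nsmul_eq_mul]; rfl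

theorem continuous_polyEval (p : MvPolynomial (Fin 3) ℝ) : Continuous (polyEval p) :=
  (continuous_eval p).comp (by fun_prop : Continuous fun x : Space => fun i => x i)

theorem polyEval_smul {p : MvPolynomial (Fin 3) ℝ} {n : ℕ} (hp : p.IsHomogeneous n) (c : ℝ)
    (x : Space) : polyEval p (c • x) = c ^ n * polyEval p x := by
  simp only [polyEval, eval_eq', PiLp.smul_apply, smul_eq_mul, Finset.mul_sum]
  refine Finset.sum_congr rfl fun d hd => ?_
  have h := hp (mem_support_iff.1 hd)
  rw [Finsupp.weight_apply, Finsupp.sum_fintype _ _ (fun i => by simp)] at h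
  simp only [Pi.one_apply, smul_eq_mul, mul_one] at h
  simp_rw [mul_pow]
  rw [Finset.prod_mul_distrib, Finset.prod_pow_eq_pow_sum, h]
  ring

/-- The chain rule for a polynomial along a curve. -/
theorem hasDerivAt_polyEval (p : MvPolynomial (Fin 3) ℝ) {γ : ℝ → Space} {γ' : Space} {t : ℝ}
    (hγ : ∀ i, HasDerivAt (fun s => γ s i) (γ' i) t) :
    HasDerivAt (fun s => polyEval p (γ s)) (∑ i, γ' i * polyEval (pderiv i p) (γ t)) t := by
  induction p using MvPolynomial.induction_on with
  | C c => simpa [polyEval] using hasDerivAt_const t c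
  | add p q hp hq =>
    simp only [map_add, polyEval_add, mul_add, Finset.sum_add_distrib]
    exact hp.add hq
  | mul_X p i hp =>
    have := hp.mul (hγ i)
    simp only [polyEval_mul, polyEval_X, pderiv_mul, polyEval_add, pderiv_X]
    refine this.congr_deriv ?_
    symm
    simp only [mul_add, Finset.sum_add_distrib, Finset.sum_mul, mul_assoc]
    congr 1
    rw [Finset.sum_eq_single i]
    · simp [polyEval]; ring
    · intro j _ hj
      simp [polyEval, hj.symm]
    · simp

/-- The composition of a polynomial with a linear isometry. -/
def polyComp (A : Space ≃ₗᵢ[ℝ] Space) (p : MvPolynomial (Fin 3) ℝ) : MvPolynomial (Fin 3) ℝ :=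
  bind₁ (fun j => ∑ i, C (A (EuclideanSpace.single i 1) j) * X i) p

theorem polyEval_polyComp (A : Space ≃ₗᵢ[ℝ] Space) (p : MvPolynomial (Fin 3) ℝ) (x : Space) :
    polyEval (polyComp A p) x = polyEval p (A x) := by
  rw [polyEval, polyComp, eval, eval₂Hom_bind₁, polyEval, eval]
  congr 2
  ext j
  have hx : x = ∑ i, x i • EuclideanSpace.single i (1 : ℝ) := by
    ext k
    simp [Finset.sum_apply, Pi.single_apply]
  conv_rhs => rw [hx, map_sum]
  simp [Finset.sum_apply, mul_comm]

theorem pderiv_polyComp (A : Space ≃ₗᵢ[ℝ] Space) (i : Fin 3) (p : MvPolynomial (Fin 3) ℝ) :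
    pderiv i (polyComp A p) =
      ∑ j, C (A (EuclideanSpace.single i 1) j) * polyComp A (pderiv j p) := by
  induction p using MvPolynomial.induction_on with
  | C c => simp [polyComp]
  | add p q hp hq => 
    simp only [polyComp, map_add] at hp hq ⊢
    rw [hp, hq, ← Finset.sum_add_distrib]
    exact Finset.sum_congr rfl fun j _ => by ring
  | mul_X p k hp =>
    simp only [polyComp] at hp
    simp only [polyComp, map_mul, bind₁_X_right, pderiv_mul, map_add, hp, pderiv_X, map_sum,
      pderiv_C, zero_mul, zero_add, mul_add, Finset.sum_add_distrib, Finset.sum_mul, mul_assoc]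
    congr 1
    rw [Finset.sum_eq_single i, Finset.sum_eq_single k]
    · simp; ring
    · intro j _ hj; simp [hj.symm]
    · simp
    · intro j _ hj; simp [hj]
    · simp

theorem sum_isometry_coord (A : Space ≃ₗᵢ[ℝ] Space) (j k : Fin 3) :
    ∑ i, A (EuclideanSpace.single i 1) j * A (EuclideanSpace.single i 1) k =
      if j = k then 1 else 0 := by
  have h := ((EuclideanSpace.basisFun (Fin 3) ℝ).map A).sum_inner_mul_inner
    (EuclideanSpace.single j (1 : ℝ)) (EuclideanSpace.single k (1 : ℝ))
  simp only [OrthonormalBasis.map_apply, EuclideanSpace.basisFun_apply,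
    EuclideanSpace.inner_single_left, EuclideanSpace.inner_single_right, map_one, one_mul,
    conj_trivial] at h
  rw [h]
  simp [eq_comm]

theorem polyLaplacian_polyComp (A : Space ≃ₗᵢ[ℝ] Space) (p : MvPolynomial (Fin 3) ℝ) :
    polyLaplacian (polyComp A p) = polyComp A (polyLaplacian p) := by
  have h1 : polyLaplacian (polyComp A p) = ∑ i, ∑ j, ∑ k,
      C (A (EuclideanSpace.single i 1) j * A (EuclideanSpace.single i 1) k) *
        polyComp A (pderiv k (pderiv j p)) := by
    refine Finset.sum_congr rfl fun i _ => ?_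
    rw [pderiv_polyComp, map_sum]
    refine Finset.sum_congr rfl fun j _ => ?_
    rw [pderiv_C_mul, pderiv_polyComp, Finset.mul_sum]
    refine Finset.sum_congr rfl fun k _ => ?_
    rw [C_mul, mul_assoc]
  rw [h1, Finset.sum_comm]
  simp_rw [Finset.sum_comm (s := Finset.univ (α := Fin 3)) (t := Finset.univ (α := Fin 3))
    (f := fun i k => C (A (EuclideanSpace.single i 1) _ * A (EuclideanSpace.single i 1) k) *
        polyComp A (pderiv k (pderiv _ p))), ← Finset.sum_mul, ← map_sum, sum_isometry_coord]
  simp [polyLaplacian, polyComp]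

theorem isHomogeneous_polyComp (A : Space ≃ₗᵢ[ℝ] Space) {p : MvPolynomial (Fin 3) ℝ} {n : ℕ}
    (hp : p.IsHomogeneous n) : (polyComp A p).IsHomogeneous n := by
  have := hp.aeval (fun j => ∑ i, C (A (EuclideanSpace.single i 1) j) * X i) (n := 1)
    (fun j => IsHomogeneous.sum _ _ _ fun i _ => isHomogeneous_C_mul_X _ _)
  rwa [one_mul] at this

end Polynomial

/-! ### The reproducing kernel of the spherical harmonics -/

theorem comp_sphereMap_mem {n : ℕ} {f : S2 → ℝ} (hf : f ∈ sphericalHarmonics n)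
    (A : Space ≃ₗᵢ[ℝ] Space) : (fun x => f (sphereMap A x)) ∈ sphericalHarmonics n := by
  obtain ⟨p, hp, hl, he⟩ := hf
  refine ⟨polyComp A p, isHomogeneous_polyComp A hp, ?_, fun x => ?_⟩
  · rw [polyLaplacian_polyComp, hl]; simp [polyComp]
  · exact (he _).trans (polyEval_polyComp A p x).symm

theorem continuous_of_mem_sphericalHarmonics {n : ℕ} {f : S2 → ℝ}
    (hf : f ∈ sphericalHarmonics n) : Continuous f := by
  obtain ⟨p, hp, hl, he⟩ := hf
  have : f = fun x : S2 => polyEval p x := funext he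
  rw [this]
  exact (continuous_polyEval p).comp continuous_subtype_val

theorem neg_of_mem_sphericalHarmonics {n : ℕ} {f : S2 → ℝ}
    (hf : f ∈ sphericalHarmonics n) (x : S2) : f (-x) = (-1) ^ n * f x := by
  obtain ⟨p, hp, hl, he⟩ := hf
  rw [he, he]
  have := polyEval_smul hp (-1) x
  rw [neg_one_smul] at this
  exact this

theorem integrable_of_continuous {f : S2 → ℝ} (hf : Continuous f) : Integrable f rho :=
  hf.integrable_of_hasCompactSupport (HasCompactSupport.of_compactSpace f)

section Kernel

variable {n : ℕ} {Y : Idx n → S2 → ℝ}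

/-- The reproducing kernel `∑_k Y_k(x) Y_k(y)`. -/
def harmonicKernel (Y : Idx n → S2 → ℝ) (x y : S2) : ℝ := ∑ k, Y k x * Y k y

theorem IsHarmonicONB.mem (hY : IsHarmonicONB n Y) (k : Idx n) : Y k ∈ sphericalHarmonics n := by
  rw [← hY.span_eq]
  exact Submodule.subset_span ⟨k, rfl⟩

theorem IsHarmonicONB.continuous (hY : IsHarmonicONB n Y) (k : Idx n) : Continuous (Y k) :=
  continuous_of_mem_sphericalHarmonics (hY.mem k)

theorem IsHarmonicONB.expand (hY : IsHarmonicONB n Y) {f : S2 → ℝ}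
    (hf : f ∈ sphericalHarmonics n) (x : S2) :
    f x = ∑ k, (∫ y, f y * Y k y ∂rho) * Y k x := by
  rw [← hY.span_eq, SetLike.mem_coe, Submodule.mem_span_range_iff_exists_fun] at hf
  obtain ⟨c, rfl⟩ := hf
  have h : ∀ k, ∫ y, (∑ l, c l • Y l) y * Y k y ∂rho = c k := by
    intro k
    simp only [Finset.sum_apply, Pi.smul_apply, smul_eq_mul, Finset.sum_mul, mul_assoc]
    have hi : ∀ l ∈ Finset.univ, Integrable (fun y => c l * (Y l y * Y k y)) rho := fun l _ =>
      integrable_of_continuous (continuous_const.mul ((hY.continuous l).mul (hY.continuous k)))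
    rw [integral_finsetSum _ hi]
    simp_rw [integral_const_mul, hY.orthonormal]
    simp
  simp_rw [h]
  simp

theorem harmonicKernel_mem (hY : IsHarmonicONB n Y) (x : S2) :
    harmonicKernel Y x ∈ sphericalHarmonics n := by
  rw [← hY.span_eq]
  have : harmonicKernel Y x = ∑ k, Y k x • Y k := by
    ext y
    simp [harmonicKernel]
  rw [this]
  exact Submodule.sum_mem _ fun k _ => Submodule.smul_mem _ _ (Submodule.subset_span ⟨k, rfl⟩)

/-- The kernel does not depend on the orthonormal basis, hence it is invariant. -/
theorem harmonicKernel_sphereMap (hY : IsHarmonicONB n Y) (A : Space ≃ₗᵢ[ℝ] Space) (x y : S2) :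
    harmonicKernel Y (sphereMap A x) (sphereMap A y) = harmonicKernel Y x y := by
  have hsymm : ∀ z, sphereMap A (sphereMap A.symm z) = z := fun z => by ext; simp [sphereMap]
  have hsymm' : ∀ z, sphereMap A.symm (sphereMap A z) = z := fun z => by ext; simp [sphereMap]
  have hZ := comp_sphereMap_mem (harmonicKernel_mem hY (sphereMap A x)) A
  rw [hY.expand hZ y, harmonicKernel]
  refine Finset.sum_congr rfl fun k _ => ?_
  congr 1
  have hc := hY.continuous
  have hkc := continuous_of_mem_sphericalHarmonics (harmonicKernel_mem hY (sphereMap A x))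
  have hm := comp_sphereMap_mem (hY.mem k) A.symm
  have h1 := hY.expand hm (sphereMap A x)
  simp only [hsymm'] at h1
  rw [h1]
  have h2 := integral_sphereMap A (f := fun y => harmonicKernel Y (sphereMap A x) y *
    Y k (sphereMap A.symm y)) (hkc.mul (continuous_of_mem_sphericalHarmonics hm))
  simp only [hsymm'] at h2
  rw [h2]
  simp only [harmonicKernel, Finset.sum_mul]
  have hi : ∀ l ∈ Finset.univ, Integrable (fun y => Y l (sphereMap A x) * Y l y *
      Y k (sphereMap A.symm y)) rho := fun l _ => integrable_of_continuous
    ((continuous_const.mul (hc l)).mul (continuous_of_mem_sphericalHarmonics hm))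
  rw [integral_finsetSum _ hi]
  refine Finset.sum_congr rfl fun l _ => ?_
  rw [← integral_mul_const]
  exact integral_congr_ae (Eventually.of_forall fun y => by ring)

theorem card_Idx (n : ℕ) : Fintype.card (Idx n) = 2 * n + 1 := by
  rw [← Set.toFinset_card, Set.toFinset_Icc, Int.card_Icc]
  omega

end Kernel

/-! ### Zonal harmonics and the Legendre equation -/

/-- Two pairs of points of the sphere with the same inner product are related by an isometry, a
composition of two reflections. -/
theorem exists_isometry_of_inner_eq {p q p' q' : S2}
    (h : inner ℝ (p : Space) (q : Space) = inner ℝ (p' : Space) (q' : Space)) :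
    ∃ A : Space ≃ₗᵢ[ℝ] Space, sphereMap A p = p' ∧ sphereMap A q = q' := by
  have hn : ∀ z : S2, ‖(z : Space)‖ = 1 := fun z => norm_eq_of_mem_sphere z
  set A₁ : Space ≃ₗᵢ[ℝ] Space := (ℝ ∙ ((p : Space) - p'))ᗮ.reflection with hA₁
  have h1 : A₁ p = p' := Submodule.reflection_sub (by rw [hn, hn])
  set A₂ : Space ≃ₗᵢ[ℝ] Space := (ℝ ∙ (A₁ (q : Space) - q'))ᗮ.reflection with hA₂
  have h2 : A₂ (A₁ q) = q' := Submodule.reflection_sub (by rw [A₁.norm_map, hn, hn])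
  have h3 : A₂ p' = p' := by
    refine Submodule.reflection_mem_subspace_eq_self ?_
    rw [Submodule.mem_orthogonal_singleton_iff_inner_left, inner_sub_right, ← h, ← h1,
      A₁.inner_map_map, sub_self]
  refine ⟨A₁.trans A₂, Subtype.ext ?_, Subtype.ext ?_⟩
  · change A₂ (A₁ p) = p'
    rw [h1, h3]
  · exact h2

/-- The point of the sphere with colatitude `θ` and longitude `φ`. -/
def sphericalPoint (θ φ : ℝ) : S2 :=
  ⟨!₂[Real.sin θ * Real.cos φ, Real.sin θ * Real.sin φ, Real.cos θ], by
    rw [mem_sphere_zero_iff_norm, EuclideanSpace.norm_eq, Real.sqrt_eq_one]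
    simp only [Fin.sum_univ_three, Real.norm_eq_abs, sq_abs, Matrix.cons_val_zero,
      Matrix.cons_val_one, Matrix.cons_val]
    linear_combination Real.sin θ ^ 2 * Real.sin_sq_add_cos_sq φ + Real.sin_sq_add_cos_sq θ⟩

theorem sphericalPoint_apply_zero (θ φ : ℝ) :
    (sphericalPoint θ φ : Space) 0 = Real.sin θ * Real.cos φ := rfl

theorem sphericalPoint_apply_one (θ φ : ℝ) :
    (sphericalPoint θ φ : Space) 1 = Real.sin θ * Real.sin φ := rfl

theorem sphericalPoint_apply_two (θ φ : ℝ) :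
    (sphericalPoint θ φ : Space) 2 = Real.cos θ := rfl

theorem inner_sphericalPoint (θ φ : ℝ) :
    inner ℝ (sphericalPoint 0 0 : Space) (sphericalPoint θ φ : Space) = Real.cos θ := by
  simp [PiLp.inner_apply, Fin.sum_univ_three, sphericalPoint_apply_zero, sphericalPoint_apply_one,
    sphericalPoint_apply_two]

/-- `u` is the solution of the Legendre equation of degree `n` in the colatitude which is regular
and equal to `1` at the pole; `u'` is its derivative. -/
structure IsLegendre (n : ℕ) (u u' : ℝ → ℝ) : Prop where
  hasDerivAt : ∀ θ, HasDerivAt u (u' θ) θ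
  ode : ∀ θ, Real.sin θ ≠ 0 → HasDerivAt u'
    (-(Real.cos θ / Real.sin θ * u' θ) - n * (n + 1) * u θ) θ
  continuous : Continuous u'
  apply_zero : u 0 = 1
  deriv_zero : u' 0 = 0

theorem euler_polyEval {p : MvPolynomial (Fin 3) ℝ} {n : ℕ} (hp : p.IsHomogeneous n) (x : Space) :
    ∑ i, x i * polyEval (MvPolynomial.pderiv i p) x = n * polyEval p x := by
  have h := congrArg (fun q => polyEval q x) hp.sum_X_mul_pderiv
  simpa only [polyEval_sum, polyEval_mul, polyEval_X, polyEval_natCast_mul] using h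

/-- A zonal harmonic solves the Legendre equation in the colatitude. -/
theorem exists_isLegendre_of_zonal {p : MvPolynomial (Fin 3) ℝ} {n : ℕ} (hn : 1 ≤ n)
    (hp : p.IsHomogeneous n) (hl : polyLaplacian p = 0)
    (hz : ∀ θ φ, polyEval p (sphericalPoint θ φ) = polyEval p (sphericalPoint θ 0))
    (h1 : polyEval p (sphericalPoint 0 0) = 1) :
    ∃ u', IsLegendre n (fun θ => polyEval p (sphericalPoint θ 0)) u' := by
  have hγ : ∀ θ : ℝ, ∀ i, HasDerivAt (fun s => (sphericalPoint s 0 : Space) i)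
      ((!₂[Real.cos θ, 0, -Real.sin θ] : Space) i) θ := by
    intro θ i
    fin_cases i
    · simpa [sphericalPoint] using Real.hasDerivAt_sin θ
    · simpa [sphericalPoint] using hasDerivAt_const θ (0 : ℝ)
    · simpa [sphericalPoint] using Real.hasDerivAt_cos θ
  have hδ : ∀ θ φ : ℝ, ∀ i, HasDerivAt (fun s => (sphericalPoint θ s : Space) i)
      ((!₂[-(Real.sin θ * Real.sin φ), Real.sin θ * Real.cos φ, 0] : Space) i) φ := by
    intro θ φ i
    fin_cases i
    · simpa [sphericalPoint] using (Real.hasDerivAt_cos φ).const_mul (Real.sin θ)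
    · simpa [sphericalPoint] using (Real.hasDerivAt_sin φ).const_mul (Real.sin θ)
    · simpa [sphericalPoint] using hasDerivAt_const φ (Real.cos θ)
  set D : Fin 3 → MvPolynomial (Fin 3) ℝ := fun i => MvPolynomial.pderiv i p with hD
  set D2 : Fin 3 → Fin 3 → MvPolynomial (Fin 3) ℝ := fun i j => MvPolynomial.pderiv i (D j)
    with hD2
  have hu : ∀ (q : MvPolynomial (Fin 3) ℝ) (θ : ℝ),
      HasDerivAt (fun θ => polyEval q (sphericalPoint θ 0))
      (Real.cos θ * polyEval (MvPolynomial.pderiv 0 q) (sphericalPoint θ 0) -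
        Real.sin θ * polyEval (MvPolynomial.pderiv 2 q) (sphericalPoint θ 0)) θ := by
    intro q θ
    refine (hasDerivAt_polyEval q (hγ θ)).congr_deriv ?_
    simp [Fin.sum_univ_three]
    ring
  have hv : ∀ (q : MvPolynomial (Fin 3) ℝ) (θ φ : ℝ),
      HasDerivAt (fun φ => polyEval q (sphericalPoint θ φ))
      (-(Real.sin θ * Real.sin φ) * polyEval (MvPolynomial.pderiv 0 q) (sphericalPoint θ φ) +
        Real.sin θ * Real.cos φ * polyEval (MvPolynomial.pderiv 1 q) (sphericalPoint θ φ)) φ := by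
    intro q θ φ
    refine (hasDerivAt_polyEval q (hδ θ φ)).congr_deriv ?_
    simp [Fin.sum_univ_three]
  -- the first derivative in the longitude vanishes identically
  have hφ : ∀ θ φ, -(Real.sin θ * Real.sin φ) * polyEval (D 0) (sphericalPoint θ φ) +
        Real.sin θ * Real.cos φ * polyEval (D 1) (sphericalPoint θ φ) = 0 := by
    intro θ φ
    refine (hv p θ φ).unique ?_
    rw [show (fun φ => polyEval p (sphericalPoint θ φ)) =
      fun _ => polyEval p (sphericalPoint θ 0) from funext (hz θ)]
    exact hasDerivAt_const _ _
  -- hence so does the second one, which expresses `∂₁∂₁p` through `∂₀p`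
  have hzz : ∀ θ, Real.sin θ ≠ 0 → Real.sin θ * polyEval (D2 1 1) (sphericalPoint θ 0) =
      polyEval (D 0) (sphericalPoint θ 0) := by
    intro θ hθ
    have e1 := ((((Real.hasDerivAt_sin 0).const_mul (Real.sin θ)).neg).mul (hv (D 0) θ 0)).add
      (((Real.hasDerivAt_cos 0).const_mul (Real.sin θ)).mul (hv (D 1) θ 0))
    have e2 := e1.unique (f₁' := 0) (by
      refine (hasDerivAt_const (0 : ℝ) (0 : ℝ)).congr_of_eventuallyEq
        (Eventually.of_forall fun φ => ?_)
      exact hφ θ φ)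
    simp only [Pi.neg_apply, Real.sin_zero, Real.cos_zero, mul_one, mul_zero, neg_zero, zero_mul, add_zero,
      zero_add] at e2
    have e3 : Real.sin θ * (Real.sin θ * polyEval (D2 1 1) (sphericalPoint θ 0) -
      polyEval (D 0) (sphericalPoint θ 0)) = 0 := by linear_combination e2
    rcases mul_eq_zero.1 e3 with h | h
    · exact absurd h hθ
    · linarith
  refine ⟨fun θ => Real.cos θ * polyEval (D 0) (sphericalPoint θ 0) -
        Real.sin θ * polyEval (D 2) (sphericalPoint θ 0), hu p, fun θ hθ => ?_, ?_, h1, ?_⟩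
  · refine (((Real.hasDerivAt_cos θ).mul (hu (D 0) θ)).sub
      ((Real.hasDerivAt_sin θ).mul (hu (D 2) θ))).congr_deriv ?_
    have E0 := euler_polyEval hp (sphericalPoint θ 0)
    have E1 := euler_polyEval (hp.pderiv (i := 0)) (sphericalPoint θ 0)
    have E2 := euler_polyEval (hp.pderiv (i := 2)) (sphericalPoint θ 0)
    have L : ∑ i, polyEval (D2 i i) (sphericalPoint θ 0) = 0 := by
      have := congrArg (fun q => polyEval q (sphericalPoint θ 0)) hl
      simp only [polyLaplacian, polyEval_sum] at this
      exact this.trans (map_zero _)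
    simp only [Fin.sum_univ_three, sphericalPoint_apply_zero, sphericalPoint_apply_one,
      sphericalPoint_apply_two, Real.cos_zero, Real.sin_zero, mul_one, mul_zero, zero_mul,
      add_zero, Nat.cast_sub hn, Nat.cast_one] at E0 E1 E2 L
    have Z := hzz θ hθ
    have T := Real.sin_sq_add_cos_sq θ
    change Real.sin θ * polyEval (D 0) (sphericalPoint θ 0) +
      Real.cos θ * polyEval (D 2) (sphericalPoint θ 0) = _ at E0
    change Real.sin θ * polyEval (D2 0 0) (sphericalPoint θ 0) +
      Real.cos θ * polyEval (D2 2 0) (sphericalPoint θ 0) =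
      (n - 1) * polyEval (D 0) (sphericalPoint θ 0) at E1
    change Real.sin θ * polyEval (D2 0 2) (sphericalPoint θ 0) +
      Real.cos θ * polyEval (D2 2 2) (sphericalPoint θ 0) =
      (n - 1) * polyEval (D 2) (sphericalPoint θ 0) at E2
    change -Real.sin θ * polyEval (D 0) (sphericalPoint θ 0) + Real.cos θ *
      (Real.cos θ * polyEval (D2 0 0) (sphericalPoint θ 0) -
        Real.sin θ * polyEval (D2 2 0) (sphericalPoint θ 0)) -
      (Real.cos θ * polyEval (D 2) (sphericalPoint θ 0) + Real.sin θ *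
        (Real.cos θ * polyEval (D2 0 2) (sphericalPoint θ 0) -
        Real.sin θ * polyEval (D2 2 2) (sphericalPoint θ 0))) = _
    generalize polyEval (D 0) (sphericalPoint θ 0) = P0 at *
    generalize polyEval (D 2) (sphericalPoint θ 0) = P2 at *
    generalize polyEval (D2 0 0) (sphericalPoint θ 0) = P00 at *
    generalize polyEval (D2 1 1) (sphericalPoint θ 0) = P11 at *
    generalize polyEval (D2 2 2) (sphericalPoint θ 0) = P22 at *
    generalize polyEval (D2 2 0) (sphericalPoint θ 0) = P20 at *
    generalize polyEval (D2 0 2) (sphericalPoint θ 0) = P02 at *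
    generalize polyEval p (sphericalPoint θ 0) = U at *
    generalize Real.sin θ = s at *
    generalize Real.cos θ = c at *
    rw [← Z] at E0 E1 ⊢
    have Q : c / s * (c * (s * P11) - s * P2) = c * (c * P11 - P2) := by field_simp
    rw [Q]
    linear_combination (P00 + P22) * T - s * E1 - c * E2 - (n - 1) * E0 + L - 2 * E0 + P11 * T
  · have hc : Continuous fun θ => (sphericalPoint θ 0 : Space) := by
      refine (PiLp.continuous_toLp 2 _).comp (continuous_pi fun i => ?_)
      exact continuous_iff_continuousAt.2 fun θ => (hγ θ i).continuousAt
    exact (Real.continuous_cos.mul ((continuous_polyEval _).comp hc)).sub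
      (Real.continuous_sin.mul ((continuous_polyEval _).comp hc))
  · have h0 := hu p 0
    have heven : ∀ θ, polyEval p (sphericalPoint (-θ) 0) = polyEval p (sphericalPoint θ 0) := by
      intro θ
      rw [← hz θ Real.pi]
      congr 1
      ext i
      fin_cases i <;> simp [sphericalPoint]
    have h2 := HasDerivAt.scomp (h := Neg.neg) (0 : ℝ) (by rwa [neg_zero]) (hasDerivAt_neg (0 : ℝ))
    rw [show (fun θ => polyEval p (sphericalPoint θ 0)) ∘ Neg.neg =
      fun θ => polyEval p (sphericalPoint θ 0) from funext heven] at h2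
    have := h0.unique h2
    simp only [Real.sin_zero, Real.cos_zero, smul_eq_mul] at this ⊢
    simp only [hD]
    linarith

/-- The kernel of degree `n` is `2n+1` times a Legendre function of the angle. -/
theorem exists_isLegendre_harmonicKernel {n : ℕ} (hn : 1 ≤ n) {Y : Idx n → S2 → ℝ}
    (hY : IsHarmonicONB n Y) : ∃ u u', IsLegendre n u u' ∧
      (∀ θ, u (-θ) = u θ) ∧
      ∀ (x y : S2) (θ : ℝ), inner ℝ (x : Space) (y : Space) = Real.cos θ →
        harmonicKernel Y x y = (2 * n + 1) * u θ := by
  have hN : (0 : ℝ) < 2 * n + 1 := by positivity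
  have hinv : ∀ {x y x' y' : S2}, inner ℝ (x : Space) (y : Space) = inner ℝ (x' : Space) (y' : Space) →
      harmonicKernel Y x y = harmonicKernel Y x' y' := by
    intro x y x' y' h
    obtain ⟨A, rfl, rfl⟩ := exists_isometry_of_inner_eq h
    exact (harmonicKernel_sphereMap hY A x y).symm
  have hdiag : harmonicKernel Y (sphericalPoint 0 0) (sphericalPoint 0 0) = 2 * n + 1 := by
    have h1 : ∀ x, harmonicKernel Y (sphericalPoint 0 0) (sphericalPoint 0 0) =
        harmonicKernel Y x x := fun x => hinv (by
          rw [real_inner_self_eq_norm_sq, real_inner_self_eq_norm_sq, norm_eq_of_mem_sphere,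
            norm_eq_of_mem_sphere])
    have h2 : ∫ x, harmonicKernel Y x x ∂rho = 2 * n + 1 := by
      simp only [harmonicKernel]
      have hi : ∀ k ∈ Finset.univ, Integrable (fun x => Y k x * Y k x) rho := fun k _ =>
        integrable_of_continuous ((hY.continuous k).mul (hY.continuous k))
      rw [integral_finsetSum _ hi]
      simp only [hY.orthonormal, if_true, Finset.sum_const, Finset.card_univ, card_Idx]
      simp
    rw [← h2, ← integral_congr_ae (Eventually.of_forall h1)]
    simp
  obtain ⟨p, hp, hl, he⟩ := harmonicKernel_mem hY (sphericalPoint 0 0)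
  set q : MvPolynomial (Fin 3) ℝ := MvPolynomial.C (2 * n + 1 : ℝ)⁻¹ * p with hq
  have hqe : ∀ x : S2, polyEval q x =
      (2 * n + 1 : ℝ)⁻¹ * harmonicKernel Y (sphericalPoint 0 0) x := by
    intro x
    rw [hq, polyEval_mul, polyEval_C, he]
    rfl
  obtain ⟨u', hu'⟩ := exists_isLegendre_of_zonal (p := q) hn (hp.C_mul _) (by
      simp only [polyLaplacian, hq, MvPolynomial.pderiv_C_mul, ← Finset.mul_sum] at hl ⊢
      rw [hl, mul_zero])
    (fun θ φ => by
      rw [hqe, hqe, hinv]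
      rw [inner_sphericalPoint, inner_sphericalPoint])
    (by rw [hqe, hdiag, inv_mul_cancel₀ hN.ne'])
  refine ⟨_, u', hu', fun θ => ?_, fun x y θ h => ?_⟩
  · simp only [hqe]
    congr 1
    apply hinv
    rw [inner_sphericalPoint, inner_sphericalPoint, Real.cos_neg]
  · simp only [hqe]
    rw [mul_inv_cancel_left₀ hN.ne']
    apply hinv
    rw [inner_sphericalPoint, h]

/-! ### Estimates for the Legendre equation -/

/-- `J` is the Bessel function `J₀` as a solution of its differential equation; `J'` is its
derivative. -/
structure IsBessel (J J' : ℝ → ℝ) : Prop where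
  hasDerivAt : ∀ r, HasDerivAt J (J' r) r
  ode : ∀ r, r ≠ 0 → HasDerivAt J' (-(J' r / r) - J r) r
  continuous : Continuous J'
  apply_zero : J 0 = 1
  deriv_zero : J' 0 = 0
  abs_deriv_le : ∀ r, |J' r| ≤ 1

section Legendre

variable {n : ℕ} {u u' : ℝ → ℝ}

theorem sin_ne_zero_of_mem {θ : ℝ} (h : θ ∈ Set.Ioo 0 (Real.pi / 2)) : Real.sin θ ≠ 0 :=
  (Real.sin_pos_of_pos_of_lt_pi h.1 (by linarith [h.2, Real.pi_pos])).ne'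

theorem cos_nonneg_of_mem {θ : ℝ} (h : θ ∈ Set.Ioo 0 (Real.pi / 2)) : 0 ≤ Real.cos θ :=
  Real.cos_nonneg_of_mem_Icc ⟨by linarith [h.1, Real.pi_pos], h.2.le⟩

/-- The energy `u² + u'² / (n (n + 1))` decreases away from the pole. -/
theorem IsLegendre.energy_le (hu : IsLegendre n u u') (hn : 1 ≤ n) {θ : ℝ}
    (hθ : θ ∈ Set.Icc 0 (Real.pi / 2)) : u θ ^ 2 + u' θ ^ 2 / (n * (n + 1)) ≤ 1 := by
  have hn' : (0 : ℝ) < n := by exact_mod_cast hn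
  have hd : ∀ x ∈ Set.Ioo 0 (Real.pi / 2),
      HasDerivAt (fun x => u x ^ 2 + u' x ^ 2 / (n * (n + 1)))
        (-(2 * (Real.cos x / Real.sin x) * u' x ^ 2 / (n * (n + 1)))) x := by
    intro x hx
    have hs := sin_ne_zero_of_mem hx
    refine (((hu.hasDerivAt x).pow 2).add (((hu.ode x hs).pow 2).div_const _)).congr_deriv ?_
    field_simp
    ring
  have hanti : AntitoneOn (fun x => u x ^ 2 + u' x ^ 2 / (n * (n + 1)))
      (Set.Icc 0 (Real.pi / 2)) := by
    refine antitoneOn_of_deriv_nonpos (convex_Icc _ _) ?_ ?_ ?_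
    · have h1 : Continuous u := continuous_iff_continuousAt.2 fun x => (hu.hasDerivAt x).continuousAt
      have h2 := hu.continuous
      fun_prop
    · rw [interior_Icc]
      exact fun x hx => (hd x hx).differentiableAt.differentiableWithinAt
    · rw [interior_Icc]
      intro x hx
      rw [(hd x hx).deriv, neg_nonpos]
      have hs := Real.sin_pos_of_pos_of_lt_pi hx.1 (by linarith [hx.2, Real.pi_pos])
      have hc := cos_nonneg_of_mem hx
      positivity
  have := hanti (Set.left_mem_Icc.2 (by positivity)) hθ hθ.1
  simpa [hu.apply_zero, hu.deriv_zero] using this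

theorem IsLegendre.abs_le_one (hu : IsLegendre n u u') (hn : 1 ≤ n) {θ : ℝ}
    (hθ : θ ∈ Set.Icc 0 (Real.pi / 2)) : |u θ| ≤ 1 := by
  have h := hu.energy_le hn hθ
  have h2 : 0 ≤ u' θ ^ 2 / (n * (n + 1)) := by positivity
  rw [← sq_le_one_iff_abs_le_one]
  linarith

theorem IsLegendre.abs_deriv_le (hu : IsLegendre n u u') (hn : 1 ≤ n) {θ : ℝ}
    (hθ : θ ∈ Set.Icc 0 (Real.pi / 2)) : |u' θ| ≤ 2 * n := by
  have hn' : (1 : ℝ) ≤ n := by exact_mod_cast hn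
  have h := hu.energy_le hn hθ
  have h2 : u' θ ^ 2 / (n * (n + 1)) ≤ 1 := by nlinarith [sq_nonneg (u θ)]
  rw [div_le_one (by positivity)] at h2
  exact abs_le_of_sq_le_sq (by nlinarith) (by positivity)

theorem abs_inv_sub_cot_le {θ : ℝ} (h0 : 0 < θ) (h1 : θ ≤ 1) :
    |1 / θ - Real.cos θ / Real.sin θ| ≤ θ := by
  have e1 := Real.sin_gt_sub_cube h0
  have e2 := Real.sin_lt h0
  have e3 := Real.one_sub_sq_div_two_le_cos (x := θ)
  have e4 := Real.cos_le_one θ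
  have hcub : θ ^ 3 ≤ θ := pow_le_of_le_one h0.le h1 three_ne_zero
  have hs : 3 / 4 * θ ≤ Real.sin θ := by linarith
  have hs0 : 0 < Real.sin θ := by linarith
  have h3 : θ ^ 3 * (3 / 4) ≤ θ ^ 2 * Real.sin θ := by
    calc θ ^ 3 * (3 / 4) = θ ^ 2 * (3 / 4 * θ) := by ring
      _ ≤ _ := by gcongr
  have h4 : θ * Real.cos θ ≤ θ := by nlinarith
  have h5 : θ - θ ^ 3 / 2 ≤ θ * Real.cos θ := by nlinarith
  have h6 : 0 ≤ θ ^ 3 := by positivity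
  rw [div_sub_div _ _ h0.ne' hs0.ne', one_mul, abs_div, abs_of_pos (mul_pos h0 hs0),
    div_le_iff₀ (mul_pos h0 hs0), abs_le]
  constructor <;> nlinarith

/-- Near the pole the Legendre function is a rescaled Bessel function: the energy of the difference
of the two solutions grows at most at a constant rate. -/
theorem IsLegendre.sq_sub_bessel_le (hu : IsLegendre n u u') (hn : 1 ≤ n) {J J' : ℝ → ℝ}
    (hJ : IsBessel J J') {θ : ℝ} (h0 : 0 ≤ θ) (h1 : θ ≤ 1) :
    (u θ - J (n * θ)) ^ 2 ≤ 18 * θ := by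
  have hn' : (1 : ℝ) ≤ n := by exact_mod_cast hn
  have hn0 : (0 : ℝ) < n := by linarith
  have hpi := Real.pi_gt_three
  -- Subtracting `18 x` compensates the bounded part of the derivative of the energy; the singular
  -- part `-2 (u' - n J')² / (n² x)` has the right sign.
  have hd : ∀ x ∈ Set.Ioo (0 : ℝ) 1,
      HasDerivAt (fun x => (u x - J (n * x)) ^ 2 + (u' x - n * J' (n * x)) ^ 2 / n ^ 2 - 18 * x)
        (2 * (u' x - n * J' (n * x)) / n ^ 2 * (-((u' x - n * J' (n * x)) / x) +
          (1 / x - Real.cos x / Real.sin x) * u' x - n * u x) - 18) x := by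
    intro x hx
    have hs := sin_ne_zero_of_mem (θ := x) ⟨hx.1, by linarith [hx.2]⟩
    have hx0 := hx.1.ne'
    have hl : HasDerivAt (fun x : ℝ => (n : ℝ) * x) n x := by
      simpa using (hasDerivAt_id x).const_mul (n : ℝ)
    have hJ1 := (hJ.hasDerivAt (n * x)).comp x hl
    have hJ2 := (hJ.ode (n * x) (by positivity)).comp x hl
    refine (((((hu.hasDerivAt x).sub hJ1).pow 2).add ((((hu.ode x hs).sub
      (hJ2.const_mul (n : ℝ))).pow 2).div_const _)).sub
      ((hasDerivAt_id x).const_mul 18)).congr_deriv ?_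
    simp only [Function.comp_apply, Pi.sub_apply]
    field_simp
    ring
  have hanti : AntitoneOn
      (fun x => (u x - J (n * x)) ^ 2 + (u' x - n * J' (n * x)) ^ 2 / n ^ 2 - 18 * x)
      (Set.Icc 0 1) := by
    refine antitoneOn_of_deriv_nonpos (convex_Icc _ _) ?_ ?_ ?_
    · have h1 : Continuous u := continuous_iff_continuousAt.2 fun x => (hu.hasDerivAt x).continuousAt
      have h2 : Continuous J := continuous_iff_continuousAt.2 fun x => (hJ.hasDerivAt x).continuousAt
      have h3 := hu.continuous
      have h4 := hJ.continuous
      fun_prop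
    · rw [interior_Icc]
      exact fun x hx => (hd x hx).differentiableAt.differentiableWithinAt
    · rw [interior_Icc]
      intro x hx
      rw [(hd x hx).deriv, sub_nonpos]
      have hmem : x ∈ Set.Icc 0 (Real.pi / 2) := ⟨hx.1.le, by linarith [hx.2]⟩
      have b1 := hu.abs_le_one hn hmem
      have b2 := hu.abs_deriv_le hn hmem
      have b3 := abs_inv_sub_cot_le hx.1 hx.2.le
      have b4 : |u' x - n * J' (n * x)| ≤ 3 * n := by
        refine (abs_sub _ _).trans ?_
        rw [abs_mul, Nat.abs_cast]
        nlinarith [hJ.abs_deriv_le (n * x)]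
      have b5 : |(1 / x - Real.cos x / Real.sin x) * u' x - n * u x| ≤ 3 * n := by
        refine (abs_sub _ _).trans ?_
        rw [abs_mul, abs_mul, Nat.abs_cast]
        have : |1 / x - Real.cos x / Real.sin x| * |u' x| ≤ 1 * (2 * n) :=
          mul_le_mul (b3.trans hx.2.le) b2 (abs_nonneg _) zero_le_one
        nlinarith
      set d := u' x - n * J' (n * x)
      set e := (1 / x - Real.cos x / Real.sin x) * u' x - n * u x
      have hx0 := hx.1
      have hsplit : 2 * d / (n : ℝ) ^ 2 *
          (-(d / x) + (1 / x - Real.cos x / Real.sin x) * u' x - n * u x) =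
          -(2 * d ^ 2 / ((n : ℝ) ^ 2 * x)) + 2 / (n : ℝ) ^ 2 * (d * e) := by
        rw [show -(d / x) + (1 / x - Real.cos x / Real.sin x) * u' x - n * u x = -(d / x) + e by
          simp only [e]; ring]
        field_simp
      have hde : d * e ≤ 3 * n * (3 * n) := (le_abs_self _).trans (by rw [abs_mul]; gcongr)
      have hneg : 0 ≤ 2 * d ^ 2 / ((n : ℝ) ^ 2 * x) := by positivity
      have hlast : 2 / (n : ℝ) ^ 2 * (3 * n * (3 * n)) = 18 := by field_simp; norm_num
      have hmul : 2 / (n : ℝ) ^ 2 * (d * e) ≤ 2 / (n : ℝ) ^ 2 * (3 * n * (3 * n)) := by gcongr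
      rw [hsplit]
      linarith
  have h := hanti (Set.left_mem_Icc.2 zero_le_one) ⟨h0, h1⟩ h0
  simp only [mul_zero, hu.apply_zero, hJ.apply_zero, hu.deriv_zero, hJ.deriv_zero] at h
  have h2 : 0 ≤ (u' θ - n * J' (n * θ)) ^ 2 / n ^ 2 := by positivity
  norm_num at h
  linarith

/-- Decay of the Legendre function: Sonine's argument for `√(sin θ) u(θ)`. -/
theorem IsLegendre.sq_le (hu : IsLegendre n u u') (hn : 1 ≤ n) {θ : ℝ}
    (h1 : 1 / n ≤ θ) (h2 : θ ≤ Real.pi / 2) : u θ ^ 2 ≤ 10 / (n * Real.sin θ) := by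
  have hn' : (1 : ℝ) ≤ n := by exact_mod_cast hn
  have hn0 : (0 : ℝ) < n := by linarith
  have hpi := Real.pi_gt_three
  have hi0 : (0 : ℝ) < 1 / n := by positivity
  have hi1 : (1 : ℝ) / n ≤ 1 := by rw [div_le_one hn0]; exact hn'
  have hpos : ∀ x ∈ Set.Icc (1 / n : ℝ) (Real.pi / 2), 0 < Real.sin x := fun x hx =>
    Real.sin_pos_of_pos_of_lt_pi (hi0.trans_le hx.1) (by linarith [hx.2])
  -- With `v = √(sin x) u` the equation reads `v'' + (1 / (4 sin² x) + (n + 1/2)²) v = 0`, and `Φ` is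
  -- `v'² + (1 / (4 sin² x) + (n + 1/2)²) v²` written in terms of `u`.
  set Φ : ℝ → ℝ := fun x => Real.sin x * u' x ^ 2 + Real.cos x * (u x * u' x) +
    u x ^ 2 * (Real.cos x ^ 2 + 1) / (4 * Real.sin x) + (n + 1 / 2) ^ 2 * (Real.sin x * u x ^ 2)
    with hΦ
  have hd : ∀ x ∈ Set.Icc (1 / n : ℝ) (Real.pi / 2),
      HasDerivAt Φ (-(Real.cos x * u x ^ 2 / (2 * Real.sin x ^ 2))) x := by
    intro x hx
    have hs := (hpos x hx).ne'
    have e1 := hu.hasDerivAt x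
    have e2 := hu.ode x hs
    have e3 := Real.hasDerivAt_sin x
    have e4 := Real.hasDerivAt_cos x
    refine ((((e3.mul (e2.pow 2)).add (e4.mul (e1.mul e2))).add
      (((e1.pow 2).mul ((e4.pow 2).add_const 1)).div (e3.const_mul 4) (by simpa using hs))).add
      ((e3.mul (e1.pow 2)).const_mul _)).congr_deriv ?_
    have T := Real.sin_sq_add_cos_sq x
    simp only [Pi.mul_apply, Pi.pow_apply]
    generalize Real.sin x = s at *
    generalize Real.cos x = c at *
    generalize u x = a at *
    generalize u' x = b at *
    have hc : c ^ 2 = 1 - s ^ 2 := by linarith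
    have hc3 : c ^ 3 = c * (1 - s ^ 2) := by rw [← hc]; ring
    field_simp
    ring_nf
    simp only [hc, hc3]
    ring
  have hanti : AntitoneOn Φ (Set.Icc (1 / n) (Real.pi / 2)) := by
    refine antitoneOn_of_deriv_nonpos (convex_Icc _ _)
      (fun x hx => (hd x hx).continuousAt.continuousWithinAt) ?_ ?_
    · exact fun x hx => (hd x (interior_subset hx)).differentiableAt.differentiableWithinAt
    · intro x hx
      rw [(hd x (interior_subset hx)).deriv, neg_nonpos]
      rw [interior_Icc] at hx
      have := cos_nonneg_of_mem (θ := x) ⟨hi0.trans hx.1, hx.2⟩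
      positivity
  have hle := hanti (Set.left_mem_Icc.2 (h1.trans h2)) ⟨h1, h2⟩ h1
  have hs := hpos θ ⟨h1, h2⟩
  have hlow : (n + 1 / 2) ^ 2 * (Real.sin θ * u θ ^ 2) ≤ Φ θ := by
    have : Φ θ - (n + 1 / 2) ^ 2 * (Real.sin θ * u θ ^ 2) =
        (Real.sin θ * u' θ + Real.cos θ * u θ / 2) ^ 2 / Real.sin θ +
          u θ ^ 2 / (4 * Real.sin θ) := by
      simp only [hΦ]
      field_simp
      ring
    have h3 : 0 ≤ (Real.sin θ * u' θ + Real.cos θ * u θ / 2) ^ 2 / Real.sin θ +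
          u θ ^ 2 / (4 * Real.sin θ) := by positivity
    linarith
  have hup : Φ (1 / n) ≤ 10 * n := by
    have hmem : (1 / n : ℝ) ∈ Set.Icc 0 (Real.pi / 2) := ⟨hi0.le, by linarith⟩
    have b1 := hu.abs_le_one hn hmem
    have b2 := hu.abs_deriv_le hn hmem
    have s1 := (Real.sin_lt hi0).le
    have s2 : 1 / (2 * n) ≤ Real.sin (1 / n) := by
      have := Real.sin_gt_sub_cube hi0
      have h3 : (1 / n : ℝ) ^ 3 ≤ 1 / n := pow_le_of_le_one hi0.le hi1 three_ne_zero
      have h4 : (1 : ℝ) / (2 * n) = 1 / n / 2 := by field_simp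
      linarith
    have s0 : 0 < Real.sin (1 / n) := lt_of_lt_of_le (by positivity) s2
    have c1 := Real.abs_cos_le_one (1 / n)
    have q1 : u' (1 / n) ^ 2 ≤ (2 * n) ^ 2 := sq_le_sq' (abs_le.1 b2).1 (abs_le.1 b2).2
    have q2 : u (1 / n) ^ 2 ≤ 1 := (sq_le_one_iff_abs_le_one _).2 b1
    have q3 : Real.cos (1 / n) ^ 2 ≤ 1 := (sq_le_one_iff_abs_le_one _).2 c1
    have t1 : Real.sin (1 / n) * u' (1 / n) ^ 2 ≤ 1 / n * (2 * n) ^ 2 := by gcongr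
    have t2 : Real.cos (1 / n) * (u (1 / n) * u' (1 / n)) ≤ 1 * (1 * (2 * n)) := by
      refine (le_abs_self _).trans ?_
      rw [abs_mul, abs_mul]
      gcongr
    have t3 : u (1 / n) ^ 2 * (Real.cos (1 / n) ^ 2 + 1) / (4 * Real.sin (1 / n)) ≤
        1 * (1 + 1) / (4 * (1 / (2 * n))) := by gcongr
    have t4 : ((n : ℝ) + 1 / 2) ^ 2 * (Real.sin (1 / n) * u (1 / n) ^ 2) ≤
        (3 / 2 * n) ^ 2 * (1 / n * 1) := by
      gcongr
      linarith
    have r1 : (1 : ℝ) / n * (2 * n) ^ 2 = 4 * n := by field_simp; norm_num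
    have r3 : (1 : ℝ) * (1 + 1) / (4 * (1 / (2 * n))) = n := by field_simp; norm_num
    have r4 : (3 / 2 * n : ℝ) ^ 2 * (1 / n * 1) = 9 / 4 * n := by field_simp; norm_num
    rw [r1] at t1
    rw [r3] at t3
    rw [r4] at t4
    simp only [hΦ]
    linarith
  rw [le_div_iff₀ (by positivity)]
  have h3 : (n + 1 / 2 : ℝ) ^ 2 * (Real.sin θ * u θ ^ 2) ≤ 10 * n := by linarith
  have h4 : (n : ℝ) ^ 2 * (Real.sin θ * u θ ^ 2) ≤ 10 * n := by
    refine le_trans ?_ h3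
    gcongr
    linarith
  nlinarith

end Legendre

/-! ### The Bessel function -/

/-- The unit circle. -/
abbrev S1 : Type := Metric.sphere (0 : Plane) 1

theorem integrable_circle {f : S1 → ℝ} (hf : Continuous f) : Integrable f (uniformSphere Plane) :=
  hf.integrable_of_hasCompactSupport (HasCompactSupport.of_compactSpace f)

theorem integral_circle_inner {v w : Plane} (h : ‖v‖ = ‖w‖) {f : ℝ → ℝ} (hf : Continuous f) :
    ∫ s : S1, f (inner ℝ (s : Plane) v) ∂uniformSphere Plane =
      ∫ s : S1, f (inner ℝ (s : Plane) w) ∂uniformSphere Plane := by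
  set A : Plane ≃ₗᵢ[ℝ] Plane := (ℝ ∙ (v - w))ᗮ.reflection
  have hA : A v = w := Submodule.reflection_sub h
  have := integral_sphereMap A (f := fun s : S1 => f (inner ℝ (s : Plane) w)) (by fun_prop)
  rw [← this]
  refine integral_congr_ae (Eventually.of_forall fun s => ?_)
  change f _ = f (inner ℝ (A s) w)
  rw [← hA, A.inner_map_map]

theorem hasDerivAt_integral_circle {g g' : ℝ → S1 → ℝ} (hg : ∀ t, Continuous (g t))
    (hg' : ∀ t, Continuous (g' t)) {C : ℝ} (hC : ∀ t s, |g' t s| ≤ C)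
    (hd : ∀ t s, HasDerivAt (fun t => g t s) (g' t s) t) (t : ℝ) :
    HasDerivAt (fun t => ∫ s, g t s ∂uniformSphere Plane) (∫ s, g' t s ∂uniformSphere Plane) t :=
  (hasDerivAt_integral_of_dominated_loc_of_deriv_le (s := Set.univ) univ_mem
    (Eventually.of_forall fun t => (hg t).stronglyMeasurable.aestronglyMeasurable)
    (integrable_circle (hg t)) (hg' t).stronglyMeasurable.aestronglyMeasurable
    (Eventually.of_forall fun s t _ => hC t s) (integrable_const C)
    (Eventually.of_forall fun s t _ => hd t s)).2

/-- The Bessel function `J₀`, the average of `cos (r s₀)` over the unit circle. -/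
def besselJ (r : ℝ) : ℝ := ∫ s : S1, Real.cos (r * (s : Plane) 0) ∂uniformSphere Plane

/-- The derivative of `besselJ`. -/
def besselJ' (r : ℝ) : ℝ :=
  ∫ s : S1, -Real.sin (r * (s : Plane) 0) * (s : Plane) 0 ∂uniformSphere Plane

theorem sq_add_sq_circle (s : S1) : (s : Plane) 0 ^ 2 + (s : Plane) 1 ^ 2 = 1 := by
  rw [← norm_sq_plane, norm_eq_of_mem_sphere, one_pow]

theorem abs_circle_zero_le (s : S1) : |(s : Plane) 0| ≤ 1 := by
  rw [← sq_le_one_iff_abs_le_one]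
  nlinarith [sq_add_sq_circle s, sq_nonneg ((s : Plane) 1)]

theorem abs_circle_one_le (s : S1) : |(s : Plane) 1| ≤ 1 := by
  rw [← sq_le_one_iff_abs_le_one]
  nlinarith [sq_add_sq_circle s, sq_nonneg ((s : Plane) 0)]

theorem abs_integral_circle_le {f : S1 → ℝ} {C : ℝ} (h : ∀ s, |f s| ≤ C) :
    |∫ s, f s ∂uniformSphere Plane| ≤ C := by
  have := norm_integral_le_of_norm_le_const (f := f) (μ := uniformSphere Plane)
    (Eventually.of_forall h)
  simpa using this

/-- The Bessel equation, from the vanishing of the second derivative of the constant function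
`φ ↦ ∫ cos (r (s₀ cos φ + s₁ sin φ))`. -/
theorem isBessel_besselJ : IsBessel besselJ besselJ' := by
  have hJ'' : ∀ r, HasDerivAt besselJ'
      (∫ s : S1, -Real.cos (r * (s : Plane) 0) * (s : Plane) 0 ^ 2 ∂uniformSphere Plane) r := by
    refine hasDerivAt_integral_circle (C := 1) (fun t => by fun_prop) (fun t => by fun_prop)
      (fun t s => ?_) (fun t s => ?_)
    · rw [abs_mul, abs_neg, abs_pow]
      exact mul_le_one₀ (Real.abs_cos_le_one _) (by positivity)
        (pow_le_one₀ (abs_nonneg _) (abs_circle_zero_le s))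
    · have h1 : HasDerivAt (fun t : ℝ => t * (s : Plane) 0) ((s : Plane) 0) t := by
        simpa using (hasDerivAt_id t).mul_const ((s : Plane) 0)
      exact ((h1.sin.neg).mul_const _).congr_deriv (by ring)
  refine ⟨?_, ?_, ?_, ?_, ?_, ?_⟩
  · refine hasDerivAt_integral_circle (C := 1) (fun t => by fun_prop) (fun t => by fun_prop)
      (fun t s => ?_) (fun t s => ?_)
    · rw [abs_mul, abs_neg]
      exact mul_le_one₀ (Real.abs_sin_le_one _) (by positivity) (abs_circle_zero_le s)
    · have h1 : HasDerivAt (fun t : ℝ => t * (s : Plane) 0) ((s : Plane) 0) t := by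
        simpa using (hasDerivAt_id t).mul_const ((s : Plane) 0)
      exact h1.cos
  · intro r hr
    refine (hJ'' r).congr_deriv ?_
    set a : ℝ → S1 → ℝ := fun φ s => (s : Plane) 0 * Real.cos φ + (s : Plane) 1 * Real.sin φ
      with ha
    set b : ℝ → S1 → ℝ := fun φ s => -((s : Plane) 0 * Real.sin φ) + (s : Plane) 1 * Real.cos φ
      with hb
    have ha' : ∀ φ s, HasDerivAt (fun φ => a φ s) (b φ s) φ := fun φ s =>
      (((Real.hasDerivAt_cos φ).const_mul _).add ((Real.hasDerivAt_sin φ).const_mul _)).congr_deriv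
        (by simp [hb])
    have hb' : ∀ φ s, HasDerivAt (fun φ => b φ s) (-a φ s) φ := fun φ s =>
      ((((Real.hasDerivAt_sin φ).const_mul _).neg).add
        ((Real.hasDerivAt_cos φ).const_mul _)).congr_deriv (by simp [ha]; ring)
    have ba : ∀ φ s, |a φ s| ≤ 2 := by
      intro φ s
      refine (abs_add_le _ _).trans ?_
      rw [abs_mul, abs_mul]
      have := mul_le_one₀ (abs_circle_zero_le s) (abs_nonneg _) (Real.abs_cos_le_one φ)
      have := mul_le_one₀ (abs_circle_one_le s) (abs_nonneg _) (Real.abs_sin_le_one φ)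
      linarith
    have bb : ∀ φ s, |b φ s| ≤ 2 := by
      intro φ s
      refine (abs_add_le _ _).trans ?_
      rw [abs_neg, abs_mul, abs_mul]
      have := mul_le_one₀ (abs_circle_zero_le s) (abs_nonneg _) (Real.abs_sin_le_one φ)
      have := mul_le_one₀ (abs_circle_one_le s) (abs_nonneg _) (Real.abs_cos_le_one φ)
      linarith
    have h1 : ∀ φ, HasDerivAt (fun φ => ∫ s, Real.cos (r * a φ s) ∂uniformSphere Plane)
        (∫ s, -Real.sin (r * a φ s) * (r * b φ s) ∂uniformSphere Plane) φ := by
      refine hasDerivAt_integral_circle (C := 1 * (|r| * 2)) (fun t => by fun_prop)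
        (fun t => by fun_prop) (fun t s => ?_) (fun t s => ?_)
      · rw [abs_mul, abs_neg, abs_mul]
        gcongr
        · exact Real.abs_sin_le_one _
        · exact bb t s
      · exact ((ha' t s).const_mul r).cos
    have h2 : ∀ φ, HasDerivAt (fun φ => ∫ s, -Real.sin (r * a φ s) * (r * b φ s)
          ∂uniformSphere Plane)
        (∫ s, -(Real.cos (r * a φ s) * (r * b φ s)) * (r * b φ s) +
          -Real.sin (r * a φ s) * (r * -a φ s) ∂uniformSphere Plane) φ := by
      refine hasDerivAt_integral_circle
        (C := 1 * (|r| * 2) * (|r| * 2) + 1 * (|r| * 2)) (fun t => by fun_prop)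
        (fun t => by fun_prop) (fun t s => ?_) (fun t s => ?_)
      · refine (abs_add_le _ _).trans ?_
        simp only [abs_mul, abs_neg]
        gcongr
        · exact Real.abs_cos_le_one _
        · exact bb t s
        · exact bb t s
        · exact Real.abs_sin_le_one _
        · exact ba t s
      · exact (((ha' t s).const_mul r).sin.neg).mul ((hb' t s).const_mul r)
    have hconst : ∀ φ, ∫ s, Real.cos (r * a φ s) ∂uniformSphere Plane = besselJ r := by
      intro φ
      have := integral_circle_inner (v := !₂[Real.cos φ, Real.sin φ]) (w := !₂[1, 0]) (by
        rw [EuclideanSpace.norm_eq, EuclideanSpace.norm_eq]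
        simp) (f := fun x => Real.cos (r * x)) (by fun_prop)
      simpa [inner_plane, besselJ, ha] using this
    have h3 : ∀ φ, ∫ s, -Real.sin (r * a φ s) * (r * b φ s) ∂uniformSphere Plane = 0 := by
      intro φ
      refine (h1 φ).unique ?_
      rw [show (fun φ => ∫ s, Real.cos (r * a φ s) ∂uniformSphere Plane) = fun _ => besselJ r from
        funext hconst]
      exact hasDerivAt_const _ _
    have h4 := (h2 0).unique (f₁' := 0) (by
      rw [funext h3]
      exact hasDerivAt_const _ _)
    have h5 : ∫ s : S1, -(Real.cos (r * a 0 s) * (r * b 0 s)) * (r * b 0 s) +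
          -Real.sin (r * a 0 s) * (r * -a 0 s) ∂uniformSphere Plane =
        -r ^ 2 * besselJ r + -r ^ 2 * (∫ s : S1, -Real.cos (r * (s : Plane) 0) * (s : Plane) 0 ^ 2
          ∂uniformSphere Plane) - r * besselJ' r := by
      rw [besselJ, besselJ', ← integral_const_mul, ← integral_const_mul, ← integral_const_mul,
        ← integral_add (integrable_circle (by fun_prop)) (integrable_circle (by fun_prop)),
        ← integral_sub (integrable_circle (by fun_prop)) (integrable_circle (by fun_prop))]
      refine integral_congr_ae (Eventually.of_forall fun s => ?_)
      have := sq_add_sq_circle s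
      simp only [ha, hb, Real.cos_zero, Real.sin_zero, mul_one, mul_zero, add_zero, neg_zero,
        zero_add]
      linear_combination (-(r ^ 2 * Real.cos (r * (s : Plane) 0))) * this
    rw [h5] at h4
    generalize (∫ s : S1, -Real.cos (r * (s : Plane) 0) * (s : Plane) 0 ^ 2
      ∂uniformSphere Plane) = I at *
    field_simp
    refine mul_left_cancel₀ hr ?_
    linear_combination -h4
  · exact continuous_iff_continuousAt.2 fun r => (hJ'' r).continuousAt
  · simp [besselJ]
  · simp [besselJ']
  · intro r
    refine abs_integral_circle_le fun s => ?_
    rw [abs_mul, abs_neg]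
    exact mul_le_one₀ (Real.abs_sin_le_one _) (by positivity) (abs_circle_zero_le s)

theorem re_charFun_unitCircleMeasure (x : Plane) :
    (charFun unitCircleMeasure x).re = besselJ ‖x‖ := by
  have hm : AEMeasurable (Subtype.val : S1 → Plane) (uniformSphere Plane) :=
    measurable_subtype_coe.aemeasurable
  have hc : Continuous fun s : Plane => Complex.exp (inner ℝ s x * Complex.I) := by fun_prop
  have hc' : Continuous fun s : S1 => Complex.exp (inner ℝ (s : Plane) x * Complex.I) := by fun_prop
  rw [charFun_apply, unitCircleMeasure, integral_map hm hc.aestronglyMeasurable]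
  have hi : Integrable (fun s : S1 => Complex.exp (inner ℝ (s : Plane) x * Complex.I))
      (uniformSphere Plane) :=
    hc'.integrable_of_hasCompactSupport (HasCompactSupport.of_compactSpace _)
  have h1 := integral_re hi
  simp only [RCLike.re_to_complex] at h1
  rw [← h1]
  simp only [Complex.exp_ofReal_mul_I_re]
  rw [integral_circle_inner (w := ‖x‖ • EuclideanSpace.single 0 (1 : ℝ)) (by simp [norm_smul])
    (f := Real.cos) Real.continuous_cos]
  simp [besselJ, inner_plane, mul_comm]

/-- The covariance of the random plane wave. -/
theorem IsRandomPlaneWave.integral_mul {Ω : Type*} [MeasurableSpace Ω] {F : Plane → Ω → ℝ}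
    {P : Measure Ω} (hF : IsRandomPlaneWave F P) (x y : Plane) :
    ∫ ω, F x ω * F y ω ∂P = besselJ ‖x - y‖ := by
  rw [← re_charFun_unitCircleMeasure, ← hF.covariance, Complex.ofReal_re]

/-- Near the origin `1 - J₀` is at least quadratic. -/
theorem exists_le_one_sub_besselJ : ∃ κ > 0, ∀ r, |r| ≤ 1 →
    κ * r ^ 2 ≤ 1 - besselJ r ∧ 0 ≤ besselJ r := by
  have hsym : ∫ s : S1, (s : Plane) 0 ^ 2 ∂uniformSphere Plane =
      ∫ s : S1, (s : Plane) 1 ^ 2 ∂uniformSphere Plane := by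
    have := integral_circle_inner (v := !₂[1, 0]) (w := !₂[0, 1]) (by
        rw [EuclideanSpace.norm_eq, EuclideanSpace.norm_eq]
        simp) (f := fun x => x ^ 2) (by fun_prop)
    simpa [inner_plane] using this
  have hone : ∫ s : S1, (s : Plane) 0 ^ 2 ∂uniformSphere Plane = 1 / 2 := by
    have h : ∫ s : S1, ((s : Plane) 0 ^ 2 + (s : Plane) 1 ^ 2) ∂uniformSphere Plane = 1 := by
      simp_rw [sq_add_sq_circle]
      simp
    rw [integral_add (integrable_circle (by fun_prop)) (integrable_circle (by fun_prop)),
      ← hsym] at h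
    linarith
  refine ⟨1 / Real.pi ^ 2, by positivity, fun r hr => ?_⟩
  have hx : ∀ s : S1, |r * (s : Plane) 0| ≤ 1 := fun s => by
    rw [abs_mul]
    exact mul_le_one₀ hr (abs_nonneg _) (abs_circle_zero_le s)
  constructor
  · have h1 : besselJ r ≤ ∫ s : S1, (1 - 2 / Real.pi ^ 2 * (r * (s : Plane) 0) ^ 2)
        ∂uniformSphere Plane := by
      refine integral_mono (integrable_circle (by fun_prop)) (integrable_circle (by fun_prop))
        fun s => ?_
      exact Real.cos_le_one_sub_mul_cos_sq ((hx s).trans (by linarith [Real.pi_gt_three]))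
    have h2 : ∫ s : S1, (1 - 2 / Real.pi ^ 2 * (r * (s : Plane) 0) ^ 2) ∂uniformSphere Plane =
        1 - 1 / Real.pi ^ 2 * r ^ 2 := by
      rw [integral_sub (integrable_const _) (integrable_circle (by fun_prop)),
        integral_const_mul]
      simp_rw [mul_pow]
      rw [integral_const_mul, hone]
      simp
      ring
    linarith
  · refine integral_nonneg fun s => Real.cos_nonneg_of_neg_pi_div_two_le_of_le ?_ ?_
    · linarith [(abs_le.1 (hx s)).1, Real.pi_gt_three]
    · linarith [(abs_le.1 (hx s)).2, Real.pi_gt_three]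

/-! ### Concentration sets of spherical harmonics -/

/-- The distance from `x` to the line through `q`, for points of the sphere. -/
def lineDist (q x : S2) : ℝ := ‖(x : Space) - inner ℝ (q : Space) (x : Space) • (q : Space)‖

theorem lineDist_sq (q x : S2) : lineDist q x ^ 2 = 1 - inner ℝ (q : Space) (x : Space) ^ 2 := by
  rw [lineDist, norm_sub_sq_real, norm_smul, inner_smul_right, norm_eq_of_mem_sphere,
    norm_eq_of_mem_sphere, real_inner_comm, Real.norm_eq_abs, mul_one, sq_abs]
  ring

theorem lineDist_le_add (q x p : S2) : lineDist q x ≤ lineDist q p + ‖(p : Space) - x‖ := by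
  have h : ∀ v : Space, ‖v - inner ℝ (q : Space) v • (q : Space)‖ ≤ ‖v‖ := by
    intro v
    have h1 : ‖v - inner ℝ (q : Space) v • (q : Space)‖ ^ 2 = ‖v‖ ^ 2 -
        inner ℝ (q : Space) v ^ 2 := by
      rw [norm_sub_sq_real, norm_smul, inner_smul_right, norm_eq_of_mem_sphere,
        real_inner_comm, Real.norm_eq_abs, mul_one, sq_abs]
      ring
    refine abs_le_of_sq_le_sq' (a := _) ?_ (norm_nonneg v) |>.2
    rw [h1]
    nlinarith [sq_nonneg (inner ℝ (q : Space) v)]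
  have h2 := h ((x : Space) - p)
  have h3 := norm_add_le ((p : Space) - inner ℝ (q : Space) (p : Space) • (q : Space))
    (((x : Space) - p) - inner ℝ (q : Space) ((x : Space) - p) • (q : Space))
  rw [norm_sub_rev (p : Space)]
  refine le_trans (le_of_eq ?_) (h3.trans (add_le_add le_rfl h2))
  rw [lineDist, inner_sub_right, sub_smul]
  congr 1
  abel

theorem lineDist_sphereMap (A : Space ≃ₗᵢ[ℝ] Space) (q x : S2) :
    lineDist (sphereMap A q) (sphereMap A x) = lineDist q x := by
  have h : lineDist (sphereMap A q) (sphereMap A x) ^ 2 = lineDist q x ^ 2 := by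
    rw [lineDist_sq, lineDist_sq]
    change 1 - inner ℝ (A q) (A x) ^ 2 = _
    rw [A.inner_map_map]
  exact (pow_left_inj₀ (norm_nonneg _) (norm_nonneg _) two_ne_zero).1 h

theorem continuous_lineDist (q : S2) : Continuous (lineDist q) := by
  unfold lineDist
  fun_prop

open scoped Pointwise in
/-- The area of a double cap is at most quadratic in its radius. -/
theorem exists_rho_lineDist_le : ∃ C : ℝ≥0∞, C ≠ ⊤ ∧ ∀ (q : S2) (s : ℝ), 0 ≤ s →
    rho {x | lineDist q x ≤ s} ≤ C * ENNReal.ofReal (s ^ 2) := by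
  have hne : (volume : Measure Space).toSphere Set.univ ≠ 0 := fun h =>
    Measure.toSphere_ne_zero _ (Measure.measure_univ_eq_zero.1 h)
  refine ⟨((volume : Measure Space).toSphere Set.univ)⁻¹ * (3 * 8),
    ENNReal.mul_ne_top (ENNReal.inv_ne_top.2 hne)
      (ENNReal.mul_ne_top (by norm_num) (by norm_num)), fun q s hs => ?_⟩
  have hmeas : ∀ q, MeasurableSet {x | lineDist q x ≤ s} := fun q =>
    (isClosed_le (continuous_lineDist q) continuous_const).measurableSet
  obtain ⟨A, hA, -⟩ := exists_isometry_of_inner_eq (p := q) (q := q) (p' := sphericalPoint 0 0)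
    (q' := sphericalPoint 0 0) (by
      rw [real_inner_self_eq_norm_sq, real_inner_self_eq_norm_sq, norm_eq_of_mem_sphere,
        norm_eq_of_mem_sphere])
  have h1 : {x | lineDist q x ≤ s} =
      sphereMap A ⁻¹' {x | lineDist (sphericalPoint 0 0) x ≤ s} := by
    ext x
    simp only [Set.mem_ofPred_eq, Set.mem_preimage]
    rw [← hA, lineDist_sphereMap]
  rw [h1, (measurePreserving_sphereMap A).measure_preimage (hmeas _).nullMeasurableSet,
    uniformSphere, Measure.smul_apply, smul_eq_mul, mul_assoc]
  gcongr
  rw [Measure.toSphere_apply' _ (hmeas _), mul_assoc]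
  have hdim : ((Module.finrank ℝ Space : ℕ) : ℝ≥0∞) = 3 := by simp
  rw [hdim]
  gcongr
  set B : Set (Fin 3 → ℝ) := Set.Icc ![-s, -s, -1] ![s, s, 1] with hB
  calc volume (Set.Ioo (0 : ℝ) 1 • (Subtype.val '' {x | lineDist (sphericalPoint 0 0) x ≤ s}))
      ≤ (volume : Measure Space) (WithLp.ofLp ⁻¹' B) := by
        refine measure_mono ?_
        rintro _ ⟨r, hr, _, ⟨x, hx, rfl⟩, rfl⟩
        have h2 : lineDist (sphericalPoint 0 0) x ^ 2 ≤ s ^ 2 :=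
          pow_le_pow_left₀ (norm_nonneg _) hx 2
        have h3 : (x : Space) 0 ^ 2 + (x : Space) 1 ^ 2 + (x : Space) 2 ^ 2 = 1 := by
          have := EuclideanSpace.norm_sq_eq (x : Space)
          rw [norm_eq_of_mem_sphere, Fin.sum_univ_three] at this
          simp only [Real.norm_eq_abs, sq_abs] at this
          linarith
        have h4 : inner ℝ (sphericalPoint 0 0 : Space) (x : Space) = (x : Space) 2 := by
          simp [PiLp.inner_apply, Fin.sum_univ_three, sphericalPoint_apply_zero,
            sphericalPoint_apply_one, sphericalPoint_apply_two]
        rw [lineDist_sq, h4] at h2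
        have a0 : |(x : Space) 0| ≤ s := abs_le_of_sq_le_sq (by nlinarith [sq_nonneg ((x : Space) 1)]) hs
        have a1 : |(x : Space) 1| ≤ s := abs_le_of_sq_le_sq (by nlinarith [sq_nonneg ((x : Space) 0)]) hs
        have a2 : |(x : Space) 2| ≤ 1 := abs_le_of_sq_le_sq
          (by nlinarith [sq_nonneg ((x : Space) 0), sq_nonneg ((x : Space) 1)]) zero_le_one
        have hsm : ∀ {a b : ℝ}, |a| ≤ b → -b ≤ r * a ∧ r * a ≤ b := by
          intro a b hab
          rw [← abs_le, abs_mul, abs_of_pos hr.1]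
          nlinarith [abs_nonneg a, hr.2]
        simp only [Set.mem_preimage, hB, Set.mem_Icc, Pi.le_def, Fin.forall_fin_succ]
        simp
        exact ⟨⟨(hsm a0).1, (hsm a1).1, (hsm a2).1⟩, (hsm a0).2, (hsm a1).2, (hsm a2).2⟩
    _ = volume B := (PiLp.volume_preserving_ofLp (Fin 3)).measure_preimage
        measurableSet_Icc.nullMeasurableSet
    _ = 8 * ENNReal.ofReal (s ^ 2) := by
        rw [hB, Real.volume_Icc_pi, Fin.prod_univ_three]
        simp only [Matrix.cons_val_zero, Matrix.cons_val_one, Matrix.cons_val]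
        rw [← ENNReal.ofReal_mul (by linarith), ← ENNReal.ofReal_mul (by nlinarith),
          ← ENNReal.ofReal_ofNat, ← ENNReal.ofReal_mul (by norm_num)]
        congr 1
        ring

section Packing

variable {n : ℕ} {Y : Idx n → S2 → ℝ}

theorem harmonicKernel_self (hY : IsHarmonicONB n Y) (hn : 1 ≤ n) (x : S2) :
    harmonicKernel Y x x = 2 * n + 1 := by
  obtain ⟨u, u', hu, -, h⟩ := exists_isLegendre_harmonicKernel hn hY
  rw [h x x 0 (by rw [real_inner_self_eq_norm_sq, norm_eq_of_mem_sphere, one_pow, Real.cos_zero]),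
    hu.apply_zero, mul_one]

/-- The kernel is small away from the diagonal and the antidiagonal. -/
theorem harmonicKernel_sq_le (hY : IsHarmonicONB n Y) (hn : 1 ≤ n) {x y : S2}
    (h : 1 / n ≤ lineDist x y) :
    harmonicKernel Y x y ^ 2 ≤ (2 * n + 1) ^ 2 * (10 / (n * lineDist x y)) := by
  obtain ⟨u, u', hu, -, hK⟩ := exists_isLegendre_harmonicKernel hn hY
  have hn0 : (0 : ℝ) < n := by
    have : 0 < n := by omega
    exact_mod_cast this
  -- up to the antipodal map the inner product is nonnegative
  have key : ∀ z : S2, 1 / n ≤ lineDist x z → 0 ≤ inner ℝ (x : Space) (z : Space) →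
      harmonicKernel Y x z ^ 2 ≤ (2 * n + 1) ^ 2 * (10 / (n * lineDist x z)) := by
    intro z hz hpos
    set t := inner ℝ (x : Space) (z : Space) with ht
    have ht1 : t ≤ 1 := by
      have := real_inner_le_norm (x : Space) (z : Space)
      rwa [norm_eq_of_mem_sphere, norm_eq_of_mem_sphere, one_mul] at this
    have hs : Real.sin (Real.arccos t) = lineDist x z := by
      rw [Real.sin_arccos, ← lineDist_sq, lineDist, Real.sqrt_sq (norm_nonneg _)]
    have h1 : 1 / n ≤ Real.arccos t :=
      hz.trans (hs ▸ Real.sin_le (Real.arccos_nonneg t))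
    have h2 := hu.sq_le hn h1 (Real.arccos_le_pi_div_two.2 hpos)
    rw [hK x z (Real.arccos t) (Real.cos_arccos (by linarith) ht1).symm, mul_pow, ← hs]
    gcongr
  rcases le_total 0 (inner ℝ (x : Space) (y : Space)) with hpos | hneg
  · exact key y h hpos
  · have h1 : lineDist x (-y) = lineDist x y := by
      have h : lineDist x (-y) ^ 2 = lineDist x y ^ 2 := by
        rw [lineDist_sq, lineDist_sq, coe_neg_sphere, inner_neg_right, neg_sq]
      exact (pow_left_inj₀ (norm_nonneg _) (norm_nonneg _) two_ne_zero).1 h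
    have h2 := key (-y) (by rwa [h1]) (by rw [coe_neg_sphere, inner_neg_right]; linarith)
    rw [h1, neg_of_mem_sphericalHarmonics (harmonicKernel_mem hY x), mul_pow, ← pow_mul,
      mul_comm n, pow_mul, neg_one_sq, one_pow, one_mul] at h2
    exact h2

/-- A spherical harmonic of unit norm is large at few points which are far apart: test the kernel,
which is nearly diagonal on them, against the signs of the values. -/
theorem card_le_of_separated (hY : IsHarmonicONB n Y) (hn : 1 ≤ n) {ε B : ℝ} (hε : 0 < ε)
    (hB1 : 1 ≤ B) (hB : 40 / ε ^ 2 ≤ B) (k : Idx n) (T : Finset S2)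
    (hT : ∀ p ∈ T, ε * (2 * n + 1) < Y k p ^ 2)
    (hsep : ∀ p ∈ T, ∀ q ∈ T, p ≠ q → B / n ≤ lineDist p q) : (T.card : ℝ) ≤ 2 / ε := by
  classical
  have hn0 : (0 : ℝ) < n := by
    have : 0 < n := by omega
    exact_mod_cast this
  set N : ℝ := 2 * n + 1 with hN
  have hN0 : 0 < N := by positivity
  set σ : S2 → ℝ := fun p => if 0 ≤ Y k p then 1 else -1 with hσ
  have hσ1 : ∀ p, |σ p| = 1 := fun p => by simp only [hσ]; split_ifs <;> simp
  have hσY : ∀ p, σ p * Y k p = |Y k p| := by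
    intro p
    simp only [hσ]
    split_ifs with h
    · rw [one_mul, abs_of_nonneg h]
    · rw [neg_one_mul, abs_of_neg (not_le.1 h)]
  have hB0 : 0 < B := by linarith
  have hK : ∀ p ∈ T, ∀ q ∈ T, σ p * σ q * harmonicKernel Y p q ≤
      (if p = q then N else 0) + N * (ε / 2) := by
    intro p hp q hq
    refine (le_abs_self _).trans ?_
    rw [abs_mul, abs_mul, hσ1, hσ1, one_mul, one_mul]
    split_ifs with h
    · rw [h, harmonicKernel_self hY hn, abs_of_pos hN0]
      have : 0 < N * (ε / 2) := by positivity
      linarith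
    · rw [zero_add]
      have h1 := hsep p hp q hq h
      have h2 : 1 / n ≤ lineDist p q := le_trans (by gcongr) h1
      have h3 := harmonicKernel_sq_le hY hn h2
      refine abs_le_of_sq_le_sq (h3.trans ?_) (by positivity)
      rw [mul_pow]
      gcongr
      have h4 : B ≤ n * lineDist p q := by
        rw [div_le_iff₀ hn0] at h1
        linarith
      calc 10 / (n * lineDist p q) ≤ 10 / B := by gcongr
        _ ≤ (ε / 2) ^ 2 := by
          rw [div_le_iff₀ hB0]
          rw [div_le_iff₀ (by positivity)] at hB
          nlinarith
  -- evaluate `∑ₗ (∑ₚ σₚ Yₗ(p))²` from below by the term `l = k`, from above through the kernel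
  have hlow : (T.card : ℝ) ^ 2 * (ε * N) ≤ (∑ p ∈ T, σ p * Y k p) ^ 2 := by
    have h1 : (T.card : ℝ) * √(ε * N) ≤ ∑ p ∈ T, σ p * Y k p := by
      rw [← nsmul_eq_mul]
      refine Finset.card_nsmul_le_sum _ _ _ fun p hp => ?_
      rw [hσY]
      exact Real.sqrt_le_iff.2 ⟨abs_nonneg _, by rw [sq_abs]; exact (hT p hp).le⟩
    calc (T.card : ℝ) ^ 2 * (ε * N) = (T.card * √(ε * N)) ^ 2 := by
          rw [mul_pow, Real.sq_sqrt (by positivity)]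
      _ ≤ _ := by gcongr
  have hmid : (∑ p ∈ T, σ p * Y k p) ^ 2 ≤ ∑ l, (∑ p ∈ T, σ p * Y l p) ^ 2 :=
    Finset.single_le_sum (f := fun l => (∑ p ∈ T, σ p * Y l p) ^ 2) (fun _ _ => sq_nonneg _)
      (Finset.mem_univ k)
  have hexp : ∑ l, (∑ p ∈ T, σ p * Y l p) ^ 2 =
      ∑ p ∈ T, ∑ q ∈ T, σ p * σ q * harmonicKernel Y p q := by
    simp_rw [sq, Finset.sum_mul_sum, harmonicKernel, Finset.mul_sum]
    rw [Finset.sum_comm]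
    refine Finset.sum_congr rfl fun p _ => ?_
    rw [Finset.sum_comm]
    exact Finset.sum_congr rfl fun q _ => Finset.sum_congr rfl fun l _ => by ring
  have hup : ∑ p ∈ T, ∑ q ∈ T, σ p * σ q * harmonicKernel Y p q ≤
      T.card * N + T.card ^ 2 * (N * (ε / 2)) := by
    calc _ ≤ ∑ p ∈ T, ∑ q ∈ T, ((if p = q then N else 0) + N * (ε / 2)) :=
          Finset.sum_le_sum fun p hp => Finset.sum_le_sum fun q hq => hK p hp q hq
      _ = _ := by
          simp only [Finset.sum_add_distrib, Finset.sum_ite_eq, Finset.sum_const, nsmul_eq_mul]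
          rw [Finset.sum_congr rfl fun p hp => if_pos hp]
          simp only [Finset.sum_const, nsmul_eq_mul]
          ring
  rw [← hexp] at hup
  have hfin : (T.card : ℝ) ^ 2 * (ε * N) ≤ T.card * N + T.card ^ 2 * (N * (ε / 2)) :=
    hlow.trans (hmid.trans hup)
  rcases Nat.eq_zero_or_pos T.card with h0 | h0
  · rw [h0]
    simp only [Nat.cast_zero]
    positivity
  · have hc : (0 : ℝ) < T.card := by exact_mod_cast h0
    rw [le_div_iff₀ hε]
    have : (T.card * N) * (T.card * ε) ≤ (T.card * N) * 2 := by nlinarith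
    exact le_of_mul_le_mul_left this (by positivity)

/-- A maximal separated set of points at which a basis function is large covers all such points. -/
theorem exists_cover (hY : IsHarmonicONB n Y) (hn : 1 ≤ n) {ε B : ℝ} (hε : 0 < ε)
    (hB1 : 1 ≤ B) (hB : 40 / ε ^ 2 ≤ B) (k : Idx n) :
    ∃ T : Finset S2, (T.card : ℝ) ≤ 2 / ε ∧
      ∀ p, ε * (2 * n + 1) < Y k p ^ 2 → ∃ q ∈ T, lineDist q p ≤ B / n := by
  classical
  set S : Set ℕ := {m | ∃ T : Finset S2, (∀ p ∈ T, ε * (2 * n + 1) < Y k p ^ 2) ∧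
    (∀ p ∈ T, ∀ q ∈ T, p ≠ q → B / n ≤ lineDist p q) ∧ T.card = m} with hS
  have hne : S.Nonempty := ⟨0, ∅, by simp, by simp, rfl⟩
  have hbdd : BddAbove S := by
    refine ⟨⌊2 / ε⌋₊, ?_⟩
    rintro _ ⟨T, h1, h2, rfl⟩
    exact Nat.le_floor (card_le_of_separated hY hn hε hB1 hB k T h1 h2)
  obtain ⟨T, h1, h2, h3⟩ := Nat.sSup_mem hne hbdd
  refine ⟨T, card_le_of_separated hY hn hε hB1 hB k T h1 h2, fun p hp => ?_⟩
  by_contra! hcon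
  have hn0 : (0 : ℝ) < n := by
    have : 0 < n := by omega
    exact_mod_cast this
  have hsymm : ∀ x y, lineDist x y = lineDist y x := by
    intro x y
    have h : lineDist x y ^ 2 = lineDist y x ^ 2 := by
      rw [lineDist_sq, lineDist_sq, real_inner_comm]
    exact (pow_left_inj₀ (norm_nonneg _) (norm_nonneg _) two_ne_zero).1 h
  have hpT : p ∉ T := by
    intro h
    have h4 := hcon p h
    have h5 : lineDist p p ^ 2 = 0 := by
      rw [lineDist_sq, real_inner_self_eq_norm_sq, norm_eq_of_mem_sphere]
      norm_num
    rw [pow_eq_zero_iff two_ne_zero] at h5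
    rw [h5] at h4
    have : 0 < B / n := by positivity
    linarith
  have hmem : T.card + 1 ∈ S := by
    refine ⟨insert p T, ?_, ?_, Finset.card_insert_of_notMem hpT⟩
    · intro q hq
      rcases Finset.mem_insert.1 hq with rfl | hq
      · exact hp
      · exact h1 q hq
    · intro x hx y hy hxy
      rcases Finset.mem_insert.1 hx with rfl | hx' <;> rcases Finset.mem_insert.1 hy with rfl | hy'
      · exact absurd rfl hxy
      · rw [hsymm]; exact (hcon y hy').le
      · exact (hcon x hx').le
      · exact h2 x hx' y hy' hxy
  have := le_csSup hbdd hmem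
  omega

end Packing

/-- The normalized basis functions are uniformly small outside of a set of points of small
measure: this is the Lindeberg condition. Each of the `2n+1` functions contributes boundedly many
double caps of radius of order `1/n`, of total area of order `1/n`. -/
theorem tendsto_rho_large {Y : ∀ n : ℕ, Idx n → S2 → ℝ} (hY : ∀ n, IsHarmonicONB n (Y n)) {ε r : ℝ}
    (hε : 0 < ε) (hr : 0 ≤ r) :
    Tendsto (fun n : ℕ => rho {x | ∃ k, ∃ p : S2, ‖(p : Space) - x‖ ≤ r / n ∧
      ε * (2 * n + 1) < Y n k p ^ 2}) atTop (𝓝 0) := by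
  obtain ⟨C, hC, hcap⟩ := exists_rho_lineDist_le
  set B : ℝ := max 1 (40 / ε ^ 2)
  have hB1 : 1 ≤ B := le_max_left _ _
  have hbound : ∀ᶠ n : ℕ in atTop, rho {x | ∃ k, ∃ p : S2, ‖(p : Space) - x‖ ≤ r / n ∧
      ε * (2 * n + 1) < Y n k p ^ 2} ≤ C * ENNReal.ofReal (3 * (2 / ε) * (B + r) ^ 2 / n) := by
    filter_upwards [eventually_ge_atTop 1] with n hn
    have hn0 : (0 : ℝ) < n := by
      have : 0 < n := by omega
      exact_mod_cast this
    have hn1 : (1 : ℝ) ≤ n := by exact_mod_cast hn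
    choose T hT hcov using fun k => exists_cover (hY n) hn hε hB1 (le_max_right _ _) k
    have hsub : {x : S2 | ∃ k, ∃ p : S2, ‖(p : Space) - x‖ ≤ r / n ∧
        ε * (2 * n + 1) < Y n k p ^ 2} ⊆
        ⋃ k ∈ (Finset.univ : Finset (Idx n)), ⋃ q ∈ T k, {x | lineDist q x ≤ (B + r) / n} := by
      rintro x ⟨k, p, hp, hY'⟩
      obtain ⟨q, hq, hqp⟩ := hcov k p hY'
      refine Set.mem_iUnion₂.2 ⟨k, Finset.mem_univ k, Set.mem_iUnion₂.2 ⟨q, hq, ?_⟩⟩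
      rw [Set.mem_ofPred_eq, add_div]
      exact (lineDist_le_add q x p).trans (add_le_add hqp hp)
    calc _ ≤ ∑ k : Idx n, ∑ q ∈ T k, rho {x | lineDist q x ≤ (B + r) / n} :=
          (measure_mono hsub).trans ((measure_biUnion_finset_le _ _).trans
            (Finset.sum_le_sum fun k _ => measure_biUnion_finset_le _ _))
      _ ≤ ∑ k : Idx n, ∑ q ∈ T k, C * ENNReal.ofReal (((B + r) / n) ^ 2) :=
          Finset.sum_le_sum fun k _ => Finset.sum_le_sum fun q _ => hcap q _ (by positivity)
      _ ≤ ∑ k : Idx n, ENNReal.ofReal (2 / ε) * (C * ENNReal.ofReal (((B + r) / n) ^ 2)) := by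
          refine Finset.sum_le_sum fun k _ => ?_
          rw [Finset.sum_const, nsmul_eq_mul]
          gcongr
          rw [← ENNReal.ofReal_natCast]
          exact ENNReal.ofReal_le_ofReal (hT k)
      _ = C * ENNReal.ofReal ((2 * n + 1) * ((2 / ε) * ((B + r) / n) ^ 2)) := by
          rw [Finset.sum_const, Finset.card_univ, card_Idx, nsmul_eq_mul,
            ENNReal.ofReal_mul (by positivity), ENNReal.ofReal_mul (by positivity)]
          rw [show ((2 * n + 1 : ℕ) : ℝ≥0∞) = ENNReal.ofReal (2 * n + 1) by
            rw [← ENNReal.ofReal_natCast]; push_cast; rfl]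
          ring
      _ ≤ _ := by
          gcongr
          calc (2 * n + 1) * ((2 / ε) * ((B + r) / n) ^ 2)
              ≤ (3 * n : ℝ) * ((2 / ε) * ((B + r) / n) ^ 2) := by gcongr; linarith
            _ = 3 * (2 / ε) * (B + r) ^ 2 / n := by field_simp
  refine tendsto_of_tendsto_of_tendsto_of_le_of_le' tendsto_const_nhds ?_
    (Eventually.of_forall fun _ => bot_le) hbound
  have h1 : Tendsto (fun n : ℕ => ENNReal.ofReal (3 * (2 / ε) * (B + r) ^ 2 / n)) atTop (𝓝 0) := by
    rw [← ENNReal.ofReal_zero]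
    exact ENNReal.tendsto_ofReal (tendsto_const_div_atTop_nhds_zero_nat _)
  simpa using ENNReal.Tendsto.const_mul h1 (Or.inr hC)

/-! ### Local scaling limit of the kernel -/

theorem norm_sphereExp_sub_le {x : S2} {v : TangentPlane x} (hv : ‖v‖ ≤ 1) :
    ‖(sphereExp x v : Space) - x - v‖ ≤ ‖v‖ ^ 2 := by
  have h1 : (sphereExp x v : Space) - x - v =
      (Real.cos ‖v‖ - 1) • (x : Space) + (Real.sinc ‖v‖ - 1) • (v : Space) := by
    change Real.cos ‖v‖ • (x : Space) + Real.sinc ‖v‖ • (v : Space) - x - v = _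
    module
  have h0 := norm_nonneg v
  have h2 : |Real.cos ‖v‖ - 1| ≤ ‖v‖ ^ 2 / 2 := by
    rw [abs_le]
    constructor
    · linarith [Real.one_sub_sq_div_two_le_cos (x := ‖v‖)]
    · nlinarith [Real.cos_le_one ‖v‖]
  have h3 : |Real.sinc ‖v‖ - 1| * ‖v‖ ≤ ‖v‖ ^ 2 / 2 := by
    rcases h0.eq_or_lt with h | h
    · rw [← h]; simp
    · have e1 : |Real.sinc ‖v‖ - 1| * ‖v‖ = |Real.sin ‖v‖ - ‖v‖| := by
        conv_lhs => rw [← abs_of_pos h, abs_norm, ← abs_norm, ← abs_mul]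
        rw [abs_norm, Real.sinc_of_ne_zero h.ne']
        congr 1
        field_simp
      rw [e1, abs_le]
      have e2 := Real.sin_gt_sub_cube h
      have e3 := Real.sin_lt h
      have e4 : ‖v‖ ^ 3 ≤ ‖v‖ ^ 2 := pow_le_pow_of_le_one h0 hv (by norm_num)
      constructor
      · linarith [sq_nonneg ‖v‖]
      · linarith [sq_nonneg ‖v‖]
  rw [h1]
  refine (norm_add_le _ _).trans ?_
  rw [norm_smul, norm_smul, norm_eq_of_mem_sphere, mul_one, Real.norm_eq_abs, Real.norm_eq_abs,
    Submodule.norm_coe]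
  linarith

theorem norm_frame (x : S2) (e : Plane ≃ₗᵢ[ℝ] TangentPlane x) (c : ℝ) (y : Plane) :
    ‖e (c • y)‖ = |c| * ‖y‖ := by
  rw [e.norm_map, norm_smul, Real.norm_eq_abs]

section Scaling

variable {n : ℕ} {R : ℝ} {x : S2} (e : Plane ≃ₗᵢ[ℝ] TangentPlane x) {y y' : Plane}

theorem norm_frame_le (hR : 0 < R) (hy : y ∈ Metric.closedBall (0 : Plane) 2) :
    ‖e ((R / n) • y)‖ ≤ 2 * R / n := by
  rw [mem_closedBall_zero_iff] at hy
  rw [norm_frame, abs_of_nonneg (by positivity)]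
  calc R / n * ‖y‖ ≤ R / n * 2 := by gcongr
    _ = 2 * R / n := by ring

theorem dist_sphereExp_center_le (hR : 0 < R) (hn : 1 ≤ n) (hnR : 2 * R ≤ n)
    (hy : y ∈ Metric.closedBall (0 : Plane) 2) :
    ‖(sphereExp x (e ((R / n) • y)) : Space) - x‖ ≤ 4 * R / n := by
  have hn0 : (0 : ℝ) < n := by exact_mod_cast hn
  have h1 := norm_frame_le (n := n) e hR hy
  have h2 : 2 * R / n ≤ 1 := by rwa [div_le_one hn0]
  have h3 := norm_sphereExp_sub_le (h1.trans h2)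
  have h4 := norm_add_le ((sphereExp x (e ((R / n) • y)) : Space) - x - e ((R / n) • y))
    (e ((R / n) • y) : Space)
  rw [sub_add_cancel, Submodule.norm_coe] at h4
  have h5 : ‖e ((R / n) • y)‖ ^ 2 ≤ ‖e ((R / n) • y)‖ := by
    nlinarith [norm_nonneg (e ((R / n) • y))]
  calc _ ≤ 2 * R / n + 2 * R / n := by linarith
    _ = 4 * R / n := by ring

theorem abs_dist_sphereExp_sub_le (hR : 0 < R) (hn : 1 ≤ n) (hnR : 2 * R ≤ n)
    (hy : y ∈ Metric.closedBall (0 : Plane) 2) (hy' : y' ∈ Metric.closedBall (0 : Plane) 2) :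
    |‖(sphereExp x (e ((R / n) • y)) : Space) - sphereExp x (e ((R / n) • y'))‖ -
      R / n * ‖y - y'‖| ≤ 8 * R ^ 2 / n ^ 2 := by
  have hn0 : (0 : ℝ) < n := by exact_mod_cast hn
  have h2 : 2 * R / n ≤ 1 := by rwa [div_le_one hn0]
  have key : ∀ z ∈ Metric.closedBall (0 : Plane) 2,
      ‖(sphereExp x (e ((R / n) • z)) : Space) - x - e ((R / n) • z)‖ ≤ 4 * R ^ 2 / n ^ 2 := by
    intro z hz
    have h1 := norm_frame_le (n := n) e hR hz
    refine (norm_sphereExp_sub_le (h1.trans h2)).trans ?_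
    calc ‖e ((R / n) • z)‖ ^ 2 ≤ (2 * R / n) ^ 2 := by gcongr
      _ = 4 * R ^ 2 / n ^ 2 := by ring
  have hd : R / n * ‖y - y'‖ = ‖(e ((R / n) • y) : Space) - e ((R / n) • y')‖ := by
    rw [← Submodule.coe_sub, ← map_sub, ← smul_sub, Submodule.norm_coe, norm_frame,
      abs_of_nonneg (by positivity)]
  rw [hd]
  refine (abs_norm_sub_norm_le _ _).trans ?_
  have h3 := norm_sub_le ((sphereExp x (e ((R / n) • y)) : Space) - x - e ((R / n) • y))
    ((sphereExp x (e ((R / n) • y')) : Space) - x - e ((R / n) • y'))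
  have h4 : 8 * R ^ 2 / (n : ℝ) ^ 2 = 4 * R ^ 2 / n ^ 2 + 4 * R ^ 2 / n ^ 2 := by ring
  rw [h4]
  refine le_trans (le_of_eq ?_) (h3.trans (add_le_add (key y hy) (key y' hy')))
  congr 1
  abel

end Scaling

theorem angle_estimates (p q : S2) {θ : ℝ} (hθ : θ = Real.arccos (inner ℝ (p : Space) (q : Space))) :
    inner ℝ (p : Space) (q : Space) = Real.cos θ ∧ 0 ≤ θ ∧ θ ≤ 2 * ‖(p : Space) - q‖ ∧
      |θ - ‖(p : Space) - q‖| ≤ θ ^ 3 := by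
  have h1 := abs_real_inner_le_norm (p : Space) (q : Space)
  rw [norm_eq_of_mem_sphere, norm_eq_of_mem_sphere, one_mul, abs_le] at h1
  have hcos : inner ℝ (p : Space) (q : Space) = Real.cos θ := by
    rw [hθ, Real.cos_arccos h1.1 h1.2]
  have h0 : 0 ≤ θ := hθ ▸ Real.arccos_nonneg _
  have hpi : θ ≤ Real.pi := hθ ▸ Real.arccos_le_pi _
  have hs0 : 0 ≤ Real.sin (θ / 2) := Real.sin_nonneg_of_nonneg_of_le_pi (by linarith) (by linarith)
  have hd : ‖(p : Space) - q‖ = 2 * Real.sin (θ / 2) := by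
    have h2 : ‖(p : Space) - q‖ ^ 2 = (2 * Real.sin (θ / 2)) ^ 2 := by
      rw [norm_sub_sq_real, norm_eq_of_mem_sphere, norm_eq_of_mem_sphere, hcos, mul_pow,
        Real.sin_sq_eq_half_sub]
      ring_nf
    exact (pow_left_inj₀ (norm_nonneg _) (by positivity) two_ne_zero).1 h2
  refine ⟨hcos, h0, ?_, ?_⟩
  · have h3 := Real.mul_le_sin (x := θ / 2) (by linarith) (by linarith)
    have h4 : θ / 4 ≤ 2 / Real.pi * (θ / 2) := by
      have : 1 / 2 ≤ 2 / Real.pi := by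
        rw [div_le_div_iff₀ two_pos Real.pi_pos]
        linarith [Real.pi_lt_four]
      nlinarith
    rw [hd]
    linarith
  · rw [hd]
    rcases h0.eq_or_lt with h | h
    · rw [← h]; simp
    · have h3 := Real.sin_lt (x := θ / 2) (by linarith)
      have h4 := Real.sin_gt_sub_cube (x := θ / 2) (by linarith)
      have h5 : (θ / 2) ^ 3 = θ ^ 3 / 8 := by ring
      have h6 : 0 < θ ^ 3 := by positivity
      rw [abs_le]
      constructor <;> linarith

theorem abs_besselJ_sub_le (a b : ℝ) : |besselJ a - besselJ b| ≤ |a - b| := by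
  have := Convex.norm_image_sub_le_of_norm_hasDerivWithin_le (f := besselJ) (f' := besselJ')
    (C := 1) (s := Set.univ) (x := b) (y := a)
    (fun x _ => (isBessel_besselJ.hasDerivAt x).hasDerivWithinAt)
    (fun x _ => isBessel_besselJ.abs_deriv_le x) convex_univ (Set.mem_univ _) (Set.mem_univ _)
  simpa [Real.norm_eq_abs] using this

/-- At the scale `1 / n` the normalized kernel converges to the covariance of the random plane
wave, uniformly in the base point and in the identification of the tangent plane. -/
theorem eventually_kernel_close {Y : ∀ n : ℕ, Idx n → S2 → ℝ} (hY : ∀ n, IsHarmonicONB n (Y n))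
    {R : ℝ} (hR : 0 < R) {δ : ℝ} (hδ : 0 < δ) :
    ∀ᶠ n : ℕ in atTop, ∀ (x : S2) (e : Plane ≃ₗᵢ[ℝ] TangentPlane x),
      ∀ y ∈ Metric.closedBall (0 : Plane) 2, ∀ y' ∈ Metric.closedBall (0 : Plane) 2,
      |harmonicKernel (Y n) (sphereExp x (e ((R / n) • y))) (sphereExp x (e ((R / n) • y'))) /
        (2 * n + 1) - besselJ (R * ‖y - y'‖)| ≤ δ := by
  have hlim : Tendsto (fun n : ℕ => √(288 * R / n) + (16 * R) ^ 3 / (n : ℝ) ^ 2 + 8 * R ^ 2 / n)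
      atTop (𝓝 0) := by
    have h1 := (tendsto_const_div_atTop_nhds_zero_nat (288 * R)).sqrt
    have h2 := tendsto_const_div_pow ((16 * R) ^ 3) 2 two_ne_zero
    have h3 := tendsto_const_div_atTop_nhds_zero_nat (8 * R ^ 2)
    simpa using (h1.add h2).add h3
  filter_upwards [hlim.eventually_le_const hδ, eventually_ge_atTop 1,
    tendsto_natCast_atTop_atTop.eventually_ge_atTop (16 * R)] with n hn hn1 hnR x e y hy y' hy'
  have hn0 : (0 : ℝ) < n := by exact_mod_cast hn1
  obtain ⟨u, u', hu, -, hK⟩ := exists_isLegendre_harmonicKernel hn1 (hY n)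
  set p := sphereExp x (e ((R / n) • y))
  set q := sphereExp x (e ((R / n) • y'))
  obtain ⟨h1, h2, h3, h4⟩ := angle_estimates p q rfl
  set θ := Real.arccos (inner ℝ (p : Space) (q : Space))
  have h5 := abs_dist_sphereExp_sub_le e hR hn1 (by linarith) hy hy'
  change |‖(p : Space) - q‖ - R / n * ‖y - y'‖| ≤ _ at h5
  have hyy : ‖y - y'‖ ≤ 4 := by
    rw [mem_closedBall_zero_iff] at hy hy'
    linarith [norm_sub_le y y']
  have h6 : ‖(p : Space) - q‖ ≤ 8 * R / n := by
    have e1 : R / n * ‖y - y'‖ ≤ R / n * 4 := by gcongr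
    have e2 : 8 * R ^ 2 / (n : ℝ) ^ 2 ≤ 4 * R / n := by
      rw [div_le_div_iff₀ (by positivity) hn0]
      have : 2 * R * (4 * R * n) ≤ n * (4 * R * n) := by
        gcongr
        linarith
      linarith
    have e3 : R / n * 4 + 4 * R / n = 8 * R / n := by ring
    have := (abs_le.1 h5).2
    linarith
  have h7 : θ ≤ 16 * R / n := by
    have : 16 * R / n = 2 * (8 * R / n) := by ring
    rw [this]
    linarith
  have h8 : θ ≤ 1 := h7.trans (by rwa [div_le_one hn0])
  have h9 := hu.sq_sub_bessel_le hn1 isBessel_besselJ h2 h8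
  have h10 : |u θ - besselJ (n * θ)| ≤ √(288 * R / n) := by
    refine Real.abs_le_sqrt (h9.trans ?_)
    calc 18 * θ ≤ 18 * (16 * R / n) := by gcongr
      _ = 288 * R / n := by ring
  have h11 : |n * θ - R * ‖y - y'‖| ≤ (16 * R) ^ 3 / (n : ℝ) ^ 2 + 8 * R ^ 2 / n := by
    have e1 : n * θ - R * ‖y - y'‖ = n * (θ - ‖(p : Space) - q‖) +
        n * (‖(p : Space) - q‖ - R / n * ‖y - y'‖) := by
      field_simp
      ring
    rw [e1]
    refine (abs_add_le _ _).trans ?_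
    rw [abs_mul, abs_mul, Nat.abs_cast]
    refine add_le_add ?_ ?_
    · calc (n : ℝ) * |θ - ‖(p : Space) - q‖| ≤ n * (16 * R / n) ^ 3 := by
            gcongr
            exact h4.trans (by gcongr)
        _ = (16 * R) ^ 3 / (n : ℝ) ^ 2 := by field_simp
    · calc (n : ℝ) * |‖(p : Space) - q‖ - R / n * ‖y - y'‖| ≤ n * (8 * R ^ 2 / n ^ 2) := by gcongr
        _ = 8 * R ^ 2 / n := by field_simp
  rw [hK p q θ h1, mul_div_cancel_left₀ _ (by positivity)]
  have h12 := abs_besselJ_sub_le (n * θ) (R * ‖y - y'‖)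
  have h13 := abs_sub_le (u θ) (besselJ (n * θ)) (besselJ (R * ‖y - y'‖))
  linarith

/-! ### Characteristic functions -/

/-- The second order Taylor expansion of the characteristic function, compared with a Gaussian. -/
theorem exists_charFun_close {Ω : Type*} [MeasurableSpace Ω] {P : Measure Ω}
    [IsProbabilityMeasure P] {X : Ω → ℝ} (hX : AEMeasurable X P) (h0 : ∫ ω, X ω ∂P = 0)
    (h1 : ∫ ω, X ω ^ 2 ∂P = 1) {ε : ℝ} (hε : 0 < ε) :
    ∃ η > 0, ∀ b : ℝ, |b| ≤ η →
      ‖charFun (P.map X) b - Complex.exp ((-(b ^ 2 / 2) : ℝ))‖ ≤ ε * b ^ 2 := by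
  have e1 := taylor_charFun_two hX h0 h1
  have e2 : (fun t : ℝ => charFun ((gaussianReal 0 1).map id) t - (1 - (t : ℂ) ^ 2 / 2))
      =o[𝓝 0] fun t => (t : ℝ) ^ 2 := by
    refine taylor_charFun_two aemeasurable_id (by simp) ?_
    have := variance_fun_id_gaussianReal (μ := 0) (v := 1)
    rw [variance_eq_integral (by fun_prop)] at this
    simpa using this
  have e3 := (e1.sub e2).def hε
  rw [Metric.eventually_nhds_iff] at e3
  obtain ⟨η, hη, h⟩ := e3
  refine ⟨η / 2, by positivity, fun b hb => ?_⟩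
  have h2 := h (y := b) (by rw [dist_zero_right, Real.norm_eq_abs]; linarith)
  rw [sub_sub_sub_cancel_right, Measure.map_id, charFun_gaussianReal, Real.norm_eq_abs,
    abs_of_nonneg (sq_nonneg b)] at h2
  have h3 : (b : ℂ) * ((0 : ℝ) : ℂ) * Complex.I - (((1 : NNReal) : ℝ) : ℂ) * (b : ℂ) ^ 2 / 2 =
      ((-(b ^ 2 / 2) : ℝ) : ℂ) := by
    push_cast
    simp
  rwa [h3] at h2

theorem norm_prod_sub_prod_le {ι : Type*} (s : Finset ι) {f g : ι → ℂ} (hf : ∀ i ∈ s, ‖f i‖ ≤ 1)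
    (hg : ∀ i ∈ s, ‖g i‖ ≤ 1) : ‖∏ i ∈ s, f i - ∏ i ∈ s, g i‖ ≤ ∑ i ∈ s, ‖f i - g i‖ := by
  classical
  induction s using Finset.induction_on with
  | empty => simp
  | insert a s ha ih =>
    rw [Finset.prod_insert ha, Finset.prod_insert ha, Finset.sum_insert ha]
    have h1 := ih (fun i hi => hf i (Finset.mem_insert_of_mem hi))
      (fun i hi => hg i (Finset.mem_insert_of_mem hi))
    have h2 : ‖∏ i ∈ s, f i‖ ≤ 1 := by
      rw [norm_prod]
      exact Finset.prod_le_one (fun _ _ => norm_nonneg _)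
        fun i hi => hf i (Finset.mem_insert_of_mem hi)
    have h3 : f a * ∏ i ∈ s, f i - g a * ∏ i ∈ s, g i =
        (f a - g a) * ∏ i ∈ s, f i + g a * (∏ i ∈ s, f i - ∏ i ∈ s, g i) := by ring
    rw [h3]
    refine (norm_add_le _ _).trans ?_
    rw [norm_mul, norm_mul]
    have h4 := hg a (Finset.mem_insert_self a s)
    have h5 : ‖f a - g a‖ * ‖∏ i ∈ s, f i‖ ≤ ‖f a - g a‖ * 1 := by gcongr
    have h6 : ‖g a‖ * ‖∏ i ∈ s, f i - ∏ i ∈ s, g i‖ ≤ 1 * ‖∏ i ∈ s, f i - ∏ i ∈ s, g i‖ := by gcongr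
    linarith

theorem integral_exp_eq_charFun {Ω : Type*} [MeasurableSpace Ω] {P : Measure Ω} {S : Ω → ℝ}
    (hS : AEMeasurable S P) :
    ∫ ω, Complex.exp (S ω * Complex.I) ∂P = charFun (P.map S) 1 := by
  rw [charFun_apply_real, integral_map hS (by fun_prop)]
  simp

/-- The characteristic function of a weighted sum of independent identically distributed
coefficients, when all the weights are small, is close to that of the Gaussian of the same
variance. -/
theorem norm_integral_exp_sub_le {Ω ι : Type*} [Fintype ι] [MeasurableSpace Ω] {P : Measure Ω}
    [IsProbabilityMeasure P] {a : ι → Ω → ℝ} (ha : iIndepFun a P)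
    (hm : ∀ k, AEMeasurable (a k) P) {φ : ℝ → ℂ} (hφ : ∀ k, charFun (P.map (a k)) = φ) {ε η : ℝ}
    (h : ∀ b : ℝ, |b| ≤ η → ‖φ b - Complex.exp ((-(b ^ 2 / 2) : ℝ))‖ ≤ ε * b ^ 2) {b : ι → ℝ}
    (hb : ∀ k, |b k| ≤ η) :
    ‖∫ ω, Complex.exp (((∑ k, b k * a k ω : ℝ) : ℂ) * Complex.I) ∂P -
      Complex.exp ((-((∑ k, b k ^ 2) / 2) : ℝ))‖ ≤ ε * ∑ k, b k ^ 2 := by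
  have hind : iIndepFun (fun k ω => b k * a k ω) P :=
    ha.comp (fun k x => b k * x) (fun k => measurable_const_mul _)
  have hm' : ∀ k, AEMeasurable (fun ω => b k * a k ω) P := fun k => (hm k).const_mul _
  rw [integral_exp_eq_charFun (S := fun ω => ∑ k, b k * a k ω)
    (Finset.aemeasurable_fun_sum _ fun k _ => hm' k), hind.charFun_map_fun_sum_eq_prod hm',
    Finset.prod_apply]
  have h1 : Complex.exp ((-((∑ k, b k ^ 2) / 2) : ℝ)) =
      ∏ k, Complex.exp ((-(b k ^ 2 / 2) : ℝ)) := by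
    rw [← Complex.exp_sum]
    congr 1
    push_cast
    rw [Finset.sum_neg_distrib, Finset.sum_div]
  have h2 : ∀ k, charFun (P.map fun ω => b k * a k ω) 1 = φ (b k) := by
    intro k
    rw [charFun_map_mul_comp (hm k), mul_one, hφ]
  simp_rw [h2]
  rw [h1, Finset.mul_sum]
  refine (norm_prod_sub_prod_le _ (fun k _ => ?_) (fun k _ => ?_)).trans
    (Finset.sum_le_sum fun k _ => h _ (hb k))
  · have := Measure.isProbabilityMeasure_map (hm k)
    rw [← hφ k]
    exact norm_charFun_le_one _
  · rw [Complex.norm_exp]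
    simp only [Complex.ofReal_re]
    rw [Real.exp_le_one_iff]
    linarith [sq_nonneg (b k)]

/-- The characteristic function of the finite-dimensional distributions of the random plane wave. -/
theorem isRandomPlaneWave_integral_exp {Ω : Type*} [MeasurableSpace Ω] {P : Measure Ω}
    {F : Plane → Ω → ℝ} (hF : IsRandomPlaneWave F P) {ι : Type*} [Fintype ι] (z : ι → Plane)
    (t : ι → ℝ) :
    ∫ ω, Complex.exp (((∑ i, t i * F (z i) ω : ℝ) : ℂ) * Complex.I) ∂P =
      Complex.exp ((-((∑ i, ∑ j, t i * t j * besselJ ‖z i - z j‖) / 2) : ℝ)) := by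
  have hG := hF.gaussian
  have := hG.isProbabilityMeasure
  have hS : HasGaussianLaw (fun ω => ∑ i, t i * F (z i) ω) P :=
    ((hG.comp_right z).smul t).hasGaussianLaw_fun_sum (I := Finset.univ)
  have hL2 : ∀ x, MemLp (F x) 2 P := fun x => (hG.hasGaussianLaw_eval x).memLp_two
  have hmean : ∫ ω, ∑ i, t i * F (z i) ω ∂P = 0 := by
    rw [integral_finsetSum _ fun i _ => ((hL2 (z i)).integrable one_le_two).const_mul (t i)]
    simp_rw [integral_const_mul, hF.centered]
    simp
  have hvar : Var[fun ω => ∑ i, t i * F (z i) ω; P] =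
      ∑ i, ∑ j, t i * t j * besselJ ‖z i - z j‖ := by
    rw [variance_of_integral_eq_zero hS.aemeasurable hmean]
    have hi : ∀ i j, Integrable (fun ω => t i * F (z i) ω * (t j * F (z j) ω)) P := by
      intro i j
      have := ((hL2 (z i)).integrable_mul (hL2 (z j))).const_mul (t i * t j)
      refine this.congr (Eventually.of_forall fun ω => ?_)
      simp only [Pi.mul_apply]
      ring
    simp_rw [sq, Finset.sum_mul_sum]
    rw [integral_finsetSum _ fun i _ => integrable_finsetSum _ fun j _ => hi i j]
    refine Finset.sum_congr rfl fun i _ => ?_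
    rw [integral_finsetSum _ fun j _ => hi i j]
    refine Finset.sum_congr rfl fun j _ => ?_
    rw [← hF.integral_mul, ← integral_const_mul]
    exact integral_congr_ae (Eventually.of_forall fun ω => by ring)
  rw [integral_exp_eq_charFun hS.aemeasurable, hS.charFun_map_eq]
  have h1 : (fun ω => inner ℝ (1 : ℝ) (∑ i, t i * F (z i) ω)) =
      fun ω => ∑ i, t i * F (z i) ω := by
    ext ω
    simp
  rw [h1, hmean, hvar]
  congr 1
  push_cast
  ring

/-! ### Convergence of the finite-dimensional distributions -/

/-- Lévy's continuity theorem and the portmanteau theorem, in the form in which they are used. -/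
theorem fddLimsup_of_tendsto {Ω Ω' : Type*} [MeasurableSpace Ω] [MeasurableSpace Ω']
    {Q : Measure Ω} [IsProbabilityMeasure Q] {P' : Measure Ω'} [IsProbabilityMeasure P']
    {X : ℕ → Ω → Plane → ℝ} {Y : Ω' → Plane → ℝ}
    (hX : ∀ n, ∀ p ∈ Metric.closedBall (0 : Plane) 2, AEMeasurable (fun ω => X n ω p) Q)
    (hY : ∀ p ∈ Metric.closedBall (0 : Plane) 2, AEMeasurable (fun ω => Y ω p) P')
    (h : ∀ s : Finset Plane, (s : Set Plane) ⊆ Metric.closedBall 0 2 → ∀ t : s → ℝ,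
      Tendsto (fun n => ∫ ω, Complex.exp (((∑ p, t p * X n ω p : ℝ) : ℂ) * Complex.I) ∂Q) atTop
        (𝓝 (∫ ω, Complex.exp (((∑ p, t p * Y ω p : ℝ) : ℂ) * Complex.I) ∂P'))) :
    FddLimsup Q P' X Y := by
  intro s hs C hC δ hδ
  have hXm : ∀ n, AEMeasurable (fun ω => WithLp.toLp 2 fun p : s => X n ω p) Q := fun n =>
    (PiLp.continuous_toLp 2 _).measurable.comp_aemeasurable
      (aemeasurable_pi_lambda _ fun p => hX n p (hs p.2))
  have hYm : AEMeasurable (fun ω => WithLp.toLp 2 fun p : s => Y ω p) P' :=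
    (PiLp.continuous_toLp 2 _).measurable.comp_aemeasurable
      (aemeasurable_pi_lambda _ fun p => hY p (hs p.2))
  let μs : ℕ → ProbabilityMeasure (EuclideanSpace ℝ s) := fun n =>
    ⟨Q.map fun ω => WithLp.toLp 2 fun p : s => X n ω p, Measure.isProbabilityMeasure_map (hXm n)⟩
  let μ : ProbabilityMeasure (EuclideanSpace ℝ s) :=
    ⟨P'.map fun ω => WithLp.toLp 2 fun p : s => Y ω p, Measure.isProbabilityMeasure_map hYm⟩
  have hlim : Tendsto μs atTop (𝓝 μ) := by
    rw [ProbabilityMeasure.tendsto_iff_tendsto_charFun]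
    intro t
    have h1 := h s hs t
    have hin : ∀ f : s → ℝ, inner ℝ (WithLp.toLp 2 f : EuclideanSpace ℝ s) t = ∑ p, t p * f p := by
      intro f
      simp [PiLp.inner_apply]
    have e1 : ∀ n, charFun (μs n : Measure (EuclideanSpace ℝ s)) t =
        ∫ ω, Complex.exp (((∑ p, t p * X n ω p : ℝ) : ℂ) * Complex.I) ∂Q := by
      intro n
      change charFun (Q.map _) t = _
      rw [charFun_apply, integral_map (hXm n) (by fun_prop)]
      simp_rw [hin]
    have e2 : charFun (μ : Measure (EuclideanSpace ℝ s)) t =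
        ∫ ω, Complex.exp (((∑ p, t p * Y ω p : ℝ) : ℂ) * Complex.I) ∂P' := by
      change charFun (P'.map _) t = _
      rw [charFun_apply, integral_map hYm (by fun_prop)]
      simp_rw [hin]
    rw [e2]
    simp_rw [e1]
    exact h1
  have hC' : IsClosed ((WithLp.ofLp : EuclideanSpace ℝ s → s → ℝ) ⁻¹' C) :=
    hC.preimage (PiLp.continuous_ofLp 2 _)
  have hle := ProbabilityMeasure.limsup_measure_closed_le_of_tendsto hlim hC'
  have hlt : (atTop.limsup fun n => (μs n : Measure (EuclideanSpace ℝ s))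
      ((WithLp.ofLp : EuclideanSpace ℝ s → s → ℝ) ⁻¹' C)) <
      (μ : Measure (EuclideanSpace ℝ s)) ((WithLp.ofLp : EuclideanSpace ℝ s → s → ℝ) ⁻¹' C) + δ :=
    hle.trans_lt (ENNReal.lt_add_right (measure_ne_top _ _) hδ)
  filter_upwards [eventually_lt_of_limsup_lt hlt] with n hn
  have e1 : (μs n : Measure (EuclideanSpace ℝ s))
      ((WithLp.ofLp : EuclideanSpace ℝ s → s → ℝ) ⁻¹' C) = Q {ω | (fun p : s => X n ω p) ∈ C} := by
    change Q.map _ _ = _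
    rw [Measure.map_apply_of_aemeasurable (hXm n) hC'.measurableSet]
    rfl
  have e2 : (μ : Measure (EuclideanSpace ℝ s))
      ((WithLp.ofLp : EuclideanSpace ℝ s → s → ℝ) ⁻¹' C) = P' {ω | (fun p : s => Y ω p) ∈ C} := by
    change P'.map _ _ = _
    rw [Measure.map_apply_of_aemeasurable hYm hC'.measurableSet]
    rfl
  rw [e1, e2] at hn
  exact hn.le

theorem measurable_sphereExp_frame {e : ∀ x : S2, Plane ≃ₗᵢ[ℝ] TangentPlane x}
    (he : ∀ y, Measurable fun x => (e x y : Space)) (c : ℝ) (y : Plane) :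
    Measurable fun x => sphereExp x (e x (c • y)) := by
  refine Measurable.subtype_mk ?_
  have h : (fun x : S2 => Real.cos ‖e x (c • y)‖ • (x : Space) +
      Real.sinc ‖e x (c • y)‖ • (e x (c • y) : Space)) = fun x : S2 =>
      Real.cos (|c| * ‖y‖) • (x : Space) + Real.sinc (|c| * ‖y‖) • (e x (c • y) : Space) := by
    ext x
    rw [norm_frame]
  rw [h]
  exact (measurable_subtype_coe.const_smul (Real.cos (|c| * ‖y‖))).add
    ((he (c • y)).const_smul (Real.sinc (|c| * ‖y‖)))

theorem aemeasurable_localField {Ω : Type*} [MeasurableSpace Ω] {P : Measure Ω} [SFinite P]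
    {n : ℕ} {Y : Idx n → S2 → ℝ} (hY : IsHarmonicONB n Y)
    {a : Idx n → Ω → ℝ} (ha_meas : ∀ k, AEMeasurable (a k) P)
    {e : ∀ x : S2, Plane ≃ₗᵢ[ℝ] TangentPlane x} (he : ∀ y, Measurable fun x => (e x y : Space))
    (R : ℝ) (y : Plane) :
    AEMeasurable (fun p : Ω × S2 => localField n R (randomHarmonic n a Y p.1) p.2 (e p.2) y)
      (P.prod rho) := by
  unfold localField randomHarmonic
  refine AEMeasurable.const_mul (Finset.aemeasurable_fun_sum _ fun k _ => ?_) _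
  refine AEMeasurable.mul ?_ ?_
  · exact (ha_meas k).comp_quasiMeasurePreserving Measure.quasiMeasurePreserving_fst
  · exact ((hY.continuous k).measurable.comp
      ((measurable_sphereExp_frame he _ y).comp measurable_snd)).aemeasurable

/-- The weights of the coefficients in a linear combination of values of the random harmonic. -/
def weight {n : ℕ} (Y : Idx n → S2 → ℝ) {ι : Type*} [Fintype ι] (t : ι → ℝ) (p : ι → S2)
    (k : Idx n) : ℝ := (√(2 * (n : ℝ) + 1))⁻¹ * ∑ i, t i * Y k (p i)

section Weights

variable {n : ℕ} {Y : Idx n → S2 → ℝ} {ι : Type*} [Fintype ι] {t : ι → ℝ} {p : ι → S2}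

theorem sum_mul_randomHarmonic {Ω : Type*} (a : Idx n → Ω → ℝ) (ω : Ω) :
    ∑ i, t i * randomHarmonic n a Y ω (p i) = ∑ k, weight Y t p k * a k ω := by
  simp only [randomHarmonic, weight, Finset.mul_sum, Finset.sum_mul]
  rw [Finset.sum_comm]
  exact Finset.sum_congr rfl fun k _ => Finset.sum_congr rfl fun i _ => by ring

theorem sum_weight_sq : ∑ k, weight Y t p k ^ 2 =
    ∑ i, ∑ j, t i * t j * (harmonicKernel Y (p i) (p j) / (2 * n + 1)) := by
  have h : ∀ k, weight Y t p k ^ 2 =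
      ∑ i, ∑ j, (2 * (n : ℝ) + 1)⁻¹ * (t i * Y k (p i) * (t j * Y k (p j))) := by
    intro k
    rw [weight, mul_pow, inv_pow, Real.sq_sqrt (by positivity), sq, Finset.sum_mul_sum,
      Finset.mul_sum]
    simp_rw [Finset.mul_sum]
  simp_rw [h, harmonicKernel, Finset.sum_div, Finset.mul_sum]
  rw [Finset.sum_comm]
  refine Finset.sum_congr rfl fun i _ => ?_
  rw [Finset.sum_comm]
  exact Finset.sum_congr rfl fun j _ => Finset.sum_congr rfl fun k _ => by
    rw [div_eq_mul_inv]; ring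

theorem abs_weight_le {ε : ℝ} (hε : 0 ≤ ε) (k : Idx n)
    (h : ∀ i, Y k (p i) ^ 2 ≤ ε * (2 * n + 1)) : |weight Y t p k| ≤ (∑ i, |t i|) * √ε := by
  have hN : (0 : ℝ) < √(2 * n + 1) := Real.sqrt_pos.2 (by positivity)
  rw [weight, abs_mul, abs_inv, abs_of_pos hN, inv_mul_le_iff₀ hN]
  calc |∑ i, t i * Y k (p i)| ≤ ∑ i, |t i| * √(ε * (2 * n + 1)) := by
        refine (Finset.abs_sum_le_sum_abs _ _).trans (Finset.sum_le_sum fun i _ => ?_)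
        rw [abs_mul]
        gcongr
        exact Real.abs_le_sqrt (h i)
    _ = √(2 * n + 1) * ((∑ i, |t i|) * √ε) := by
        rw [← Finset.sum_mul, Real.sqrt_mul hε]
        ring

end Weights

/-- The finite-dimensional distributions of the rescaled random harmonics converge to those of the
random plane wave: for most base points the weights in the sum satisfy the Lindeberg condition. -/
theorem tendsto_integral_exp_localField {Ω : Type*} [MeasurableSpace Ω] {P : Measure Ω}
    [IsProbabilityMeasure P] {Y : ∀ n : ℕ, Idx n → S2 → ℝ}
    (hY : ∀ n, IsHarmonicONB n (Y n)) {a : ∀ n : ℕ, Idx n → Ω → ℝ}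
    (ha_meas : ∀ n k, AEMeasurable (a n k) P) {e : ∀ x : S2, Plane ≃ₗᵢ[ℝ] TangentPlane x}
    (he : ∀ y, Measurable fun x => (e x y : Space))
    (ha_indep : ∀ n, iIndepFun (a n) P) {φ : ℝ → ℂ} (hφ : ∀ n k, charFun (P.map (a n k)) = φ)
    (hφc : ∀ ε > 0, ∃ η > 0, ∀ b : ℝ, |b| ≤ η →
      ‖φ b - Complex.exp ((-(b ^ 2 / 2) : ℝ))‖ ≤ ε * b ^ 2)
    {R : ℝ} (hR : 0 < R) {ι : Type*} [Fintype ι] (z : ι → Plane)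
    (hz : ∀ i, z i ∈ Metric.closedBall (0 : Plane) 2) (t : ι → ℝ) :
    Tendsto (fun n => ∫ p : Ω × S2, Complex.exp (((∑ i, t i *
        localField n R (randomHarmonic n (a n) (Y n) p.1) p.2 (e p.2) (z i) : ℝ) : ℂ) * Complex.I)
        ∂(P.prod rho)) atTop
      (𝓝 (Complex.exp ((-((∑ i, ∑ j, t i * t j * besselJ (R * ‖z i - z j‖)) / 2) : ℝ)))) := by
  set σ := ∑ i, ∑ j, t i * t j * besselJ (R * ‖z i - z j‖) with hσ
  set T := ∑ i, |t i| with hT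
  have hT0 : 0 ≤ T := Finset.sum_nonneg fun i _ => abs_nonneg _
  set c : ℂ := Complex.exp ((-(σ / 2) : ℝ)) with hc
  set L : ℝ := 1 + ‖c‖ with hL
  have hL0 : 0 < L := by positivity
  rw [Metric.tendsto_nhds]
  intro δ hδ
  -- `δ₁`: accuracy of the total variance; `η`: smallness of the weights under which the Gaussian
  -- approximation is `ε`-close; `ε'`: smallness of the basis functions that ensures it.
  have hcont : ContinuousAt (fun s : ℝ => Complex.exp ((-(s / 2) : ℝ))) σ := by fun_prop
  obtain ⟨δ₁, hδ₁, hcont⟩ := Metric.continuousAt_iff.1 hcont (δ / 4) (by positivity)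
  set ε := δ / (4 * (|σ| + δ₁)) with hε
  have hε0 : 0 < ε := by positivity
  obtain ⟨η, hη, hclose⟩ := hφc ε hε0
  set ε' := (η / (T + 1)) ^ 2 with hε'
  have hε'0 : 0 < ε' := by positivity
  have hTε : T * √ε' ≤ η := by
    rw [hε', Real.sqrt_sq (by positivity)]
    calc T * (η / (T + 1)) ≤ (T + 1) * (η / (T + 1)) := by gcongr; linarith
      _ = η := by field_simp
  have hker := eventually_kernel_close hY hR (δ := δ₁ / (2 * (T ^ 2 + 1))) (by positivity)
  have hbad := (tendsto_rho_large hY hε'0 (r := 4 * R) (by positivity)).eventually_lt_const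
    (u := ENNReal.ofReal (δ / (4 * L))) (ENNReal.ofReal_pos.2 (by positivity))
  filter_upwards [hker, hbad, eventually_ge_atTop 1,
    tendsto_natCast_atTop_atTop.eventually_ge_atTop (2 * R)] with n hker hbad hn1 hnR
  -- the exceptional base points, near which some basis function is large
  set B := toMeasurable rho {x : S2 | ∃ k, ∃ p : S2, ‖(p : Space) - x‖ ≤ 4 * R / n ∧
    ε' * (2 * n + 1) < Y n k p ^ 2} with hB
  set p : S2 → ι → S2 := fun x i => sphereExp x (e x ((R / n) • z i)) with hp
  set S : Ω × S2 → ℝ := fun w => ∑ i, t i *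
    localField n R (randomHarmonic n (a n) (Y n) w.1) w.2 (e w.2) (z i) with hS
  have hSm : AEMeasurable S (P.prod rho) :=
    Finset.aemeasurable_fun_sum _ fun i _ =>
      (aemeasurable_localField (hY n) (ha_meas n) he R (z i)).const_mul _
  have hSi : Integrable (fun w => Complex.exp ((S w : ℂ) * Complex.I)) (P.prod rho) := by
    refine Integrable.of_bound (C := 1) ?_ (Eventually.of_forall fun w => ?_)
    · exact (by fun_prop : Measurable fun s : ℝ => Complex.exp ((s : ℂ) * Complex.I)).comp_aemeasurable
        hSm |>.aestronglyMeasurable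
    · rw [Complex.norm_exp_ofReal_mul_I]
  have hSx : ∀ x ω, S (ω, x) = ∑ k, weight (Y n) t (p x) k * a n k ω := fun x ω =>
    sum_mul_randomHarmonic (p := p x) (a n) ω
  set G : S2 → ℂ := fun x => ∫ ω, Complex.exp ((S (ω, x) : ℂ) * Complex.I) ∂P with hG
  have hGi : Integrable G rho := hSi.integral_prod_right
  have hG1 : ∀ x, ‖G x‖ ≤ 1 := by
    intro x
    have := norm_integral_le_of_norm_le_const (μ := P) (C := 1)
      (f := fun ω => Complex.exp ((S (ω, x) : ℂ) * Complex.I))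
      (Eventually.of_forall fun ω => (Complex.norm_exp_ofReal_mul_I _).le)
    simpa using this
  -- the weights have total variance close to the one of the limit
  have hvar : ∀ x, |∑ k, weight (Y n) t (p x) k ^ 2 - σ| < δ₁ := by
    intro x
    rw [sum_weight_sq, hσ, ← Finset.sum_sub_distrib]
    simp_rw [← Finset.sum_sub_distrib, ← mul_sub]
    calc _ ≤ ∑ i, ∑ j, |t i| * |t j| * (δ₁ / (2 * (T ^ 2 + 1))) := by
          refine (Finset.abs_sum_le_sum_abs _ _).trans (Finset.sum_le_sum fun i _ => ?_)
          refine (Finset.abs_sum_le_sum_abs _ _).trans (Finset.sum_le_sum fun j _ => ?_)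
          rw [abs_mul, abs_mul]
          gcongr
          exact hker x (e x) (z i) (hz i) (z j) (hz j)
      _ = T ^ 2 * (δ₁ / (2 * (T ^ 2 + 1))) := by
          rw [sq, hT, Finset.sum_mul_sum, Finset.sum_mul]
          exact Finset.sum_congr rfl fun i _ => by rw [Finset.sum_mul]
      _ ≤ (T ^ 2 + 1) * (δ₁ / (2 * (T ^ 2 + 1))) := by gcongr; linarith
      _ = δ₁ / 2 := by field_simp
      _ < δ₁ := by linarith
  have hgood : ∀ x, x ∉ B → ‖G x - c‖ ≤ δ / 2 := by
    intro x hx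
    have hx' : ∀ k i, Y n k (p x i) ^ 2 ≤ ε' * (2 * n + 1) := by
      intro k i
      by_contra! hcon
      exact hx (subset_toMeasurable _ _ ⟨k, p x i,
        dist_sphereExp_center_le (e x) hR hn1 hnR (hz i), hcon⟩)
    have h1 := norm_integral_exp_sub_le (ha_indep n) (ha_meas n) (hφ n) hclose
      (b := weight (Y n) t (p x)) fun k => (abs_weight_le hε'0.le k (hx' k)).trans hTε
    simp_rw [← hSx] at h1
    have h2 := (hcont (x := ∑ k, weight (Y n) t (p x) k ^ 2) (hvar x)).le
    rw [dist_eq_norm] at h2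
    have h3 : ε * ∑ k, weight (Y n) t (p x) k ^ 2 ≤ δ / 4 := by
      have h4 := (abs_lt.1 (hvar x)).2
      calc ε * ∑ k, weight (Y n) t (p x) k ^ 2 ≤ ε * (|σ| + δ₁) := by
            gcongr
            linarith [le_abs_self σ]
        _ = δ / 4 := by rw [hε]; field_simp
    calc ‖G x - c‖ ≤ _ := norm_sub_le_norm_sub_add_norm_sub _
          (Complex.exp ((-((∑ k, weight (Y n) t (p x) k ^ 2) / 2) : ℝ))) _
      _ ≤ δ / 4 + δ / 4 := add_le_add (h1.trans h3) h2
      _ = δ / 2 := by ring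
  have hBm : MeasurableSet B := measurableSet_toMeasurable _ _
  have hall : ∀ x, ‖G x - c‖ ≤ δ / 2 + B.indicator (fun _ => L) x := by
    intro x
    by_cases hx : x ∈ B
    · rw [Set.indicator_of_mem hx]
      have := norm_sub_le (G x) c
      linarith [hG1 x]
    · rw [Set.indicator_of_notMem hx, add_zero]
      exact hgood x hx
  have hBr : rho.real B ≤ δ / (4 * L) := by
    rw [Measure.real, hB, measure_toMeasurable]
    exact ENNReal.toReal_le_of_le_ofReal (by positivity) hbad.le
  have hint : Integrable (fun x => δ / 2 + B.indicator (fun _ => L) x) rho :=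
    (integrable_const _).add ((integrable_const _).indicator hBm)
  rw [integral_prod_symm _ hSi, dist_eq_norm]
  have hsub : ∫ x, G x ∂rho - c = ∫ x, (G x - c) ∂rho := by
    rw [integral_sub hGi (integrable_const _)]
    simp
  change ‖∫ x, G x ∂rho - c‖ < δ
  rw [hsub]
  calc ‖∫ x, (G x - c) ∂rho‖ ≤ ∫ x, (δ / 2 + B.indicator (fun _ => L) x) ∂rho :=
        norm_integral_le_of_norm_le hint (Eventually.of_forall hall)
    _ = δ / 2 + rho.real B * L := by
        rw [integral_add (integrable_const _) ((integrable_const _).indicator hBm),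
          integral_indicator_const _ hBm]
        simp
    _ ≤ δ / 2 + δ / (4 * L) * L := by gcongr
    _ = 3 * δ / 4 := by field_simp; norm_num
    _ < δ := by linarith

/-! ### The algebra of functions with quadratic approximations -/

/-- Membership in the class, for a function whose values outside of the disk of radius `2` are
disregarded. -/
def IsSmooth (M : ℝ) (f : Plane → ℝ) : Prop :=
  (∀ p ∈ Metric.closedBall (0 : Plane) 2, |f p| ≤ M) ∧
    ∀ q ∈ Metric.closedBall (0 : Plane) 2, ∃ G, ‖G‖ ≤ M ∧ HasQuadApprox M f q G

section Smooth

variable {M M' : ℝ} {f g : Plane → ℝ}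

theorem HasQuadApprox.congr {q G : Plane} (h : HasQuadApprox M f q G)
    (hfg : ∀ p ∈ Metric.closedBall (0 : Plane) 2, f p = g p)
    (hq : q ∈ Metric.closedBall (0 : Plane) 2) : HasQuadApprox M g q G := by
  intro p hp
  rw [← hfg p hp, ← hfg q hq]
  exact h p hp

theorem cutoff_mem_smoothClass_iff : cutoff f ∈ smoothClass M ↔ IsSmooth M f := by
  have hc : ∀ p ∈ Metric.closedBall (0 : Plane) 2, cutoff f p = f p := fun p hp => cutoff_apply hp
  constructor
  · rintro ⟨h1, -, h3⟩
    refine ⟨fun p hp => hc p hp ▸ h1 p hp, fun q hq => ?_⟩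
    obtain ⟨G, hG, h⟩ := h3 q hq
    exact ⟨G, hG, h.congr hc hq⟩
  · rintro ⟨h1, h3⟩
    refine ⟨fun p hp => (hc p hp).symm ▸ h1 p hp, fun p hp => Set.indicator_of_notMem hp _,
      fun q hq => ?_⟩
    obtain ⟨G, hG, h⟩ := h3 q hq
    exact ⟨G, hG, h.congr (fun p hp => (hc p hp).symm) hq⟩

theorem IsSmooth.nonneg (h : IsSmooth M f) : 0 ≤ M := (abs_nonneg _).trans (h.1 0 (by simp))

theorem IsSmooth.mono (h : IsSmooth M f) (hM : M ≤ M') : IsSmooth M' f :=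
  cutoff_mem_smoothClass_iff.1 (smoothClass_mono hM (cutoff_mem_smoothClass_iff.2 h))

theorem IsSmooth.lipschitz (h : IsSmooth M f) {p q : Plane}
    (hp : p ∈ Metric.closedBall (0 : Plane) 2) (hq : q ∈ Metric.closedBall (0 : Plane) 2) :
    |f p - f q| ≤ 5 * M * ‖p - q‖ := by
  have := smoothClass_lipschitz (cutoff_mem_smoothClass_iff.2 h) hp hq
  rwa [cutoff_apply hp, cutoff_apply hq] at this

theorem isSmooth_const (c : ℝ) : IsSmooth |c| fun _ => c :=
  ⟨fun _ _ => le_rfl, fun q _ => ⟨0, by simp, fun p _ => by simp; positivity⟩⟩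

theorem IsSmooth.add (hf : IsSmooth M f) (hg : IsSmooth M' g) :
    IsSmooth (M + M') fun y => f y + g y := by
  refine ⟨fun p hp => (abs_add_le _ _).trans (add_le_add (hf.1 p hp) (hg.1 p hp)), fun q hq => ?_⟩
  obtain ⟨G, hG, h⟩ := hf.2 q hq
  obtain ⟨G', hG', h'⟩ := hg.2 q hq
  refine ⟨G + G', (norm_add_le _ _).trans (add_le_add hG hG'), fun p hp => ?_⟩
  have e : f p + g p - (f q + g q) - inner ℝ (G + G') (p - q) =
      (f p - f q - inner ℝ G (p - q)) + (g p - g q - inner ℝ G' (p - q)) := by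
    rw [inner_add_left]; ring
  rw [e, add_mul]
  exact (abs_add_le _ _).trans (add_le_add (h p hp) (h' p hp))

/-- The class is stable under products, up to a universal constant. -/
theorem IsSmooth.mul (hf : IsSmooth M f) (hg : IsSmooth M' g) :
    IsSmooth (27 * M * M') fun y => f y * g y := by
  have hM := hf.nonneg
  have hM' := hg.nonneg
  have hMM : 0 ≤ M * M' := mul_nonneg hM hM'
  refine ⟨fun p hp => ?_, fun q hq => ?_⟩
  · rw [abs_mul]
    have := mul_le_mul (hf.1 p hp) (hg.1 p hp) (abs_nonneg _) hM
    nlinarith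
  · obtain ⟨G, hG, h⟩ := hf.2 q hq
    obtain ⟨G', hG', h'⟩ := hg.2 q hq
    refine ⟨f q • G' + g q • G, ?_, fun p hp => ?_⟩
    · refine (norm_add_le _ _).trans ?_
      rw [norm_smul, norm_smul, Real.norm_eq_abs, Real.norm_eq_abs]
      have h1 := mul_le_mul (hf.1 q hq) hG' (norm_nonneg _) hM
      have h2 := mul_le_mul (hg.1 q hq) hG (norm_nonneg _) hM'
      nlinarith
    · have e : f p * g p - f q * g q - inner ℝ (f q • G' + g q • G) (p - q) =
          f q * (g p - g q - inner ℝ G' (p - q)) + g q * (f p - f q - inner ℝ G (p - q)) +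
            (f p - f q) * (g p - g q) := by
        rw [inner_add_left, inner_smul_left, inner_smul_left]
        simp only [conj_trivial]
        ring
      rw [e]
      have h1 : |f q * (g p - g q - inner ℝ G' (p - q))| ≤ M * (M' * ‖p - q‖ ^ 2) := by
        rw [abs_mul]
        exact mul_le_mul (hf.1 q hq) (h' p hp) (abs_nonneg _) hM
      have h2 : |g q * (f p - f q - inner ℝ G (p - q))| ≤ M' * (M * ‖p - q‖ ^ 2) := by
        rw [abs_mul]
        exact mul_le_mul (hg.1 q hq) (h p hp) (abs_nonneg _) hM'
      have h3 : |(f p - f q) * (g p - g q)| ≤ (5 * M * ‖p - q‖) * (5 * M' * ‖p - q‖) := by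
        rw [abs_mul]
        exact mul_le_mul (hf.lipschitz hp hq) (hg.lipschitz hp hq) (abs_nonneg _) (by positivity)
      calc _ ≤ M * (M' * ‖p - q‖ ^ 2) + M' * (M * ‖p - q‖ ^ 2) +
            (5 * M * ‖p - q‖) * (5 * M' * ‖p - q‖) :=
            (abs_add_le _ _).trans (add_le_add ((abs_add_le _ _).trans (add_le_add h1 h2)) h3)
        _ = 27 * M * M' * ‖p - q‖ ^ 2 := by ring

theorem IsSmooth.const_mul (hf : IsSmooth M f) (c : ℝ) : IsSmooth (|c| * M) fun y => c * f y := by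
  refine ⟨fun p hp => ?_, fun q hq => ?_⟩
  · rw [abs_mul]
    exact mul_le_mul_of_nonneg_left (hf.1 p hp) (abs_nonneg c)
  · obtain ⟨G, hG, h⟩ := hf.2 q hq
    refine ⟨c • G, ?_, fun p hp => ?_⟩
    · rw [norm_smul, Real.norm_eq_abs]
      exact mul_le_mul_of_nonneg_left hG (abs_nonneg c)
    · have e : c * f p - c * f q - inner ℝ (c • G) (p - q) =
          c * (f p - f q - inner ℝ G (p - q)) := by
        rw [inner_smul_left]
        simp only [conj_trivial]
        ring
      rw [e, abs_mul, mul_assoc]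
      exact mul_le_mul_of_nonneg_left (h p hp) (abs_nonneg c)

theorem IsSmooth.sum {ι : Type*} (s : Finset ι) {M : ι → ℝ} {f : ι → Plane → ℝ}
    (h : ∀ i ∈ s, IsSmooth (M i) (f i)) : IsSmooth (∑ i ∈ s, M i) fun y => ∑ i ∈ s, f i y := by
  classical
  induction s using Finset.induction_on with
  | empty => simpa using isSmooth_const 0
  | insert a s ha ih =>
    simp only [Finset.sum_insert ha]
    exact (h a (Finset.mem_insert_self a s)).add
      (ih fun i hi => h i (Finset.mem_insert_of_mem hi))

theorem IsSmooth.pow (hf : IsSmooth M f) (j : ℕ) : IsSmooth ((27 * M) ^ j) fun y => f y ^ j := by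
  induction j with
  | zero => simpa using isSmooth_const 1
  | succ j ih =>
    have := hf.mul ih
    simp only [pow_succ']
    exact this

theorem isSmooth_norm_sq : IsSmooth 4 fun y : Plane => ‖y‖ ^ 2 := by
  refine ⟨fun p hp => ?_, fun q hq => ⟨(2 : ℝ) • q, ?_, fun p _ => ?_⟩⟩
  · rw [mem_closedBall_zero_iff] at hp
    rw [abs_of_nonneg (by positivity)]
    nlinarith [norm_nonneg p]
  · rw [mem_closedBall_zero_iff] at hq
    rw [norm_smul, Real.norm_ofNat]
    linarith
  · have e : ‖p‖ ^ 2 - ‖q‖ ^ 2 - inner ℝ ((2 : ℝ) • q) (p - q) = ‖p - q‖ ^ 2 := by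
      rw [norm_sub_sq_real, inner_smul_left, inner_sub_right, real_inner_self_eq_norm_sq,
        real_inner_comm p q]
      simp only [conj_trivial]
      ring
    rw [e, abs_of_nonneg (by positivity)]
    nlinarith [sq_nonneg ‖p - q‖]

/-- Linear functionals belong to the class. -/
theorem isSmooth_linear (ℓ : Plane →L[ℝ] ℝ) (h : ‖ℓ‖ ≤ 1) : IsSmooth 2 ℓ := by
  refine ⟨fun p hp => ?_, fun q _ => ⟨(InnerProductSpace.toDual ℝ Plane).symm ℓ, ?_, fun p _ => ?_⟩⟩
  · rw [mem_closedBall_zero_iff] at hp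
    have h1 := ℓ.le_opNorm p
    rw [Real.norm_eq_abs] at h1
    nlinarith [norm_nonneg p]
  · rw [LinearIsometryEquiv.norm_map]
    linarith
  · rw [InnerProductSpace.toDual_symm_apply, map_sub, sub_self, abs_zero]
    positivity

/-- The class is closed under pointwise limits. -/
theorem isSmooth_of_tendsto {F : ℕ → Plane → ℝ} (h : ∀ j, IsSmooth M (F j))
    (hlim : ∀ y, Tendsto (fun j => F j y) atTop (𝓝 (f y))) : IsSmooth M f := by
  rw [← cutoff_mem_smoothClass_iff]
  refine (isCompact_smoothClass M).isClosed.mem_of_tendsto (f := fun j => cutoff (F j))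
    (b := atTop) (tendsto_pi_nhds.2 fun y => ?_)
    (Eventually.of_forall fun j => cutoff_mem_smoothClass_iff.2 (h j))
  by_cases hy : y ∈ Metric.closedBall (0 : Plane) 2
  · simp only [cutoff_apply hy]
    exact hlim y
  · have h0 : ∀ g : Plane → ℝ, cutoff g y = 0 := fun g => Set.indicator_of_notMem hy _
    simp only [h0]
    exact tendsto_const_nhds

/-- The function `sinc (s ‖y‖)` belongs to the class, by its power series in `‖y‖²`. -/
theorem isSmooth_sinc {s R : ℝ} (hs : 0 ≤ s) (hsR : s ≤ R) :
    IsSmooth (Real.exp (108 * R ^ 2)) fun y : Plane => Real.sinc (s * ‖y‖) := by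
  set F : ℕ → Plane → ℝ := fun N y =>
    ∑ j ∈ Finset.range N, ((-1) ^ j * s ^ (2 * j) / (2 * j + 1).factorial) * (‖y‖ ^ 2) ^ j with hF
  refine isSmooth_of_tendsto (F := F) (fun N => ?_) fun y => ?_
  · have h1 : IsSmooth (∑ j ∈ Finset.range N,
        |(-1) ^ j * s ^ (2 * j) / (2 * j + 1).factorial| * (27 * 4) ^ j) (F N) :=
      IsSmooth.sum _ fun j _ => (isSmooth_norm_sq.pow j).const_mul _
    refine h1.mono ?_
    calc _ ≤ ∑ j ∈ Finset.range N, (108 * R ^ 2) ^ j / j.factorial := by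
          refine Finset.sum_le_sum fun j _ => ?_
          rw [abs_div, abs_mul, abs_pow, abs_neg, abs_one, one_pow, one_mul,
            abs_of_nonneg (by positivity), Nat.abs_cast, div_mul_eq_mul_div]
          have e : s ^ (2 * j) * (27 * 4) ^ j = (108 * s ^ 2) ^ j := by
            rw [pow_mul, ← mul_pow]
            congr 1
            ring
          rw [e]
          gcongr
          omega
      _ ≤ Real.exp (108 * R ^ 2) := Real.sum_le_exp_of_nonneg (by positivity) N
  · rcases eq_or_ne (s * ‖y‖) 0 with h0 | h0
    · rw [h0, Real.sinc_zero]
      refine tendsto_const_nhds.congr' ?_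
      filter_upwards [eventually_ge_atTop 1] with N hN
      have h1 : ∀ j ∈ Finset.range N, j ≠ 0 →
          ((-1) ^ j * s ^ (2 * j) / (2 * j + 1).factorial) * (‖y‖ ^ 2) ^ j = 0 := by
        intro j _ hj
        have : s ^ (2 * j) * (‖y‖ ^ 2) ^ j = 0 := by
          rw [pow_mul, ← mul_pow, ← mul_pow, h0]
          simp [hj]
        rw [div_mul_eq_mul_div, mul_assoc, this]
        simp
      simp only [hF]
      rw [Finset.sum_eq_single_of_mem 0 (Finset.mem_range.2 hN) h1]
      simp
    · have h1 := (Real.hasSum_sin (s * ‖y‖)).div_const (s * ‖y‖)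
      rw [Real.sinc_of_ne_zero h0]
      refine h1.tendsto_sum_nat.congr fun N => Finset.sum_congr rfl fun j _ => ?_
      have hs0 : s ≠ 0 := left_ne_zero_of_mul h0
      have hy0 : ‖y‖ ≠ 0 := right_ne_zero_of_mul h0
      field_simp
      ring

end Smooth

/-! ### Derivatives of random harmonic polynomials -/

section Taylor

open MvPolynomial

/-- The sum of the absolute values at `x` of all partial derivatives of order `m`, indexed by
`m`-tuples of coordinates. -/
def derivSum : ℕ → MvPolynomial (Fin 3) ℝ → Space → ℝ
  | 0, p, x => |polyEval p x|
  | m + 1, p, x => ∑ i, derivSum m (pderiv i p) x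

/-- The sum of the squares at `x` of all partial derivatives of order `m`, indexed by `m`-tuples
of coordinates. -/
def derivSqSum : ℕ → MvPolynomial (Fin 3) ℝ → Space → ℝ
  | 0, p, x => polyEval p x ^ 2
  | m + 1, p, x => ∑ i, derivSqSum m (pderiv i p) x

/-- The `m`-th derivative at `x` in the direction `w`. -/
def dirDeriv : ℕ → MvPolynomial (Fin 3) ℝ → Space → Space → ℝ
  | 0, p, x, _ => polyEval p x
  | m + 1, p, x, w => ∑ i, w i * dirDeriv m (pderiv i p) x w

theorem derivSum_nonneg (m : ℕ) (p : MvPolynomial (Fin 3) ℝ) (x : Space) : 0 ≤ derivSum m p x := by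
  induction m generalizing p with
  | zero => exact abs_nonneg _
  | succ m ih => exact Finset.sum_nonneg fun i _ => ih _

/-- Taylor's formula for a homogeneous polynomial. -/
theorem polyEval_add_smul {d : ℕ} {p : MvPolynomial (Fin 3) ℝ} (hp : p.IsHomogeneous d)
    (x w : Space) (t : ℝ) : polyEval p (x + t • w) =
      ∑ m ∈ Finset.range (d + 1), t ^ m / m.factorial * dirDeriv m p x w := by
  induction d generalizing p t with
  | zero =>
    have h := totalDegree_eq_zero_iff_eq_C.1 ((totalDegree_zero_iff_isHomogeneous _).2 hp)
    rw [h]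
    simp [dirDeriv, polyEval_C]
  | succ d ih =>
    set g : ℝ → ℝ := fun s => polyEval p (x + s • w) -
      ∑ m ∈ Finset.range (d + 2), s ^ m / m.factorial * dirDeriv m p x w with hg
    have hder : ∀ s, HasDerivAt g 0 s := by
      intro s
      have h1 := hasDerivAt_polyEval p (γ := fun s => x + s • w) (γ' := w) (t := s) fun i => by
        simpa using ((hasDerivAt_id s).mul_const (w i)).const_add (x i)
      have h2 : HasDerivAt (fun s : ℝ =>
          ∑ m ∈ Finset.range (d + 2), s ^ m / m.factorial * dirDeriv m p x w)
          (∑ m ∈ Finset.range (d + 1), s ^ m / m.factorial * dirDeriv (m + 1) p x w) s := by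
        have h3 : ∀ m : ℕ, HasDerivAt (fun s : ℝ =>
            s ^ (m + 1) / (m + 1).factorial * dirDeriv (m + 1) p x w)
            (s ^ m / m.factorial * dirDeriv (m + 1) p x w) s := by
          intro m
          refine (((hasDerivAt_pow (m + 1) s).div_const _).mul_const _).congr_deriv ?_
          rw [Nat.factorial_succ]
          push_cast
          have : (m.factorial : ℝ) ≠ 0 := by positivity
          have : (m : ℝ) + 1 ≠ 0 := by positivity
          field_simp
        have h4 := (HasDerivAt.fun_sum (u := Finset.range (d + 1)) fun m _ => h3 m).add_const
          (dirDeriv 0 p x w)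
        refine h4.congr_of_eventuallyEq (Eventually.of_forall fun r => ?_)
        change ∑ m ∈ Finset.range (d + 1 + 1), r ^ m / m.factorial * dirDeriv m p x w = _
        rw [Finset.sum_range_succ']
        simp
      refine (h1.sub h2).congr_deriv ?_
      have h5 : ∀ i, polyEval (pderiv i p) (x + s • w) =
          ∑ m ∈ Finset.range (d + 1), s ^ m / m.factorial * dirDeriv m (pderiv i p) x w :=
        fun i => ih (by simpa using hp.pderiv (i := i)) s
      simp only [h5, dirDeriv, Finset.mul_sum]
      rw [Finset.sum_comm, sub_eq_zero]
      exact Finset.sum_congr rfl fun m _ => Finset.sum_congr rfl fun i _ => by ring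
    have hconst := is_const_of_deriv_eq_zero (fun s => (hder s).differentiableAt)
      (fun s => (hder s).deriv) t 0
    have h0 : g 0 = 0 := by
      simp only [hg]
      rw [Finset.sum_range_succ']
      simp [dirDeriv]
    rw [h0] at hconst
    exact sub_eq_zero.1 hconst

/-- The factor `27` per order comes from the constant in the product estimate. -/
theorem isSmooth_dirDeriv {C0 : ℝ} {u : Plane → Space} (hu : ∀ i, IsSmooth C0 fun y => u y i)
    (m : ℕ) (p : MvPolynomial (Fin 3) ℝ) (x : Space) :
    IsSmooth ((27 * C0) ^ m * derivSum m p x) fun y => dirDeriv m p x (u y) := by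
  induction m generalizing p with
  | zero => simpa [derivSum, dirDeriv] using isSmooth_const (polyEval p x)
  | succ m ih =>
    have h := IsSmooth.sum Finset.univ fun i _ => (hu i).mul (ih (pderiv i p))
    refine h.mono (le_of_eq ?_)
    simp only [derivSum, Finset.mul_sum]
    exact Finset.sum_congr rfl fun i _ => by ring

end Taylor

section Laplacian

open MvPolynomial

/-- The polynomial `x₀² + x₁² + x₂²`. -/
def normSqPoly : MvPolynomial (Fin 3) ℝ := ∑ i, X i ^ 2

theorem polyEval_normSqPoly (x : Space) : polyEval normSqPoly x = ‖x‖ ^ 2 := by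
  rw [EuclideanSpace.norm_sq_eq]
  simp [polyEval, normSqPoly, Fin.sum_univ_three]

theorem pderiv_normSqPoly (i : Fin 3) : pderiv i normSqPoly = 2 * X i := by
  rw [normSqPoly, map_sum, Finset.sum_eq_single i]
  · rw [pderiv_pow, pderiv_X_self]; norm_num
  · intro j _ hj
    rw [pderiv_pow, pderiv_X_of_ne hj, mul_zero]
  · simp

theorem pderiv_normSqPoly_pow (i : Fin 3) (a : ℕ) : pderiv i (normSqPoly ^ (a + 1)) =
    (2 * ((a : MvPolynomial (Fin 3) ℝ) + 1)) * (normSqPoly ^ a * X i) := by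
  rw [pderiv_pow, pderiv_normSqPoly]
  simp only [Nat.add_sub_cancel]
  push_cast
  ring

theorem polyLaplacian_normSqPoly_pow (a : ℕ) : polyLaplacian (normSqPoly ^ (a + 1)) =
    (2 * ((a : MvPolynomial (Fin 3) ℝ) + 1) * (2 * a + 3)) * normSqPoly ^ a := by
  have hc : ∀ i : Fin 3, pderiv i (2 * ((a : MvPolynomial (Fin 3) ℝ) + 1)) = 0 := by
    intro i
    have : (2 * ((a : MvPolynomial (Fin 3) ℝ) + 1)) = C (2 * ((a : ℝ) + 1)) := by
      simp only [C_mul, C_add, map_natCast, map_ofNat, map_one]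
    rw [this, pderiv_C]
  have h : ∀ i : Fin 3, pderiv i (pderiv i (normSqPoly ^ (a + 1))) =
      (2 * ((a : MvPolynomial (Fin 3) ℝ) + 1)) *
        (pderiv i (normSqPoly ^ a) * X i + normSqPoly ^ a) := by
    intro i
    rw [pderiv_normSqPoly_pow, pderiv_mul, hc, pderiv_mul, pderiv_X_self]
    ring
  simp only [polyLaplacian, h, ← Finset.mul_sum, Finset.sum_add_distrib]
  cases a with
  | zero => simp
  | succ a =>
    simp only [pderiv_normSqPoly_pow, mul_assoc, ← Finset.mul_sum, ← sq]
    have e : ∑ i : Fin 3, (X i : MvPolynomial (Fin 3) ℝ) ^ 2 = normSqPoly := rfl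
    rw [e]
    simp only [Finset.sum_const, Finset.card_univ, Fintype.card_fin, nsmul_eq_mul]
    push_cast
    ring

theorem pderiv_comm (i j : Fin 3) (p : MvPolynomial (Fin 3) ℝ) :
    pderiv i (pderiv j p) = pderiv j (pderiv i p) := by
  let D : Fin 3 → Derivation ℝ (MvPolynomial (Fin 3) ℝ) (MvPolynomial (Fin 3) ℝ) :=
    fun i => pderiv i
  have h : ⁅D i, D j⁆ = 0 := by
    refine derivation_ext fun k => ?_
    rw [Derivation.commutator_apply]
    simp only [D]
    rw [pderiv_X, pderiv_X, Pi.single_apply, Pi.single_apply]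
    split_ifs <;> simp
  have := congrArg (fun D : Derivation ℝ (MvPolynomial (Fin 3) ℝ)
    (MvPolynomial (Fin 3) ℝ) => D p) h
  simp only [Derivation.commutator_apply, Derivation.zero_apply, D] at this
  exact sub_eq_zero.1 this

theorem polyLaplacian_pderiv {p : MvPolynomial (Fin 3) ℝ} (hp : polyLaplacian p = 0) (i : Fin 3) :
    polyLaplacian (pderiv i p) = 0 := by
  have : polyLaplacian (pderiv i p) = pderiv i (polyLaplacian p) := by
    simp only [polyLaplacian, map_sum]
    exact Finset.sum_congr rfl fun j _ => by rw [pderiv_comm j i, pderiv_comm j i]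
  rw [this, hp, map_zero]

theorem polyLaplacian_sq {p : MvPolynomial (Fin 3) ℝ} (hp : polyLaplacian p = 0) :
    polyLaplacian (p ^ 2) = 2 * ∑ i, pderiv i p ^ 2 := by
  have h : ∀ i, pderiv i (pderiv i (p ^ 2)) =
      2 * (pderiv i p ^ 2) + 2 * (p * pderiv i (pderiv i p)) := by
    intro i
    rw [sq p, pderiv_mul, map_add, pderiv_mul, pderiv_mul]
    ring
  simp only [polyLaplacian, h, Finset.sum_add_distrib, ← Finset.mul_sum]
  rw [polyLaplacian] at hp
  rw [hp]
  ring

/-- For harmonic polynomials the Laplacian of the sum of the squares is twice the sum of the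
squares of the first derivatives. Iterating this identity, starting from a multiple of a power of
the squared norm, bounds the derivatives of all orders. -/
theorem sum_derivSqSum_le {n : ℕ} (m : ℕ) {ι : Type} [Fintype ι] {q : ι → MvPolynomial (Fin 3) ℝ}
    (hq : ∀ k, polyLaplacian (q k) = 0) {c : ℝ} (hc : 0 ≤ c) {a : ℕ} (ha : a ≤ n)
    (hs : ∑ k, q k ^ 2 = C c * normSqPoly ^ a) {x : Space} (hx : ‖x‖ = 1) :
    ∑ k, derivSqSum m (q k) x ≤ c * ((n : ℝ) * (2 * n + 1)) ^ m := by
  induction m generalizing ι c a with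
  | zero =>
    have := congrArg (fun p => polyEval p x) hs
    simp only [polyEval_sum, polyEval_mul, polyEval_C] at this
    have e : ∀ (p : MvPolynomial (Fin 3) ℝ) (j : ℕ), polyEval (p ^ j) x = polyEval p x ^ j :=
      fun p j => map_pow _ _ _
    simp only [e, polyEval_normSqPoly, hx, one_pow, mul_one] at this
    simp [derivSqSum, this]
  | succ m ih =>
    have hL : (2 : MvPolynomial (Fin 3) ℝ) * ∑ r : ι × Fin 3, pderiv r.2 (q r.1) ^ 2 =
        C c * polyLaplacian (normSqPoly ^ a) := by
      have h1 : polyLaplacian (∑ k, q k ^ 2) = ∑ k, polyLaplacian (q k ^ 2) := by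
        simp only [polyLaplacian, map_sum]
        rw [Finset.sum_comm]
      have h2 : polyLaplacian (C c * normSqPoly ^ a) = C c * polyLaplacian (normSqPoly ^ a) := by
        simp only [polyLaplacian, pderiv_C_mul, Finset.mul_sum]
      rw [← h2, ← hs, h1, Fintype.sum_prod_type, Finset.mul_sum]
      exact Finset.sum_congr rfl fun k _ => (polyLaplacian_sq (hq k)).symm
    have h2 : (2 : MvPolynomial (Fin 3) ℝ) ≠ 0 := two_ne_zero
    -- the Laplacian of `c ‖x‖ ^ (2 a)` is `2 c a (2 a + 1) ‖x‖ ^ (2 (a - 1))`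
    have key : ∃ b ≤ n, ∑ r : ι × Fin 3, pderiv r.2 (q r.1) ^ 2 =
        C (c * ((a : ℝ) * (2 * a + 1))) * normSqPoly ^ b := by
      cases a with
      | zero =>
        refine ⟨0, Nat.zero_le _, mul_left_cancel₀ h2 ?_⟩
        rw [hL]
        simp [polyLaplacian]
      | succ a =>
        refine ⟨a, by omega, mul_left_cancel₀ h2 ?_⟩
        rw [hL, polyLaplacian_normSqPoly_pow]
        simp only [C_mul, C_add, map_natCast, map_ofNat, map_one]
        push_cast
        ring
    obtain ⟨b, hb, hsum⟩ := key
    have := ih (q := fun r : ι × Fin 3 => pderiv r.2 (q r.1))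
      (fun r => polyLaplacian_pderiv (hq r.1) r.2) (by positivity) hb hsum
    rw [Fintype.sum_prod_type] at this
    refine this.trans ?_
    have han : (a : ℝ) ≤ n := by exact_mod_cast ha
    rw [pow_succ', ← mul_assoc c ((n : ℝ) * (2 * n + 1))]
    have : c * ((a : ℝ) * (2 * a + 1)) ≤ c * ((n : ℝ) * (2 * n + 1)) := by gcongr
    exact mul_le_mul_of_nonneg_right this
      (pow_nonneg (show (0 : ℝ) ≤ (n : ℝ) * (2 * n + 1) by positivity) m)

end Laplacian

section RandomPolynomial

open MvPolynomial

variable {ι : Type} [Fintype ι] {W : Type*} [MeasurableSpace W] {μ : Measure W}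

/-- The linear combination of a family of polynomials with given coefficients. -/
def polyComb (α : ι → ℝ) (q : ι → MvPolynomial (Fin 3) ℝ) : MvPolynomial (Fin 3) ℝ :=
  ∑ k, C (α k) * q k

theorem polyEval_polyComb (α : ι → ℝ) (q : ι → MvPolynomial (Fin 3) ℝ) (x : Space) :
    polyEval (polyComb α q) x = ∑ k, α k * polyEval (q k) x := by
  simp only [polyComb, polyEval_sum, polyEval_mul, polyEval_C]

theorem pderiv_polyComb (i : Fin 3) (α : ι → ℝ) (q : ι → MvPolynomial (Fin 3) ℝ) :
    pderiv i (polyComb α q) = polyComb α fun k => pderiv i (q k) := by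
  simp only [polyComb, map_sum, pderiv_C_mul]

theorem isHomogeneous_polyComb {n : ℕ} (α : ι → ℝ) {q : ι → MvPolynomial (Fin 3) ℝ}
    (hq : ∀ k, (q k).IsHomogeneous n) : (polyComb α q).IsHomogeneous n := by
  refine IsHomogeneous.sum _ _ _ fun k _ => ?_
  simpa using (isHomogeneous_C (Fin 3) (α k)).mul (hq k)

theorem aemeasurable_derivSum {α : ι → W → ℝ} (hα : ∀ k, AEMeasurable (α k) μ) {ξ : W → Space}
    (hξ : AEMeasurable ξ μ) (m : ℕ) (q : ι → MvPolynomial (Fin 3) ℝ) :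
    AEMeasurable (fun w => derivSum m (polyComb (fun k => α k w) q) (ξ w)) μ := by
  induction m generalizing q with
  | zero =>
    simp only [derivSum, polyEval_polyComb]
    refine AEMeasurable.abs (Finset.aemeasurable_fun_sum _ fun k _ => (hα k).mul ?_)
    exact (continuous_polyEval _).measurable.comp_aemeasurable hξ
  | succ m ih =>
    simp only [derivSum, pderiv_polyComb]
    exact Finset.aemeasurable_fun_sum _ fun i _ => ih _

/-- The second moment of the derivatives of a combination with orthonormal random coefficients. -/
theorem lintegral_derivSum_sq_le [DecidableEq ι] {α : ι → W → ℝ} (hα : ∀ k, AEMeasurable (α k) μ)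
    (hint : ∀ k l, Integrable (fun w => α k w * α l w) μ)
    (hort : ∀ k l, ∫ w, α k w * α l w ∂μ = if k = l then 1 else 0)
    (m : ℕ) (q : ι → MvPolynomial (Fin 3) ℝ) (x : Space) :
    ∫⁻ w, ENNReal.ofReal (derivSum m (polyComb (fun k => α k w) q) x ^ 2) ∂μ ≤
      ENNReal.ofReal (3 ^ m * ∑ k, derivSqSum m (q k) x) := by
  induction m generalizing q with
  | zero =>
    simp only [derivSum, derivSqSum, polyEval_polyComb, sq_abs, pow_zero, one_mul]
    have e : ∀ w, (∑ k, α k w * polyEval (q k) x) ^ 2 =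
        ∑ k, ∑ l, polyEval (q k) x * polyEval (q l) x * (α k w * α l w) := by
      intro w
      rw [sq, Finset.sum_mul_sum]
      exact Finset.sum_congr rfl fun k _ => Finset.sum_congr rfl fun l _ => by ring
    have hi1 : ∀ k, ∀ l ∈ Finset.univ, Integrable
        (fun w => polyEval (q k) x * polyEval (q l) x * (α k w * α l w)) μ :=
      fun k l _ => (hint k l).const_mul _
    have hi2 : ∀ k ∈ Finset.univ, Integrable
        (fun w => ∑ l, polyEval (q k) x * polyEval (q l) x * (α k w * α l w)) μ :=
      fun k _ => integrable_finsetSum _ (hi1 k)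
    have hi3 : Integrable (fun w => (∑ k, α k w * polyEval (q k) x) ^ 2) μ := by
      simp only [e]
      exact integrable_finsetSum _ hi2
    rw [← ofReal_integral_eq_lintegral_ofReal hi3 (Eventually.of_forall fun w => sq_nonneg _)]
    refine ENNReal.ofReal_le_ofReal (le_of_eq ?_)
    simp only [e]
    rw [integral_finsetSum _ hi2]
    refine Finset.sum_congr rfl fun k _ => ?_
    rw [integral_finsetSum _ (hi1 k)]
    simp only [integral_const_mul, hort]
    simp [sq]
  | succ m ih =>
    simp only [derivSum, derivSqSum, pderiv_polyComb]
    have hm : ∀ i ∈ (Finset.univ : Finset (Fin 3)), AEMeasurable (fun w => ENNReal.ofReal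
        (derivSum m (polyComb (fun k => α k w) fun k => pderiv i (q k)) x ^ 2)) μ := fun i _ =>
      ((aemeasurable_derivSum hα aemeasurable_const m _).pow_const 2).ennreal_ofReal
    calc ∫⁻ w, ENNReal.ofReal
          ((∑ i, derivSum m (polyComb (fun k => α k w) fun k => pderiv i (q k)) x) ^ 2) ∂μ
        ≤ ∫⁻ w, ENNReal.ofReal 3 * ∑ i, ENNReal.ofReal
          (derivSum m (polyComb (fun k => α k w) fun k => pderiv i (q k)) x ^ 2) ∂μ := by
          refine lintegral_mono fun w => ?_
          rw [← ENNReal.ofReal_sum_of_nonneg fun i _ => sq_nonneg _,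
            ← ENNReal.ofReal_mul (by norm_num)]
          refine ENNReal.ofReal_le_ofReal ?_
          have := sq_sum_le_card_mul_sum_sq (s := (Finset.univ : Finset (Fin 3)))
            (f := fun i => derivSum m (polyComb (fun k => α k w) fun k => pderiv i (q k)) x)
          simpa using this
      _ = ENNReal.ofReal 3 * ∑ i, ∫⁻ w, ENNReal.ofReal
          (derivSum m (polyComb (fun k => α k w) fun k => pderiv i (q k)) x ^ 2) ∂μ := by
          rw [lintegral_const_mul'' _ (Finset.aemeasurable_fun_sum _ hm), lintegral_finsetSum' _ hm]
      _ ≤ ENNReal.ofReal 3 * ∑ i : Fin 3, ENNReal.ofReal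
          (3 ^ m * ∑ k, derivSqSum m (pderiv i (q k)) x) := by
          gcongr with i
          exact ih _
      _ = _ := by
          have hn : ∀ (m : ℕ) (p : MvPolynomial (Fin 3) ℝ), 0 ≤ derivSqSum m p x := by
            intro m
            induction m with
            | zero => exact fun p => sq_nonneg _
            | succ m ih => exact fun p => Finset.sum_nonneg fun i _ => ih _
          rw [← ENNReal.ofReal_sum_of_nonneg fun i _ =>
            mul_nonneg (by positivity) (Finset.sum_nonneg fun k _ => hn _ _),
            ← ENNReal.ofReal_mul (by norm_num), ← Finset.mul_sum, ← mul_assoc, ← pow_succ',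
            Finset.sum_comm]

/-- The derivatives of order `m` of a random spherical harmonic are of order `n ^ m` in mean. -/
theorem lintegral_derivSum_le [DecidableEq ι] [IsProbabilityMeasure μ] {α : ι → W → ℝ}
    (hα : ∀ k, AEMeasurable (α k) μ)
    (hint : ∀ k l, Integrable (fun w => α k w * α l w) μ)
    (hort : ∀ k l, ∫ w, α k w * α l w ∂μ = if k = l then 1 else 0) {n : ℕ} (hn : 1 ≤ n)
    {q : ι → MvPolynomial (Fin 3) ℝ} (hq : ∀ k, polyLaplacian (q k) = 0)
    (hs : ∑ k, q k ^ 2 = normSqPoly ^ n) {x : Space} (hx : ‖x‖ = 1) (m : ℕ) :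
    ∫⁻ w, ENNReal.ofReal (derivSum m (polyComb (fun k => α k w) q) x) ∂μ ≤
      ENNReal.ofReal ((3 * (n : ℝ)) ^ m) := by
  have hn1 : (1 : ℝ) ≤ n := by exact_mod_cast hn
  set c : ℝ := (3 * (n : ℝ)) ^ m with hc
  have hc0 : 0 < c := by positivity
  have h1 : ∫⁻ w, ENNReal.ofReal (derivSum m (polyComb (fun k => α k w) q) x ^ 2) ∂μ ≤
      ENNReal.ofReal (c ^ 2) := by
    refine (lintegral_derivSum_sq_le hα hint hort m q x).trans (ENNReal.ofReal_le_ofReal ?_)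
    have := sum_derivSqSum_le m hq zero_le_one le_rfl (by simpa using hs) hx
    rw [one_mul] at this
    calc (3 : ℝ) ^ m * ∑ k, derivSqSum m (q k) x ≤ 3 ^ m * ((n : ℝ) * (2 * n + 1)) ^ m := by gcongr
      _ = (3 * ((n : ℝ) * (2 * n + 1))) ^ m := (mul_pow _ _ _).symm
      _ ≤ ((3 * (n : ℝ)) ^ 2) ^ m := by
          gcongr
          nlinarith
      _ = c ^ 2 := by rw [hc, ← pow_mul, ← pow_mul, mul_comm 2 m]
  have hm := (((aemeasurable_derivSum hα (ξ := fun _ => x) aemeasurable_const m q).pow_const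
    2).ennreal_ofReal)
  calc _ ≤ ∫⁻ w, (ENNReal.ofReal (1 / (2 * c)) *
        ENNReal.ofReal (derivSum m (polyComb (fun k => α k w) q) x ^ 2) +
          ENNReal.ofReal (c / 2)) ∂μ := by
        refine lintegral_mono fun w => ?_
        rw [← ENNReal.ofReal_mul (by positivity), ← ENNReal.ofReal_add (by positivity)
          (by positivity)]
        refine ENNReal.ofReal_le_ofReal ?_
        -- the arithmetic-geometric mean inequality
        set f := derivSum m (polyComb (fun k => α k w) q) x
        have e : 1 / (2 * c) * f ^ 2 + c / 2 - f = (f - c) ^ 2 / (2 * c) := by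
          field_simp
          ring
        have : 0 ≤ (f - c) ^ 2 / (2 * c) := by positivity
        linarith
    _ = ENNReal.ofReal (1 / (2 * c)) *
        ∫⁻ w, ENNReal.ofReal (derivSum m (polyComb (fun k => α k w) q) x ^ 2) ∂μ +
          ENNReal.ofReal (c / 2) := by
        rw [lintegral_add_right _ measurable_const, lintegral_const_mul'' _ hm]
        simp
    _ ≤ ENNReal.ofReal (1 / (2 * c)) * ENNReal.ofReal (c ^ 2) + ENNReal.ofReal (c / 2) := by
        gcongr
    _ = _ := by
        rw [← ENNReal.ofReal_mul (by positivity), ← ENNReal.ofReal_add (by positivity)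
          (by positivity)]
        congr 1
        field_simp
        ring

end RandomPolynomial

section HarmonicPolynomial

open MvPolynomial

/-- The elements of an orthonormal basis, divided by `√(2n+1)`, are the restrictions of harmonic
polynomials whose squares add up to a power of the squared norm. -/
theorem IsHarmonicONB.exists_poly {n : ℕ} {Y : Idx n → S2 → ℝ} (hY : IsHarmonicONB n Y)
    (hn : 1 ≤ n) : ∃ q : Idx n → MvPolynomial (Fin 3) ℝ, (∀ k, (q k).IsHomogeneous n) ∧
      (∀ k, polyLaplacian (q k) = 0) ∧ ∑ k, q k ^ 2 = normSqPoly ^ n ∧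
      ∀ k (x : S2), polyEval (q k) x = (√(2 * (n : ℝ) + 1))⁻¹ * Y k x := by
  choose p hp1 hp2 hp3 using fun k => hY.mem k
  set c : ℝ := (√(2 * (n : ℝ) + 1))⁻¹ with hc
  have hcc : c ^ 2 * (2 * n + 1) = 1 := by
    rw [hc, inv_pow, Real.sq_sqrt (by positivity)]
    exact inv_mul_cancel₀ (by positivity)
  have hq : ∀ k (x : S2), polyEval (C c * p k) x = c * Y k x := by
    intro k x
    rw [polyEval_mul, polyEval_C, hp3 k x]
    rfl
  have hh : ∀ k, (C c * p k).IsHomogeneous n := fun k => by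
    simpa using (isHomogeneous_C (Fin 3) c).mul (hp1 k)
  refine ⟨fun k => C c * p k, hh, fun k => ?_, ?_, hq⟩
  · have : polyLaplacian (C c * p k) = C c * polyLaplacian (p k) := by
      simp only [polyLaplacian, pderiv_C_mul, Finset.mul_sum]
    rw [this, hp2, mul_zero]
  · refine MvPolynomial.funext fun v => ?_
    set x : Space := WithLp.toLp 2 v with hx
    change polyEval _ x = polyEval _ x
    have e : ∀ (p : MvPolynomial (Fin 3) ℝ) (j : ℕ), polyEval (p ^ j) x = polyEval p x ^ j :=
      fun p j => map_pow _ _ _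
    obtain ⟨u, hu⟩ : ∃ u : S2, x = ‖x‖ • (u : Space) := by
      rcases eq_or_ne x 0 with h0 | h0
      · exact ⟨⟨EuclideanSpace.single 0 1, by simp⟩, by rw [h0]; simp⟩
      · refine ⟨⟨‖x‖⁻¹ • x, by simp [norm_smul, h0]⟩, ?_⟩
        simp [smul_smul, h0]
    have hk : ∀ k, polyEval (C c * p k) x = ‖x‖ ^ n * (c * Y k u) := by
      intro k
      conv_lhs => rw [hu]
      rw [polyEval_smul (hh k), hq]
    have hK := harmonicKernel_self hY hn u
    rw [harmonicKernel] at hK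
    rw [polyEval_sum, e, polyEval_normSqPoly]
    simp only [e, hk]
    calc ∑ k, (‖x‖ ^ n * (c * Y k u)) ^ 2 = ‖x‖ ^ (2 * n) * c ^ 2 * ∑ k, Y k u * Y k u := by
          rw [Finset.mul_sum]
          exact Finset.sum_congr rfl fun k _ => by ring
      _ = (‖x‖ ^ 2) ^ n := by
          rw [hK, mul_assoc, hcc, mul_one, pow_mul]

theorem randomHarmonic_eq_polyEval {Ω : Type*} {n : ℕ} {Y : Idx n → S2 → ℝ}
    {q : Idx n → MvPolynomial (Fin 3) ℝ}
    (hq : ∀ k (x : S2), polyEval (q k) x = (√(2 * (n : ℝ) + 1))⁻¹ * Y k x)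
    (a : Idx n → Ω → ℝ) (ω : Ω) (x : S2) :
    randomHarmonic n a Y ω x = polyEval (polyComb (fun k => a k ω) q) x := by
  rw [randomHarmonic, polyEval_polyComb, Finset.mul_sum]
  refine Finset.sum_congr rfl fun k _ => ?_
  rw [hq]
  ring

end HarmonicPolynomial

/-- Independent variables with mean zero and variance one are orthonormal. -/
theorem orthonormal_of_iIndepFun {ι Ω : Type*} [DecidableEq ι] [MeasurableSpace Ω]
    {P : Measure Ω} [IsProbabilityMeasure P]
    {a : ι → Ω → ℝ} (hm : ∀ k, AEMeasurable (a k) P) (hi : iIndepFun a P)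
    (h0 : ∀ k, ∫ ω, a k ω ∂P = 0) (h1 : ∀ k, ∫ ω, a k ω ^ 2 ∂P = 1) (k l : ι) :
    Integrable (fun ω => a k ω * a l ω) P ∧
      ∫ ω, a k ω * a l ω ∂P = if k = l then 1 else 0 := by
  have hL : ∀ k, MemLp (a k) 2 P := fun k => by
    refine (memLp_two_iff_integrable_sq (hm k).aestronglyMeasurable).2 ?_
    by_contra h
    have := h1 k
    rw [integral_undef h] at this
    exact zero_ne_one this
  refine ⟨(hL k).integrable_mul (hL l), ?_⟩
  split_ifs with h
  · subst h
    simp only [← sq, h1]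
  · rw [(hi.indepFun h).integral_fun_mul_eq_mul_integral (hm k).aestronglyMeasurable
      (hm l).aestronglyMeasurable, h0, zero_mul]

/-! ### Tightness of the local fields -/

section Tightness

variable {R : ℝ}

/-- A bound for the rescaled exponential map in the class of functions with quadratic
approximations, in the form in which the product estimates produce it. -/
def expBound (R : ℝ) : ℝ :=
  R * R * (27 * 4 * (27 * Real.exp (108 * R ^ 2) * Real.exp (108 * R ^ 2))) +
    R * (27 * Real.exp (108 * R ^ 2) * 2)

theorem expBound_nonneg (hR : 0 < R) : 0 ≤ expBound R := by
  unfold expBound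
  positivity

theorem isSmooth_frame_coord (x : S2) (e : Plane ≃ₗᵢ[ℝ] TangentPlane x) (i : Fin 3) :
    IsSmooth 2 fun y => (e y : Space) i := by
  let ℓ : Plane →L[ℝ] ℝ := (EuclideanSpace.proj i : Space →L[ℝ] ℝ) ∘L
    Submodule.subtypeL (ℝ ∙ (x : Space))ᗮ ∘L (e.toContinuousLinearEquiv : Plane →L[ℝ] TangentPlane x)
  refine isSmooth_linear ℓ (ContinuousLinearMap.opNorm_le_bound _ zero_le_one fun y => ?_)
  rw [one_mul, ← e.norm_map y, ← Submodule.norm_coe]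
  exact PiLp.norm_apply_le (e y : Space) i

/-- The displacement `n (exp_x (R y / n) - x)` is bounded in the class uniformly in `n` and `x`. -/
theorem isSmooth_sphereExp_coord (hR : 0 < R) {n : ℕ} (hn : 1 ≤ n) (x : S2)
    (e : Plane ≃ₗᵢ[ℝ] TangentPlane x) (i : Fin 3) : IsSmooth (expBound R) fun y =>
      ((n : ℝ) • ((sphereExp x (e ((R / (n : ℝ)) • y)) : Space) - x) : Space) i := by
  have hn1 : (1 : ℝ) ≤ n := by exact_mod_cast hn
  set s : ℝ := R / n with hs
  have hs0 : 0 ≤ s := by positivity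
  have hsR : s ≤ R := div_le_self hR.le hn1
  have hns : n * s = R := by rw [hs]; field_simp
  have hfun : ∀ y : Plane, ((n : ℝ) • ((sphereExp x (e (s • y)) : Space) - x) : Space) i =
      -(R * s / 2 * (x : Space) i) *
        (‖y‖ ^ 2 * (Real.sinc (s / 2 * ‖y‖) * Real.sinc (s / 2 * ‖y‖))) +
      R * (Real.sinc (s * ‖y‖) * (e y : Space) i) := by
    intro y
    have h1 : ‖e (s • y)‖ = s * ‖y‖ := by rw [norm_frame, abs_of_nonneg hs0]
    have h2 : (e (s • y) : Space) i = s * (e y : Space) i := by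
      rw [map_smul]; rfl
    have h3 : Real.cos (s * ‖y‖) - 1 = -((s * ‖y‖) ^ 2 / 2 * Real.sinc (s / 2 * ‖y‖) ^ 2) := by
      have e1 : Real.sin (s / 2 * ‖y‖) = s / 2 * ‖y‖ * Real.sinc (s / 2 * ‖y‖) := by
        rcases eq_or_ne (s / 2 * ‖y‖) 0 with h0 | h0
        · rw [h0]; simp
        · rw [Real.sinc_of_ne_zero h0, mul_div_cancel₀ _ h0]
      have e2 : s * ‖y‖ = 2 * (s / 2 * ‖y‖) := by ring
      rw [e2, Real.cos_two_mul, Real.cos_sq', e1]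
      ring
    have h4 : ((sphereExp x (e (s • y)) : Space) : Space) i =
        Real.cos (s * ‖y‖) * (x : Space) i + Real.sinc (s * ‖y‖) * (s * (e y : Space) i) := by
      rw [← h2, ← h1]; rfl
    rw [PiLp.smul_apply, PiLp.sub_apply, h4, smul_eq_mul]
    have h5 : Real.cos (s * ‖y‖) = 1 - (s * ‖y‖) ^ 2 / 2 * Real.sinc (s / 2 * ‖y‖) ^ 2 := by
      linarith
    rw [h5, ← hns]
    ring
  have hx : |(x : Space) i| ≤ 1 := by
    have := PiLp.norm_apply_le (x : Space) i
    rwa [norm_eq_of_mem_sphere, Real.norm_eq_abs] at this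
  have hA := isSmooth_sinc (s := s / 2) (R := R) (by positivity) (by linarith)
  have hB := isSmooth_sinc hs0 hsR
  -- `n (cos r - 1)` and `n sin r / r`, for `r = s ‖y‖`, are expressed through `sinc`, which removes
  -- the factor `n`
  have h := ((isSmooth_norm_sq.mul (hA.mul hA)).const_mul (-(R * s / 2 * (x : Space) i))).add
    ((hB.mul (isSmooth_frame_coord x e i)).const_mul R)
  simp only [hfun]
  refine h.mono ?_
  have hc : |-(R * s / 2 * (x : Space) i)| ≤ R * R := by
    rw [abs_neg, abs_mul, abs_of_nonneg (by positivity)]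
    calc R * s / 2 * |(x : Space) i| ≤ R * s / 2 * 1 := by gcongr
      _ ≤ R * R := by nlinarith
  rw [expBound, abs_of_pos hR]
  gcongr

/-- The local field of a homogeneous polynomial is controlled by the derivatives of the polynomial
at the base point. -/
theorem isSmooth_localField (hR : 0 < R) {n : ℕ} (hn : 1 ≤ n) (x : S2)
    (e : Plane ≃ₗᵢ[ℝ] TangentPlane x) {f : S2 → ℝ} {H : MvPolynomial (Fin 3) ℝ}
    (hH : H.IsHomogeneous n) (hf : ∀ z : S2, f z = polyEval H z) :
    IsSmooth (∑ m ∈ Finset.range (n + 1),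
      (27 * expBound R / n) ^ m / m.factorial * derivSum m H x) (localField n R f x e) := by
  have hn1 : (1 : ℝ) ≤ n := by exact_mod_cast hn
  set u : Plane → Space := fun y => (n : ℝ) • ((sphereExp x (e ((R / (n : ℝ)) • y)) : Space) - x)
    with hu
  have hexp : ∀ y, localField n R f x e y = ∑ m ∈ Finset.range (n + 1),
      ((n : ℝ)⁻¹ ^ m / m.factorial) * dirDeriv m H x (u y) := by
    intro y
    rw [localField, hf, ← polyEval_add_smul hH]
    congr 1
    simp only [hu]
    rw [smul_smul, inv_mul_cancel₀ (by positivity), one_smul]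
    abel
  have h := IsSmooth.sum (Finset.range (n + 1)) fun m _ =>
    (isSmooth_dirDeriv (fun i => isSmooth_sphereExp_coord hR hn x e i) m H x).const_mul
      ((n : ℝ)⁻¹ ^ m / m.factorial)
  rw [funext hexp]
  refine h.mono (le_of_eq (Finset.sum_congr rfl fun m _ => ?_))
  rw [abs_of_nonneg (by positivity), div_pow, inv_pow]
  field_simp

variable {Ω : Type*} [MeasurableSpace Ω] {P : Measure Ω} [IsProbabilityMeasure P]
  {Y : ∀ n : ℕ, Idx n → S2 → ℝ} {a : ∀ n : ℕ, Idx n → Ω → ℝ}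
  {e : ∀ x : S2, Plane ≃ₗᵢ[ℝ] TangentPlane x}

/-- The local fields lie in a fixed ball of the class with high probability: the Taylor coefficients at
the base point are bounded in mean, so Markov's inequality applies. -/
theorem exists_eventually_cutoff_localField (hY : ∀ n, IsHarmonicONB n (Y n))
    (ha_meas : ∀ n k, AEMeasurable (a n k) P) (ha_indep : ∀ n, iIndepFun (a n) P)
    (ha_mean : ∀ n k, ∫ ω, a n k ω ∂P = 0) (ha_var : ∀ n k, ∫ ω, a n k ω ^ 2 ∂P = 1)
    (hR : 0 < R) {δ : ℝ≥0∞} (hδ : δ ≠ 0) : ∃ M : ℝ, ∀ᶠ n : ℕ in atTop,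
      (P.prod rho) {p | cutoff (localField n R (randomHarmonic n (a n) (Y n) p.1) p.2 (e p.2)) ∉
        smoothClass M} ≤ δ := by
  rcases eq_or_ne δ ⊤ with rfl | hδt
  · exact ⟨0, Eventually.of_forall fun _ => le_top⟩
  have hδ0 : 0 < δ.toReal := ENNReal.toReal_pos hδ hδt
  set K : ℝ := Real.exp (81 * expBound R) with hK
  have hK0 : 0 < K := Real.exp_pos _
  have hM0 : 0 < K / δ.toReal := by positivity
  refine ⟨K / δ.toReal, ?_⟩
  filter_upwards [eventually_ge_atTop 1] with n hn
  have hn1 : (1 : ℝ) ≤ n := by exact_mod_cast hn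
  have hB := expBound_nonneg hR
  obtain ⟨q, hq1, hq2, hq3, hq4⟩ := (hY n).exists_poly hn
  set c : ℕ → ℝ := fun m => (27 * expBound R / n) ^ m / m.factorial with hc
  have hc0 : ∀ m, 0 ≤ c m := fun m => by positivity
  set D : ℕ → Ω × S2 → ℝ := fun m p => derivSum m (polyComb (fun k => a n k p.1) q) p.2 with hD
  have hD0 : ∀ m p, 0 ≤ D m p := fun m p => derivSum_nonneg _ _ _
  have hDm : ∀ m, AEMeasurable (D m) (P.prod rho) := fun m =>
    aemeasurable_derivSum (α := fun k (p : Ω × S2) => a n k p.1)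
      (ξ := fun p : Ω × S2 => (p.2 : Space)) (fun k => (ha_meas n k).comp_fst)
      (measurable_subtype_coe.comp measurable_snd).aemeasurable m q
  set S : Ω × S2 → ℝ≥0∞ := fun p => ∑ m ∈ Finset.range (n + 1),
    ENNReal.ofReal (c m) * ENNReal.ofReal (D m p) with hS
  have hSm : AEMeasurable S (P.prod rho) := Finset.aemeasurable_fun_sum _ fun m _ =>
    (hDm m).ennreal_ofReal.const_mul _
  have hSint : ∫⁻ p, S p ∂(P.prod rho) ≤ ENNReal.ofReal K := by
    simp only [hS]
    rw [lintegral_finsetSum' _ fun m _ => (hDm m).ennreal_ofReal.const_mul _]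
    calc _ ≤ ∑ m ∈ Finset.range (n + 1),
          ENNReal.ofReal (c m) * ENNReal.ofReal ((3 * (n : ℝ)) ^ m) := by
          refine Finset.sum_le_sum fun m _ => ?_
          rw [lintegral_const_mul'' _ (hDm m).ennreal_ofReal]
          gcongr
          rw [lintegral_prod_symm _ (hDm m).ennreal_ofReal]
          calc _ ≤ ∫⁻ _, ENNReal.ofReal ((3 * (n : ℝ)) ^ m) ∂rho := by
                refine lintegral_mono fun x => ?_
                have ho := orthonormal_of_iIndepFun (ha_meas n) (ha_indep n) (ha_mean n) (ha_var n)
                exact lintegral_derivSum_le (ha_meas n) (fun k l => (ho k l).1)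
                  (fun k l => (ho k l).2) hn hq2 hq3 (norm_eq_of_mem_sphere x) m
            _ = _ := by simp
      _ = ENNReal.ofReal (∑ m ∈ Finset.range (n + 1), (81 * expBound R) ^ m / m.factorial) := by
          rw [ENNReal.ofReal_sum_of_nonneg fun m _ => by positivity]
          refine Finset.sum_congr rfl fun m _ => ?_
          rw [← ENNReal.ofReal_mul (hc0 m)]
          congr 1
          simp only [hc]
          rw [div_mul_eq_mul_div, ← mul_pow]
          congr 2
          field_simp
          ring
      _ ≤ _ := ENNReal.ofReal_le_ofReal (Real.sum_le_exp_of_nonneg (by positivity) _)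
  have hsub : {p : Ω × S2 | cutoff (localField n R (randomHarmonic n (a n) (Y n) p.1) p.2 (e p.2)) ∉
      smoothClass (K / δ.toReal)} ⊆ {p | ENNReal.ofReal (K / δ.toReal) ≤ S p} := by
    intro p hp
    by_contra hlt
    simp only [Set.mem_ofPred_eq, not_le] at hlt
    apply hp
    rw [cutoff_mem_smoothClass_iff]
    refine (isSmooth_localField hR hn p.2 (e p.2) (isHomogeneous_polyComb (fun k => a n k p.1) hq1)
      fun z => randomHarmonic_eq_polyEval hq4 (a n) p.1 z).mono ?_
    have e1 : S p = ENNReal.ofReal (∑ m ∈ Finset.range (n + 1), c m * D m p) := by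
      simp only [hS]
      rw [ENNReal.ofReal_sum_of_nonneg fun m _ => mul_nonneg (hc0 m) (hD0 m p)]
      exact Finset.sum_congr rfl fun m _ => (ENNReal.ofReal_mul (hc0 m)).symm
    rw [e1] at hlt
    exact ((ENNReal.ofReal_lt_ofReal_iff hM0).1 hlt).le
  calc _ ≤ (P.prod rho) {p | ENNReal.ofReal (K / δ.toReal) ≤ S p} := measure_mono hsub
    _ ≤ (∫⁻ p, S p ∂(P.prod rho)) / ENNReal.ofReal (K / δ.toReal) :=
        meas_ge_le_lintegral_div hSm (by simpa using hM0) ENNReal.ofReal_ne_top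
    _ ≤ ENNReal.ofReal K / ENNReal.ofReal (K / δ.toReal) := by gcongr
    _ = δ := by
        rw [← ENNReal.ofReal_div_of_pos hM0]
        have : K / (K / δ.toReal) = δ.toReal := by field_simp
        rw [this, ENNReal.ofReal_toReal hδt]

end Tightness

/-! ### A measurable moving frame of the sphere -/

/-- A unit tangent vector field on the sphere, discontinuous at the poles only. -/
def tangentField (x : S2) : Space :=
  if (x : Space) 0 ^ 2 + (x : Space) 1 ^ 2 = 0 then !₂[1, 0, 0]
  else !₂[-((x : Space) 1 / √((x : Space) 0 ^ 2 + (x : Space) 1 ^ 2)),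
    (x : Space) 0 / √((x : Space) 0 ^ 2 + (x : Space) 1 ^ 2), 0]

/-- The cross product of the base point with `tangentField`. -/
def tangentField' (x : S2) : Space :=
  !₂[(x : Space) 1 * tangentField x 2 - (x : Space) 2 * tangentField x 1,
    (x : Space) 2 * tangentField x 0 - (x : Space) 0 * tangentField x 2,
    (x : Space) 0 * tangentField x 1 - (x : Space) 1 * tangentField x 0]

theorem measurable_coord (i : Fin 3) : Measurable fun x : S2 => (x : Space) i :=
  (by fun_prop : Continuous fun x : S2 => (x : Space) i).measurable

theorem measurable_toLp {v : S2 → Fin 3 → ℝ} (hv : ∀ i, Measurable fun x => v x i) :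
    Measurable fun x => (WithLp.toLp 2 (v x) : Space) :=
  (PiLp.continuous_toLp 2 _).measurable.comp (measurable_pi_lambda _ hv)

theorem measurable_tangentField : Measurable tangentField := by
  have h0 := measurable_coord 0
  have h1 := measurable_coord 1
  refine Measurable.ite ?_ measurable_const (measurable_toLp fun i => ?_)
  · exact measurableSet_eq_fun ((h0.pow_const 2).add (h1.pow_const 2)) measurable_const
  · have hs := ((h0.pow_const 2).add (h1.pow_const 2)).sqrt
    fin_cases i
    · exact (h1.div hs).neg
    · exact h0.div hs
    · exact measurable_const

theorem measurable_tangentField' : Measurable tangentField' := by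
  have hc := measurable_coord
  have ht : ∀ i, Measurable fun x => tangentField x i := fun i =>
    (by fun_prop : Continuous fun x : Space => x i).measurable.comp measurable_tangentField
  refine measurable_toLp fun i => ?_
  fin_cases i
  · exact ((hc 1).mul (ht 2)).sub ((hc 2).mul (ht 1))
  · exact ((hc 2).mul (ht 0)).sub ((hc 0).mul (ht 2))
  · exact ((hc 0).mul (ht 1)).sub ((hc 1).mul (ht 0))

theorem sum_sq_coord (x : S2) :
    (x : Space) 0 ^ 2 + (x : Space) 1 ^ 2 + (x : Space) 2 ^ 2 = 1 := by
  have h := EuclideanSpace.norm_sq_eq (x : Space)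
  rw [norm_eq_of_mem_sphere, Fin.sum_univ_three] at h
  simpa using h.symm

theorem tangentField_spec (x : S2) :
    tangentField x 0 ^ 2 + tangentField x 1 ^ 2 + tangentField x 2 ^ 2 = 1 ∧
      (x : Space) 0 * tangentField x 0 + (x : Space) 1 * tangentField x 1 +
        (x : Space) 2 * tangentField x 2 = 0 := by
  rw [tangentField]
  split_ifs with h
  · have h0 : (x : Space) 0 = 0 := by nlinarith [sq_nonneg ((x : Space) 0), sq_nonneg ((x : Space) 1)]
    simp [h0]
  · have hr : 0 < (x : Space) 0 ^ 2 + (x : Space) 1 ^ 2 := lt_of_le_of_ne (by positivity) (Ne.symm h)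
    have hs := Real.sq_sqrt hr.le
    have hs0 := (Real.sqrt_pos.2 hr).ne'
    set r := √((x : Space) 0 ^ 2 + (x : Space) 1 ^ 2)
    constructor
    · simp only [Matrix.cons_val]
      field_simp
      linarith
    · simp only [Matrix.cons_val]
      field_simp
      ring

theorem inner_space (u v : Space) : inner ℝ u v = u 0 * v 0 + u 1 * v 1 + u 2 * v 2 := by
  rw [PiLp.inner_apply, Fin.sum_univ_three]
  simp only [RCLike.inner_apply, conj_trivial]
  ring

/-- The tangent planes can be identified with the plane in a measurable way. Given identifications
need not be measurable; they are exchanged for these by `localCount_eq`. -/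
theorem exists_measurable_frame : ∃ e : ∀ x : S2, Plane ≃ₗᵢ[ℝ] TangentPlane x,
    ∀ y, Measurable fun x => (e x y : Space) := by
  have h : ∀ x : S2, ∃ e : Plane ≃ₗᵢ[ℝ] TangentPlane x,
      ∀ y, (e y : Space) = y 0 • tangentField x + y 1 • tangentField' x := by
    intro x
    obtain ⟨h1, h2⟩ := tangentField_spec x
    have h3 := sum_sq_coord x
    have hv : tangentField x ∈ (ℝ ∙ (x : Space))ᗮ := by
      rw [Submodule.mem_orthogonal_singleton_iff_inner_right, inner_space, h2]
    have hw : tangentField' x ∈ (ℝ ∙ (x : Space))ᗮ := by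
      rw [Submodule.mem_orthogonal_singleton_iff_inner_right, inner_space, tangentField']
      simp only [Matrix.cons_val]
      ring
    have hvn : ‖(⟨tangentField x, hv⟩ : TangentPlane x)‖ = 1 := by
      rw [← Submodule.norm_coe, norm_eq_sqrt_real_inner, inner_space, ← sq, ← sq, ← sq, h1,
        Real.sqrt_one]
    have hwn : ‖(⟨tangentField' x, hw⟩ : TangentPlane x)‖ = 1 := by
      rw [← Submodule.norm_coe, norm_eq_sqrt_real_inner, inner_space]
      simp only [tangentField', Matrix.cons_val]
      set a := (x : Space) 0
      set b := (x : Space) 1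
      set c := (x : Space) 2
      set p := tangentField x 0
      set q := tangentField x 1
      set r := tangentField x 2
      -- Lagrange's identity
      have e : (b * r - c * q) * (b * r - c * q) + (c * p - a * r) * (c * p - a * r) +
          (a * q - b * p) * (a * q - b * p) =
          (a ^ 2 + b ^ 2 + c ^ 2) * (p ^ 2 + q ^ 2 + r ^ 2) - (a * p + b * q + c * r) ^ 2 := by ring
      rw [e, h1, h2, h3]
      simp
    have hvw : inner ℝ (⟨tangentField x, hv⟩ : TangentPlane x) ⟨tangentField' x, hw⟩ = 0 := by
      rw [Submodule.coe_inner, inner_space]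
      simp only [tangentField', Matrix.cons_val]
      ring
    have hb : Orthonormal ℝ (![⟨tangentField x, hv⟩, ⟨tangentField' x, hw⟩] :
        Fin 2 → TangentPlane x) := by
      rw [orthonormal_vecCons_iff, orthonormal_vecCons_iff]
      refine ⟨hvn, fun i => ?_, hwn, fun i => i.elim0, ?_⟩
      · fin_cases i
        exact hvw
      · exact ⟨fun i => i.elim0, fun i => i.elim0⟩
    have : Fact (Module.finrank ℝ Space = 2 + 1) := ⟨by simp⟩
    have hx0 : (x : Space) ≠ 0 := ne_zero_of_mem_unit_sphere x
    have hcard : Fintype.card (Fin 2) = Module.finrank ℝ (TangentPlane x) := by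
      rw [Submodule.finrank_orthogonal_span_singleton (n := 2) hx0, Fintype.card_fin]
    have hcoe := coe_basisOfOrthonormalOfCardEqFinrank hb hcard
    have hon : Orthonormal ℝ (basisOfOrthonormalOfCardEqFinrank hb hcard) := by rwa [hcoe]
    refine ⟨((basisOfOrthonormalOfCardEqFinrank hb hcard).toOrthonormalBasis hon).repr.symm,
      fun y => ?_⟩
    rw [← OrthonormalBasis.sum_repr_symm, Module.Basis.coe_toOrthonormalBasis, hcoe,
      Fin.sum_univ_two]
    rfl
  choose e he using h
  refine ⟨e, fun y => ?_⟩
  simp only [he]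
  exact (measurable_tangentField.const_smul (y 0)).add (measurable_tangentField'.const_smul (y 1))

/-- The number of nodal domains does not depend on the identification of the tangent plane. -/
theorem localCount_eq (n : ℕ) (R : ℝ) (f : S2 → ℝ) (x : S2) (e e' : Plane ≃ₗᵢ[ℝ] TangentPlane x) :
    localCount n R f x e = localCount n R f x e' := by
  rw [localCount, localCount,
    ← nodalCount_comp_isometry (e.trans e'.symm) (localField n R f x e')]
  congr 1
  funext y
  simp only [localField, LinearIsometryEquiv.trans_apply, ← map_smul,
    LinearIsometryEquiv.apply_symm_apply]

theorem continuous_localField {n : ℕ} {R : ℝ} {f : S2 → ℝ} (hf : Continuous f) (x : S2)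
    (e : Plane ≃ₗᵢ[ℝ] TangentPlane x) : Continuous (localField n R f x e) := by
  refine hf.comp ?_
  unfold sphereExp
  refine Continuous.subtype_mk ?_ _
  have he : Continuous fun y => e ((R / (n : ℝ)) • y) := e.continuous.comp (by fun_prop)
  exact ((Real.continuous_cos.comp he.norm).smul continuous_const).add
    ((Real.continuous_sinc.comp he.norm).smul (continuous_subtype_val.comp he))

/-! ### Convergence of the number of nodal domains -/

section Convergence

variable {Ω Ω' : Type*} [MeasurableSpace Ω] [MeasurableSpace Ω'] {P : Measure Ω}
  [IsProbabilityMeasure P] {P' : Measure Ω'}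
  {Y : ∀ n : ℕ, Idx n → S2 → ℝ} {a : ∀ n : ℕ, Idx n → Ω → ℝ} {F : Plane → Ω' → ℝ}
  {e : ∀ x : S2, Plane ≃ₗᵢ[ℝ] TangentPlane x} {R : ℝ}

/-- The finite dimensional distributions of the local fields converge to those of the rescaled
random plane wave. -/
theorem fddLimsup_localField [IsProbabilityMeasure P'] (hY : ∀ n, IsHarmonicONB n (Y n)) (ha_indep : ∀ n, iIndepFun (a n) P)
    (ha_ident : ∀ n k m l, IdentDistrib (a n k) (a m l) P P)
    (ha_mean : ∀ n k, ∫ ω, a n k ω ∂P = 0) (ha_var : ∀ n k, ∫ ω, a n k ω ^ 2 ∂P = 1)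
    (hF : IsRandomPlaneWave F P') (he : ∀ y, Measurable fun x => (e x y : Space)) (hR : 0 < R) :
    FddLimsup (P.prod rho) P'
      (fun n p => localField n R (randomHarmonic n (a n) (Y n) p.1) p.2 (e p.2))
      (fun ω y => F (R • y) ω) := by
  have ha_meas : ∀ n k, AEMeasurable (a n k) P := fun n k => (ha_ident n k n k).aemeasurable_fst
  let k0 : Idx 0 := ⟨0, by simp⟩
  refine fddLimsup_of_tendsto
    (fun n p _ => aemeasurable_localField (hY n) (ha_meas n) he R p)
    (fun p _ => hF.gaussian.aemeasurable _) fun s hs t => ?_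
  have h := tendsto_integral_exp_localField hY ha_meas he ha_indep
    (φ := charFun (P.map (a 0 k0))) (fun n k => by rw [(ha_ident n k 0 k0).map_eq])
    (fun ε hε => exists_charFun_close (ha_meas 0 k0) (ha_mean 0 k0) (ha_var 0 k0) hε) hR
    (fun p : s => (p : Plane)) (fun p => hs p.2) t
  rw [isRandomPlaneWave_integral_exp hF (fun p : s => R • (p : Plane)) t]
  simpa only [← smul_sub, norm_smul, Real.norm_eq_abs, abs_of_pos hR] using h

theorem norm_gridPoint_sub {N : ℕ} (hN : 1 ≤ N) (i j : ℤ) :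
    ‖gridPoint N i j - gridPoint N (i + 1) j‖ = 1 / N := by
  have hN0 : (0 : ℝ) < N := by exact_mod_cast hN
  have e : gridPoint N i j - gridPoint N (i + 1) j = EuclideanSpace.single 0 (-(1 / (N : ℝ))) := by
    ext k
    fin_cases k
    · simp [gridPoint]
      field_simp
      ring
    · simp [gridPoint]
  rw [e, PiLp.norm_single, norm_neg, Real.norm_eq_abs, abs_of_pos (by positivity)]

/-- Almost surely the random plane wave is regular: it has no critical zeros, and its zero set is
nowhere tangent to the circle of radius `R`. -/
theorem measure_randomPlaneWave_not_regular (hF : IsRandomPlaneWave F P') (hR : 0 < R) (M : ℝ) :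
    P' {ω | cutoff (fun y => F (R • y) ω) ∈ smoothClass M ∧
      ¬ IsRegularOn M (cutoff fun y => F (R • y) ω)} = 0 := by
  obtain ⟨κ, hκ, hJ⟩ := exists_le_one_sub_besselJ
  refine measure_not_regular_eq_zero (Z := fun y ω => F (R • y) ω) (κ := κ * R ^ 2)
    (hF.gaussian.comp_right fun y => R • y) (fun x => hF.centered _) (fun x => ?_)
    (by positivity) ?_ M
  · rw [hF.integral_mul, sub_self, norm_zero, isBessel_besselJ.apply_zero]
  · filter_upwards [eventually_ge_atTop (max 1 ⌈R⌉₊)] with N hN i j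
    have hN1 : 1 ≤ N := (le_max_left _ _).trans hN
    have hNR : R ≤ N := (Nat.le_ceil R).trans (by exact_mod_cast (le_max_right _ _).trans hN)
    have hN0 : (0 : ℝ) < N := by exact_mod_cast hN1
    rw [hF.integral_mul, ← smul_sub, norm_smul, norm_gridPoint_sub hN1, Real.norm_eq_abs,
      abs_of_pos hR]
    have := hJ (R * (1 / N)) (by
      rw [abs_of_pos (by positivity), mul_one_div]
      exact (div_le_one hN0).2 hNR)
    rw [mul_pow, ← mul_assoc] at this
    exact this

theorem tendstoInDistribution_localCount [IsProbabilityMeasure P'] (hY : ∀ n, IsHarmonicONB n (Y n))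
    (ha_indep : ∀ n, iIndepFun (a n) P)
    (ha_ident : ∀ n k m l, IdentDistrib (a n k) (a m l) P P)
    (ha_mean : ∀ n k, ∫ ω, a n k ω ∂P = 0) (ha_var : ∀ n k, ∫ ω, a n k ω ^ 2 ∂P = 1)
    (hF : IsRandomPlaneWave F P') (e : ∀ x : S2, Plane ≃ₗᵢ[ℝ] TangentPlane x) (hR : 0 < R) :
    (∀ᵐ ω ∂P', planarCount (fun y => F y ω) R ≠ ⊤) ∧
    TendstoInDistribution
      (fun (n : ℕ) (p : Ω × S2) =>
        ((localCount n R (randomHarmonic n (a n) (Y n) p.1) p.2 (e p.2) : ℕ∞) : ℝ≥0∞))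
      atTop (fun ω => ((planarCount (fun y => F y ω) R : ℕ∞) : ℝ≥0∞))
      (fun _ => P.prod rho) P' := by
  obtain ⟨e', he'⟩ := exists_measurable_frame
  have ha_meas : ∀ n k, AEMeasurable (a n k) P := fun n k => (ha_ident n k n k).aemeasurable_fst
  have hcont : ∀ ω, Continuous fun y => F (R • y) ω := fun ω =>
    (hF.continuous ω).comp (continuous_const_smul R)
  have hplanar : ∀ ω, planarCount (fun y => F y ω) R =
      nodalCount (Metric.closedBall 0 1) (fun y => F (R • y) ω) 1 := fun ω => by
    rw [planarCount_eq_nodalCount (hF.continuous ω), ← nodalCount_comp_smul hR]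
  have hlocal : ∀ (n : ℕ) (p : Ω × S2),
      localCount n R (randomHarmonic n (a n) (Y n) p.1) p.2 (e p.2) = nodalCount
        (Metric.closedBall 0 1) (localField n R (randomHarmonic n (a n) (Y n) p.1) p.2 (e' p.2)) 1 :=
    fun n p => localCount_eq n R _ p.2 (e p.2) (e' p.2)
  have hf : ∀ n ω, Continuous (randomHarmonic n (a n) (Y n) ω) := fun n ω =>
    continuous_const.mul (continuous_finsetSum _ fun k _ =>
      continuous_const.mul ((hY n).continuous k))
  simp only [hplanar, hlocal]
  obtain ⟨h1, h2⟩ := nodalCount_limit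
    (fddLimsup_localField hY ha_indep ha_ident ha_mean ha_var hF he' hR)
    (fun ω => (hcont ω).continuousOn) (fun p _ => hF.gaussian.aemeasurable _)
    (fun δ hδ => exists_eventually_cutoff_localField hY ha_meas ha_indep ha_mean ha_var hR hδ)
    (fun M => measure_randomPlaneWave_not_regular hF hR M)
  refine ⟨h1, tendstoInDistribution_of_eventually_le (fun n => ?_) ?_ h1 h2⟩
  · exact aemeasurable_nodalCount
      (fun p => (continuous_localField (hf n p.1) p.2 (e' p.2)).continuousOn)
      fun y _ => aemeasurable_localField (hY n) (ha_meas n) he' R y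
  · exact aemeasurable_nodalCount (fun ω => (hcont ω).continuousOn)
      fun y _ => hF.gaussian.aemeasurable _

end Convergence

end

end NodalUniversality

theorem mainTheorem2
    {Ω Ω' : Type*} [MeasurableSpace Ω] [MeasurableSpace Ω']
    (P : Measure Ω) [IsProbabilityMeasure P] (P' : Measure Ω') [IsProbabilityMeasure P']
    -- orthonormal bases of the spherical harmonics of each degree
    (Y : ∀ n : ℕ, NodalUniversality.Idx n → NodalUniversality.S2 → ℝ)
    (hY : ∀ n, NodalUniversality.IsHarmonicONB n (Y n))
    -- i.i.d. coefficients with mean zero and variance one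
    (a : ∀ n : ℕ, NodalUniversality.Idx n → Ω → ℝ)
    (ha_indep : ∀ n, iIndepFun (a n) P)
    (ha_ident : ∀ n k m l, IdentDistrib (a n k) (a m l) P P)
    (ha_mean : ∀ n k, ∫ ω, a n k ω ∂P = 0)
    (ha_var : ∀ n k, ∫ ω, a n k ω ^ 2 ∂P = 1)
    -- the random plane wave
    (F : NodalUniversality.Plane → Ω' → ℝ) (hF : NodalUniversality.IsRandomPlaneWave F P')
    -- the identifications of the tangent planes with `ℝ²`
    (e : ∀ x : NodalUniversality.S2,
      NodalUniversality.Plane ≃ₗᵢ[ℝ] NodalUniversality.TangentPlane x)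
    (R : ℝ) (hR : 0 < R) :
    (∀ᵐ ω ∂P', NodalUniversality.planarCount (fun y => F y ω) R ≠ ⊤) ∧
    TendstoInDistribution
      (fun (n : ℕ) (p : Ω × NodalUniversality.S2) =>
        ((NodalUniversality.localCount n R
          (NodalUniversality.randomHarmonic n (a n) (Y n) p.1) p.2 (e p.2) : ℕ∞) : ℝ≥0∞))
      atTop
      (fun ω => ((NodalUniversality.planarCount (fun y => F y ω) R : ℕ∞) : ℝ≥0∞))
      (fun _ => P.prod NodalUniversality.rho) P' := by
  exact NodalUniversality.tendstoInDistribution_localCount hY ha_indep ha_ident ha_mean ha_var hF e hR
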